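/- Let $k$ be a field of characteristic zero, $\mathcal H$ a Hopf algebra over $k$ with invertible antipode $\gamma$, and $\mathcal L$ an $\mathcal H$-base algebra: a left $\mathcal H$-module algebra (action $\triangleright$) and left $\mathcal H$-comodule algebra (coaction $\delta(\lambda)=\lambda^{(1)}\otimes\lambda^{[\infty]}$) that is a Yetter–Drinfeld module and satisfies $\lambda\mu=(\lambda^{(1)}\triangleright\mu)\lambda^{[\infty]}$. Let $\mathcal U\supset\mathcal H$ be a quasitriangular Hopf algebra with universal R-matrix $\mathcal R$, containing $\mathcal H$ as a Hopf subalgebra, and let $\mathcal F=\mathcal F_1\otimes\mathcal F_2\otimes\mathcal F_{\mathcal L}\in\mathcal U\otimes\mathcal U\otimes\mathcal L$ be a dynamical twist: an invertible element with $\Delta(h^{(1)})(\mathcal F_1\otimes\mathcal F_2)\otimes h^{(2)}\triangleright\mathcal F_{\mathcal L}=(\mathcal F_1\otimes\mathcal F_2)\Delta(h)\otimes\mathcal F_{\mathcal L}$ for all $h\in\mathcal H$, with $$(\Delta\otimes\mathrm{id}\otimes\mathrm{id})(\mathcal F)\cdot(\mathrm{id}\otimes\mathrm{id}\otimes\delta)(\mathcal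 F)=(\mathrm{id}\otimes\Delta\otimes\mathrm{id})(\mathcal F)\cdot(1\otimes\mathcal F)\quad\text{in }\mathcal U^{\otimes3}\otimes\mathcal L,$$ and with $(\varepsilon\otimes\mathrm{id}\otimes\mathrm{id})(\mathcal F)=1=(\mathrm{id}\otimes\varepsilon\otimes\mathrm{id})(\mathcal F)$. Put $\bar{\mathcal F}=\mathcal F^{-1}$ and $\tilde{\mathcal R}=\bar{\mathcal F}_{21}\mathcal R\mathcal F$. Let $\rho\colon\mathcal U\to\mathrm{End}(V)$ be a finite-dimensional representation in matrix form, $P$ the flip of $V\otimes V$, $R=\rho^{\otimes2}(\mathcal R)$, $\tilde R=(\rho^{\otimes2}\otimes\mathrm{id})(\tilde{\mathcal R})$, $S=PR$ and $\tilde S=P\tilde R\in\mathrm{End}(V)^{\otimes2}\otimes\mathcal L$. The subscript $op$ denotes opposite multiplication; $T$ is the matrix of generators $T^i_j$. *The dFRT algebra.* Let $\mathfrak F(T)=k\langle T^i_j\rangle\rtimes(\mathcal L_{op}\otimes\mathcal L)$ be the smash product with the permutation relations $\lambda T=T\rho(\lambda^{(1)})\lambda^{[\infty]}$ for $\lambda\in\mathcal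 L$ and $\mu T=\rho(\mu^{(1)})T\mu^{[\infty]}$ for $\mu\in\mathcal L_{op}$. The dFRT algebra $\tilde{\mathcal T}$ is the quotient of $\mathfrak F(T)$ by the two-sided ideal generated by the relations $\tilde S_{op}T_1T_2=T_1T_2\tilde S$, where, writing $\tilde S=\tilde S_1\otimes\tilde S_2\otimes\tilde S_{\mathcal L}$ and $\delta(\tilde S_{\mathcal L})=h\otimes\tilde S_{\mathcal L}^{[\infty]}$, one puts $\tilde S_{op}=\tilde S_1\rho(\gamma h^{(2)})\otimes\tilde S_2\rho(\gamma h^{(1)})\otimes\tilde S_{\mathcal L}^{[\infty]}$; the coefficients of $\tilde S_{op}$ and of $\tilde S$ are taken in $\mathcal L_{op}$ and in $\mathcal L$, respectively. *The twisted FRT algebra.* Let $\mathcal T$ be the FRT algebra generated by the $T^i_j$ with relations $ST_1T_2=T_1T_2S$. It is a left $\mathcal U_{op}\otimes\mathcal U$-module algebra with $(y\otimes x)\blacktriangleright T=\rho(y)T\rho(x)$. Let $\tilde{\mathcal T}'$ be the space $\mathcal T\otimes\mathcal M$, $\mathcal M=\mathcal L_{op}\otimes\mathcal L$, with the multiplication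 twisted by the dynamical twist $\mathcal G=\bar{\mathcal F}\otimes\mathcal F=\mathcal G_1\otimes\mathcal G_2\otimes\mathcal G_{\mathcal M}$, viewed in $(\mathcal U_{op}\otimes\mathcal U)^{\otimes2}\otimes\mathcal M$ (with $\bar{\mathcal F}\in\mathcal U_{op}\otimes\mathcal U_{op}\otimes\mathcal L_{op}$): $$(a\otimes m)*(b\otimes n)=(\mathcal G_1\blacktriangleright a)\,\bigl(\mathcal G_2\,m^{(1)}\blacktriangleright b\bigr)\otimes\mathcal G_{\mathcal M}\,m^{[\infty]}\,n ,$$ where $m\mapsto m^{(1)}\otimes m^{[\infty]}$ is the coaction of $\mathcal H_{op}\otimes\mathcal H$ on $\mathcal M$ given by $\delta$ on both factors. This is the ordinary multiplication of $\mathcal T\otimes\mathcal L_{op}\otimes\mathcal L$ composed with the action of the bialgebroid twist associated with $\bar{\mathcal F}\otimes\mathcal F$. Then $\tilde{\mathcal T}'$ is isomorphic to the dFRT algebra $\tilde{\mathcal T}$ of $\tilde S$: there is a $k$-linear bijection $\Phi\colon\tilde{\mathcal T}\to\tilde{\mathcal T}'$ with $\Phi(xy)=\Phi(x)*\Phi(y)$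 and $\Phi(1)=1$, which sends $T^i_j\mapsto T^i_j\otimes1\otimes1$, $\mu\mapsto1\otimes\mu\otimes1$ for $\mu\in\mathcal L_{op}$, and $\lambda\mapsto1\otimes1\otimes\lambda$ for $\lambda\in\mathcal L$. -/

import Mathlib

open scoped TensorProduct

noncomputable section

namespace DynFRT

open Coalgebra TensorProduct

/-! ## Base algebras, universal R-matrices and dynamical twists -/

section Hopf

variable (k : Type*) [Field k]

/-- An `H`-base algebra structure on an algebra `L` over a bialgebra `H`: a left `H`-module algebra
and left `H`-comodule algebra which is a Yetter-Drinfeld module and is commutative in the sense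
`a b = (a₍₁₎ ▷ b) a₍∞₎`, where `δ a = a₍₁₎ ⊗ a₍∞₎`. -/
structure BaseAlgebra (H L : Type*) [Ring H] [Bialgebra k H] [Ring L] [Algebra k L] where
  /-- the left action `h ▷ a` -/
  act : H →ₐ[k] Module.End k L
  /-- the left coaction `δ`, a homomorphism of algebras -/
  coact : L →ₐ[k] H ⊗[k] L
  /-- `h ▷ 1 = ε(h) 1` -/
  act_one : ∀ h : H, act h 1 = algebraMap k L (counit h)
  /-- `h ▷ (a b) = (h₍₁₎ ▷ a) (h₍₂₎ ▷ b)` -/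
  act_mul : ∀ (h : H) (a b : L), act h (a * b) =
    LinearMap.mul' k L
      (TensorProduct.map (act.toLinearMap.flip a) (act.toLinearMap.flip b) (comul (R := k) h))
  /-- `(ε ⊗ id) δ = id` -/
  coact_counit : ∀ a : L,
    TensorProduct.lid k L ((counit (R := k) (A := H)).rTensor L (coact a)) = a
  /-- `(Δ ⊗ id) δ = (id ⊗ δ) δ` -/
  coact_coassoc : ∀ a : L,
    TensorProduct.assoc k H H L ((comul (R := k) (A := H)).rTensor L (coact a)) =
      coact.toLinearMap.lTensor H (coact a)
  /-- `h₍₁₎ a₍₁₎ ⊗ h₍₂₎ ▷ a₍∞₎ = (h₍₁₎ ▷ a)₍₁₎ h₍₂₎ ⊗ (h₍₁₎ ▷ a)₍∞₎` -/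
  yetterDrinfeld : ∀ (h : H) (a : L),
    TensorProduct.map₂ (LinearMap.mul k H) act.toLinearMap (comul (R := k) h) (coact a) =
      LinearMap.mul' k (H ⊗[k] L)
        (TensorProduct.map (coact.toLinearMap ∘ₗ act.toLinearMap.flip a)
          (Algebra.TensorProduct.includeLeft (R := k) (S := k) (A := H) (B := L)).toLinearMap
          (comul (R := k) h))
  /-- `a b = (a₍₁₎ ▷ b) a₍∞₎` -/
  quasiComm : ∀ a b : L, a * b =
    LinearMap.mul' k L (TensorProduct.map (act.toLinearMap.flip b) LinearMap.id (coact a))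

variable {U : Type*} [Ring U] [Bialgebra k U]

/-- Embedding `u ⊗ v ↦ u ⊗ 1 ⊗ v` of `U ⊗ U` into `U ⊗ U ⊗ U`. -/
def leg13 : U ⊗[k] U →ₗ[k] (U ⊗[k] U) ⊗[k] U :=
  ((TensorProduct.mk k U U).flip 1).rTensor U

/-- Embedding `u ⊗ v ↦ 1 ⊗ u ⊗ v` of `U ⊗ U` into `U ⊗ U ⊗ U`. -/
def leg23 : U ⊗[k] U →ₗ[k] (U ⊗[k] U) ⊗[k] U :=
  ((TensorProduct.mk k U U) 1).rTensor U

/-- Embedding `u ⊗ v ↦ u ⊗ v ⊗ 1` of `U ⊗ U` into `U ⊗ U ⊗ U`. -/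
def leg12 : U ⊗[k] U →ₗ[k] (U ⊗[k] U) ⊗[k] U :=
  (TensorProduct.mk k (U ⊗[k] U) U).flip 1

/-- `R` is a universal R-matrix (quasitriangular structure) of the bialgebra `U`. -/
structure IsUniversalRMatrix (R : (U ⊗[k] U)ˣ) : Prop where
  /-- `R Δ(x) = Δᵒᵖ(x) R` -/
  intertwine : ∀ x : U,
    (R : U ⊗[k] U) * comul (R := k) x = TensorProduct.comm k U U (comul (R := k) x) * R
  /-- `(Δ ⊗ id) R = R₁₃ R₂₃` -/
  comul_left : (comul (R := k) (A := U)).rTensor U (R : U ⊗[k] U) = leg13 k R * leg23 k R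
  /-- `(id ⊗ Δ) R = R₁₃ R₁₂` -/
  comul_right : (TensorProduct.assoc k U U U).symm
    ((comul (R := k) (A := U)).lTensor U (R : U ⊗[k] U)) = leg13 k R * leg12 k R

variable {H L : Type*} [Ring H] [Bialgebra k H] [Ring L] [Algebra k L]

variable {k}

/-- The coaction with its `H`-leg embedded in `U`: `a ↦ i(a₍₁₎) ⊗ a₍∞₎`. -/
def coactIn (i : H →ₐ[k] U) (B : BaseAlgebra k H L) : L →ₗ[k] U ⊗[k] L :=
  i.toLinearMap.rTensor L ∘ₗ B.coact.toLinearMap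

/-- `F₍₁₂₎₃ = (Δ ⊗ id)(F₁ ⊗ F₂) ⊗ F_L`. -/
def dyn12c3 : (U ⊗[k] U) ⊗[k] L →ₗ[k] ((U ⊗[k] U) ⊗[k] U) ⊗[k] L :=
  ((comul (R := k) (A := U)).rTensor U).rTensor L

/-- `F₁₍₂₃₎ = (id ⊗ Δ)(F₁ ⊗ F₂) ⊗ F_L`. -/
def dyn1c23 : (U ⊗[k] U) ⊗[k] L →ₗ[k] ((U ⊗[k] U) ⊗[k] U) ⊗[k] L :=
  ((TensorProduct.assoc k U U U).symm.toLinearMap ∘ₗ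
    (comul (R := k) (A := U)).lTensor U).rTensor L

/-- `F₂₃ = 1 ⊗ F₁ ⊗ F₂ ⊗ F_L`. -/
def dyn23 : (U ⊗[k] U) ⊗[k] L →ₗ[k] ((U ⊗[k] U) ⊗[k] U) ⊗[k] L :=
  (leg23 k).rTensor L

/-- `F₁₂|₃ = F₁ ⊗ F₂ ⊗ (F_L)₍₁₎ ⊗ (F_L)₍∞₎`. -/
def dyn12b3 (i : H →ₐ[k] U) (B : BaseAlgebra k H L) :
    (U ⊗[k] U) ⊗[k] L →ₗ[k] ((U ⊗[k] U) ⊗[k] U) ⊗[k] L :=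
  (TensorProduct.assoc k (U ⊗[k] U) U L).symm.toLinearMap ∘ₗ
    (coactIn i B).lTensor (U ⊗[k] U)

/-- An invertible element `F` of `U ⊗ U ⊗ L` is a dynamical `(U, H, L)`-twist; `H` is mapped into
`U` by `i`. -/
structure IsDynamicalTwist (i : H →ₐ[k] U) (B : BaseAlgebra k H L)
    (F : ((U ⊗[k] U) ⊗[k] L)ˣ) : Prop where
  /-- `Δ(h₍₁₎) (F₁ ⊗ F₂) ⊗ h₍₂₎ ▷ F_L = (F₁ ⊗ F₂) Δ(h) ⊗ F_L` for all `h` in `H` -/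
  invariant : ∀ h : H,
    TensorProduct.map₂ (LinearMap.mul k (U ⊗[k] U) ∘ₗ comul (R := k) (A := U) ∘ₗ i.toLinearMap)
        B.act.toLinearMap (comul (R := k) h) (F : (U ⊗[k] U) ⊗[k] L) =
      (F : (U ⊗[k] U) ⊗[k] L) * (comul (R := k) (i h) ⊗ₜ[k] (1 : L))
  /-- `F₍₁₂₎₃ F₁₂|₃ = F₁₍₂₃₎ F₂₃` -/
  cocycle : dyn12c3 (F : (U ⊗[k] U) ⊗[k] L) * dyn12b3 i B F = dyn1c23 F.1 * dyn23 F.1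
  /-- `ε₁(F) = 1` -/
  counit_left : ((TensorProduct.lid k U).toLinearMap ∘ₗ
    (counit (R := k) (A := U)).rTensor U).rTensor L (F : (U ⊗[k] U) ⊗[k] L) = 1
  /-- `ε₂(F) = 1` -/
  counit_right : ((TensorProduct.rid k U).toLinearMap ∘ₗ
    (counit (R := k) (A := U)).lTensor U).rTensor L (F : (U ⊗[k] U) ⊗[k] L) = 1

/-- The dynamical R-matrix `(F⁻¹)₂₁ R F` in `U ⊗ U ⊗ L`. -/
def dynR (R : U ⊗[k] U) (F : ((U ⊗[k] U) ⊗[k] L)ˣ) : (U ⊗[k] U) ⊗[k] L :=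
  (TensorProduct.comm k U U).toLinearMap.rTensor L (F⁻¹ : ((U ⊗[k] U) ⊗[k] L)ˣ).1 *
    (R ⊗ₜ[k] (1 : L)) * F.1

end Hopf

/-! ## Matrices -/

section Matrices

variable {k : Type*} [Field k] {ι : Type*} [Fintype ι] [DecidableEq ι]
variable {U : Type*} [Ring U] [Algebra k U]

/-- The representation `ρ ⊗ ρ` of `U ⊗ U`, in matrix form: the entry of `x ⊗ y` at
`((a, b), (c, d))` is `ρ(x) a c * ρ(y) b d`. -/
def rep2 (ρ : U →ₐ[k] Matrix ι ι k) : U ⊗[k] U →ₐ[k] Matrix (ι × ι) (ι × ι) k :=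
  (Matrix.kroneckerAlgEquiv ι ι k).toAlgHom.comp (Algebra.TensorProduct.map ρ ρ)

/-- The `(p, q)` entry of a linear map with values in matrices. -/
def entry {M m n : Type*} [AddCommGroup M] [Module k M] (f : M →ₗ[k] Matrix m n k) (p : m) (q : n) :
    M →ₗ[k] k where
  toFun x := f x p q
  map_add' x y := by simp
  map_smul' c x := by simp

/-- For `f : M → k` the map `f ⊗ id : M ⊗ L → L`. -/
def evalLeft {M : Type*} [AddCommGroup M] [Module k M] (L : Type*) [Ring L] [Algebra k L]
    (f : M →ₗ[k] k) : M ⊗[k] L →ₗ[k] L :=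
  (TensorProduct.lid k L).toLinearMap ∘ₗ f.rTensor L

/-- The image of an element of `U ⊗ U ⊗ L` in `End(V)^{⊗ 2} ⊗ L`, as a matrix over `L`. -/
def rep2L {L : Type*} [Ring L] [Algebra k L] (ρ : U →ₐ[k] Matrix ι ι k) (X : (U ⊗[k] U) ⊗[k] L) :
    Matrix (ι × ι) (ι × ι) L :=
  Matrix.of fun p q => evalLeft L (entry (rep2 ρ).toLinearMap p q) X

/-- The permutation matrix of `v ⊗ w ↦ w ⊗ v` on `V ⊗ V`. -/
def flipMatrix (ι : Type*) [DecidableEq ι] (A : Type*) [Zero A] [One A] :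
    Matrix (ι × ι) (ι × ι) A :=
  Matrix.of fun p q => if p = q.swap then 1 else 0

/-- `S = P R`. -/
def matS (ρ : U →ₐ[k] Matrix ι ι k) (R : U ⊗[k] U) : Matrix (ι × ι) (ι × ι) k :=
  flipMatrix ι k * rep2 ρ R

/-- The matrix `T₁ T₂` over a noncommutative algebra, with entry `T a c * T b d`
at `((a, b), (c, d))`. -/
def mat12 {A : Type*} [Mul A] (T : Matrix ι ι A) : Matrix (ι × ι) (ι × ι) A :=
  Matrix.of fun p q => T p.1 q.1 * T p.2 q.2

/-! ## The FRT algebra and its `U`-bimodule structure -/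

/-- The matrix of free generators `T i j`. -/
def freeT (k : Type*) [Field k] (ι : Type*) : Matrix ι ι (FreeAlgebra k (ι × ι)) :=
  Matrix.of fun i j => FreeAlgebra.ι k (i, j)

/-- The relations `S T₁ T₂ = T₁ T₂ S` in the free algebra on the `T i j`. -/
inductive FRTRel (S : Matrix (ι × ι) (ι × ι) k) :
    FreeAlgebra k (ι × ι) → FreeAlgebra k (ι × ι) → Prop
  | frt (p q : ι × ι) : FRTRel S
      ((S.map (algebraMap k (FreeAlgebra k (ι × ι))) * mat12 (freeT k ι)) p q)
      ((mat12 (freeT k ι) * S.map (algebraMap k (FreeAlgebra k (ι × ι)))) p q)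

/-- The FRT algebra associated with `S`. -/
abbrev FRT (S : Matrix (ι × ι) (ι × ι) k) : Type _ := RingQuot (FRTRel S)

/-- The matrix of generators of the FRT algebra. -/
def FRT.T (S : Matrix (ι × ι) (ι × ι) k) : Matrix ι ι (FRT S) :=
  (freeT k ι).map (RingQuot.mkAlgHom k (FRTRel S))

theorem FRT.rel (S : Matrix (ι × ι) (ι × ι) k) :
    S.map (algebraMap k (FRT S)) * mat12 (FRT.T S) =
      mat12 (FRT.T S) * S.map (algebraMap k (FRT S)) := by
  ext p q
  have h := RingQuot.mkAlgHom_rel k (FRTRel.frt (S := S) p q)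
  simpa only [Matrix.mul_apply, mat12, FRT.T, Matrix.of_apply, Matrix.map_apply, map_sum, map_mul,
    AlgHom.commutes] using h

/-- On the generators, the element `y ⊗ x` of `U_op ⊗ U` acts by `T ↦ ρ(y) T ρ(x)`. -/
def FRT.genAct (ρ : U →ₐ[k] Matrix ι ι k) (S : Matrix (ι × ι) (ι × ι) k) (i j : ι) :
    Uᵐᵒᵖ ⊗[k] U →ₗ[k] FRT S :=
  ∑ a, ∑ b, LinearMap.toSpanSingleton k (FRT S) (FRT.T S a b) ∘ₗ LinearMap.mul' k k ∘ₗ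
    TensorProduct.map
      (entry ρ.toLinearMap i a ∘ₗ (MulOpposite.opLinearEquiv k).symm.toLinearMap)
      (entry ρ.toLinearMap b j)

theorem FRT.genAct_tmul (ρ : U →ₐ[k] Matrix ι ι k) (S : Matrix (ι × ι) (ι × ι) k) (i j : ι)
    (y x : U) : FRT.genAct ρ S i j (MulOpposite.op y ⊗ₜ[k] x) =
      ∑ a, ∑ b, (ρ y i a * ρ x b j) • FRT.T S a b := by
  simp [FRT.genAct, entry, LinearMap.sum_apply]

theorem rep2_tmul (ρ : U →ₐ[k] Matrix ι ι k) (x y : U) (p q : ι × ι) :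
    rep2 ρ (x ⊗ₜ[k] y) p q = ρ x p.1 q.1 * ρ y p.2 q.2 := by
  simp [rep2, Matrix.kroneckerAlgEquiv]

theorem sum_swap_outer {A : Type*} [AddCommMonoid A] (f : ι → ι → ι → ι → A) :
    ∑ x, ∑ y, ∑ z, ∑ w, f x y z w = ∑ x, ∑ y, ∑ z, ∑ w, f w y z x := by
  let e : (((ι × ι) × ι) × ι) ≃ (((ι × ι) × ι) × ι) :=
    { toFun := fun t => (((t.2, t.1.1.2), t.1.2), t.1.1.1)
      invFun := fun t => (((t.2, t.1.1.2), t.1.2), t.1.1.1)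
      left_inv := fun _ => rfl
      right_inv := fun _ => rfl }
  have h := Fintype.sum_equiv e (fun t => f t.1.1.1 t.1.1.2 t.1.2 t.2)
    (fun t => f t.2 t.1.1.2 t.1.2 t.1.1.1) (fun _ => rfl)
  simpa only [Fintype.sum_prod_type] using h

theorem FRT.genAct_mul_aux (ρ : U →ₐ[k] Matrix ι ι k) (S : Matrix (ι × ι) (ι × ι) k)
    (p q : ι × ι) (Y X : U ⊗[k] U) :
    LinearMap.mul' k (FRT S) (TensorProduct.map (FRT.genAct ρ S p.1 q.1) (FRT.genAct ρ S p.2 q.2)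
      (TensorProduct.tensorTensorTensorComm k Uᵐᵒᵖ Uᵐᵒᵖ U U
        (TensorProduct.map (MulOpposite.opLinearEquiv k).toLinearMap
          (MulOpposite.opLinearEquiv k).toLinearMap Y ⊗ₜ[k] X))) =
      ((rep2 ρ Y).map (algebraMap k (FRT S)) * mat12 (FRT.T S) *
        (rep2 ρ X).map (algebraMap k (FRT S))) p q := by
  induction Y using TensorProduct.induction_on with
  | zero => simp [Matrix.map_zero]
  | add Y₁ Y₂ h₁ h₂ =>
    simp only [map_add, TensorProduct.add_tmul, h₁, h₂]
    rw [Matrix.map_add _ (by simp), Matrix.add_mul, Matrix.add_mul, Matrix.add_apply]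
  | tmul y₁ y₂ =>
    induction X using TensorProduct.induction_on with
    | zero => simp [Matrix.map_zero]
    | add X₁ X₂ h₁ h₂ =>
      simp only [map_add, TensorProduct.tmul_add, h₁, h₂]
      rw [Matrix.map_add _ (by simp), Matrix.mul_add, Matrix.add_apply]
    | tmul x₁ x₂ =>
      simp only [TensorProduct.map_tmul, LinearEquiv.coe_coe, MulOpposite.coe_opLinearEquiv,
        TensorProduct.tensorTensorTensorComm_tmul, LinearMap.mul'_apply, FRT.genAct_tmul,
        Matrix.mul_apply, Matrix.map_apply, rep2_tmul, mat12, Matrix.of_apply,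
        Fintype.sum_prod_type, Finset.sum_mul, Finset.mul_sum]
      simp only [← Algebra.commutes, ← Algebra.smul_def, smul_smul, smul_mul_smul_comm]
      rw [sum_swap_outer]
      refine Finset.sum_congr rfl fun x _ => Finset.sum_congr rfl fun y _ =>
        Finset.sum_congr rfl fun z _ => Finset.sum_congr rfl fun w _ => ?_
      congr 1
      ring

end Matrices

section Action

variable {k : Type*} [Field k] {ι : Type*} [Fintype ι] [DecidableEq ι]
variable {U : Type*} [Ring U] [Bialgebra k U]

theorem FRT.genAct_conv (ρ : U →ₐ[k] Matrix ι ι k) (S : Matrix (ι × ι) (ι × ι) k)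
    (p q : ι × ι) (y x : U) :
    (WithConv.toConv (FRT.genAct ρ S p.1 q.1) * WithConv.toConv (FRT.genAct ρ S p.2 q.2))
        (MulOpposite.op y ⊗ₜ[k] x) =
      ((rep2 ρ (comul (R := k) y)).map (algebraMap k (FRT S)) * mat12 (FRT.T S) *
        (rep2 ρ (comul (R := k) x)).map (algebraMap k (FRT S))) p q := by
  rw [← FRT.genAct_mul_aux]
  simp only [LinearMap.convMul_apply, TensorProduct.comul_tmul, MulOpposite.comul_def]
  rfl

/-- `S = P R` commutes with `ρ ⊗ ρ (Δ x)`. -/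
theorem matS_commute (ρ : U →ₐ[k] Matrix ι ι k) {R : (U ⊗[k] U)ˣ}
    (hR : IsUniversalRMatrix k R) (x : U) :
    matS ρ R.1 * rep2 ρ (comul (R := k) x) = rep2 ρ (comul (R := k) x) * matS ρ R.1 := by
  have hflip : ∀ X : U ⊗[k] U, flipMatrix ι k * rep2 ρ (TensorProduct.comm k U U X) =
      rep2 ρ X * flipMatrix ι k := by
    intro X
    induction X using TensorProduct.induction_on with
    | zero => simp
    | add X Y hX hY => simp only [map_add, Matrix.mul_add, Matrix.add_mul, hX, hY]
    | tmul u v =>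
      ext p q
      have h₁ : ∀ r : ι × ι, p = r.swap ↔ p.swap = r := fun r => by
        constructor <;> rintro rfl <;> rfl
      have h₂ : ∀ r : ι × ι, r = q.swap ↔ q.swap = r := fun r => eq_comm
      simp [Matrix.mul_apply, flipMatrix, rep2_tmul, h₁, h₂, mul_comm]
  rw [matS, Matrix.mul_assoc, ← map_mul, hR.intertwine, map_mul, ← Matrix.mul_assoc, hflip,
    Matrix.mul_assoc]

theorem FRT.act_rel (ρ : U →ₐ[k] Matrix ι ι k) {R : (U ⊗[k] U)ˣ} (hR : IsUniversalRMatrix k R)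
    ⦃a b : FreeAlgebra k (ι × ι)⦄ (h : FRTRel (matS ρ R.1) a b) :
    FreeAlgebra.lift k (fun t : ι × ι =>
      WithConv.toConv (FRT.genAct ρ (matS ρ R.1) t.1 t.2)) a =
    FreeAlgebra.lift k (fun t : ι × ι =>
      WithConv.toConv (FRT.genAct ρ (matS ρ R.1) t.1 t.2)) b := by
  obtain ⟨p, q⟩ := h
  simp only [Matrix.mul_apply, Matrix.map_apply, mat12, Matrix.of_apply, freeT, map_sum, map_mul,
    AlgHom.commutes, FreeAlgebra.lift_ι_apply]
  simp only [← Algebra.commutes, ← Algebra.smul_def]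
  apply WithConv.ofConv_injective
  apply TensorProduct.ext'
  intro y' x
  obtain ⟨y, rfl⟩ := MulOpposite.op_surjective y'
  have hc : ∀ z : U, (matS ρ R.1).map (algebraMap k (FRT (matS ρ R.1))) *
      (rep2 ρ (comul (R := k) z)).map (algebraMap k (FRT (matS ρ R.1))) =
      (rep2 ρ (comul (R := k) z)).map (algebraMap k (FRT (matS ρ R.1))) *
        (matS ρ R.1).map (algebraMap k (FRT (matS ρ R.1))) := fun z => by
    rw [← Matrix.map_mul, matS_commute ρ hR, Matrix.map_mul]
  have hm : (matS ρ R.1).map (algebraMap k (FRT (matS ρ R.1))) *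
      ((rep2 ρ (comul (R := k) y)).map (algebraMap k (FRT (matS ρ R.1))) *
        mat12 (FRT.T (matS ρ R.1)) *
        (rep2 ρ (comul (R := k) x)).map (algebraMap k (FRT (matS ρ R.1)))) =
      (rep2 ρ (comul (R := k) y)).map (algebraMap k (FRT (matS ρ R.1))) *
        mat12 (FRT.T (matS ρ R.1)) *
        (rep2 ρ (comul (R := k) x)).map (algebraMap k (FRT (matS ρ R.1))) *
        (matS ρ R.1).map (algebraMap k (FRT (matS ρ R.1))) := by
    rw [Matrix.mul_assoc, Matrix.mul_assoc, ← Matrix.mul_assoc, hc, Matrix.mul_assoc,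
      ← Matrix.mul_assoc _ (mat12 _), FRT.rel, Matrix.mul_assoc, hc]
    simp only [Matrix.mul_assoc]
  have hpq := congrFun (congrFun hm p) q
  rw [Matrix.mul_apply, Matrix.mul_apply] at hpq
  simp only [← FRT.genAct_conv, Matrix.map_apply, ← Algebra.commutes, ← Algebra.smul_def] at hpq
  simpa using hpq

/-- The left action of `U_op ⊗ U` on the FRT algebra of `S = P R` that makes it a module algebra
and is given by `T ↦ ρ(y) T ρ(x)` on the generators. A module algebra structure is a homomorphism
of algebras into the convolution algebra of linear maps from `U_op ⊗ U`. -/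
def FRT.actHom (ρ : U →ₐ[k] Matrix ι ι k) {R : (U ⊗[k] U)ˣ} (hR : IsUniversalRMatrix k R) :
    FRT (matS ρ R.1) →ₐ[k] WithConv (Uᵐᵒᵖ ⊗[k] U →ₗ[k] FRT (matS ρ R.1)) :=
  RingQuot.liftAlgHom k
    ⟨FreeAlgebra.lift k fun t : ι × ι => WithConv.toConv (FRT.genAct ρ (matS ρ R.1) t.1 t.2),
      FRT.act_rel ρ hR⟩

/-- The action `w ▷ a` of `w` in `U_op ⊗ U` on the FRT algebra. -/
def FRT.act (ρ : U →ₐ[k] Matrix ι ι k) {R : (U ⊗[k] U)ˣ} (hR : IsUniversalRMatrix k R) :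
    Uᵐᵒᵖ ⊗[k] U →ₗ[k] Module.End k (FRT (matS ρ R.1)) :=
  ((WithConv.linearEquiv k _).toLinearMap ∘ₗ (FRT.actHom ρ hR).toLinearMap).flip

end Action

/-! ## The twisted module algebra -/

section Twist

variable {k : Type*} [Field k]
variable {W A M : Type*} [Ring W] [Algebra k W] [Ring A] [Algebra k A] [Ring M] [Algebra k M]

/-- The operator `Θ₁ ⊗ Θ₂` on `(A ⊗ M) ⊗ (A ⊗ M)`:
`(a ⊗ m) ⊗ (b ⊗ n) ↦ (a ⊗ Θ₁ ▷ m) ⊗ (Θ₂ ▷ b ⊗ n) = (a ⊗ m₍∞₎) ⊗ (m₍₁₎ ▷ b ⊗ n)`,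
where `δ m = m₍₁₎ ⊗ m₍∞₎ = Θ₂ ⊗ Θ₁ ▷ m` is the coaction, with values in `W ⊗ M`. -/
def thetaOp (act : W →ₗ[k] Module.End k A) (δ : M →ₗ[k] W ⊗[k] M) :
    (A ⊗[k] M) ⊗[k] (A ⊗[k] M) →ₗ[k] (A ⊗[k] M) ⊗[k] (A ⊗[k] M) :=
  (TensorProduct.lift (LinearMap.rTensorHom M ∘ₗ act)).lTensor (A ⊗[k] M) ∘ₗ
    (TensorProduct.assoc k (A ⊗[k] M) W (A ⊗[k] M)).toLinearMap ∘ₗ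
      ((TensorProduct.comm k W (A ⊗[k] M)).toLinearMap ∘ₗ
        (TensorProduct.leftComm k A W M).toLinearMap ∘ₗ δ.lTensor A).rTensor (A ⊗[k] M)

/-- The operator by which `G = G₁ ⊗ G₂ ⊗ G_M` acts on `(A ⊗ M) ⊗ (A ⊗ M)`:
`(a ⊗ m) ⊗ (b ⊗ n) ↦ (G₁ ▷ a ⊗ G_M m) ⊗ (G₂ ▷ b ⊗ n)`. -/
def tensorOp (act : W →ₗ[k] Module.End k A) (G : (W ⊗[k] W) ⊗[k] M) :
    (A ⊗[k] M) ⊗[k] (A ⊗[k] M) →ₗ[k] (A ⊗[k] M) ⊗[k] (A ⊗[k] M) :=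
  TensorProduct.map₂ (TensorProduct.map₂ act (LinearMap.mul k M)) (LinearMap.rTensorHom M ∘ₗ act)
    (TensorProduct.rightComm k W W M G)

/-- The twist of the multiplication of `A ⊗ M` by the bialgebroid twist
`Ψ = (G₁ ⊗ G_M ⊗ Θ₁) ⊗ (G₂ Θ₂ ⊗ 1 ⊗ 1)` that corresponds to the dynamical twist `G`:
the product of `x` and `y` is the ordinary product applied to `Ψ ▷ (x ⊗ y)`. Explicitly,
`(a ⊗ m) * (b ⊗ n) = (G₁ ▷ a) (G₂ ▷ m₍₁₎ ▷ b) ⊗ G_M m₍∞₎ n`. -/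
def twistMul (act : W →ₗ[k] Module.End k A) (δ : M →ₗ[k] W ⊗[k] M) (G : (W ⊗[k] W) ⊗[k] M) :
    A ⊗[k] M →ₗ[k] A ⊗[k] M →ₗ[k] A ⊗[k] M :=
  (TensorProduct.mk k (A ⊗[k] M) (A ⊗[k] M)).compr₂
    (LinearMap.mul' k (A ⊗[k] M) ∘ₗ tensorOp act G ∘ₗ thetaOp act δ)

end Twist


section TwistedFRT

variable {k : Type*} [Field k] {H U L : Type*} [Ring H] [Bialgebra k H] [Ring U] [Bialgebra k U]
variable [Ring L] [Algebra k L]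

/-- The coaction of `H_op` on `L_op`, with values in `U_op ⊗ L_op`; as a map it is the coaction
of `H` on `L`. -/
def coactOp (i : H →ₐ[k] U) (B : BaseAlgebra k H L) : Lᵐᵒᵖ →ₗ[k] Uᵐᵒᵖ ⊗[k] Lᵐᵒᵖ :=
  TensorProduct.map (MulOpposite.opLinearEquiv k).toLinearMap
      (MulOpposite.opLinearEquiv k).toLinearMap ∘ₗ
    coactIn i B ∘ₗ (MulOpposite.opLinearEquiv k).symm.toLinearMap

/-- The coaction of `H_op ⊗ H` on the base algebra `L_op ⊗ L`, with values in
`(U_op ⊗ U) ⊗ (L_op ⊗ L)`. -/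
def coactBi (i : H →ₐ[k] U) (B : BaseAlgebra k H L) :
    Lᵐᵒᵖ ⊗[k] L →ₗ[k] (Uᵐᵒᵖ ⊗[k] U) ⊗[k] (Lᵐᵒᵖ ⊗[k] L) :=
  (TensorProduct.tensorTensorTensorComm k Uᵐᵒᵖ Lᵐᵒᵖ U L).toLinearMap ∘ₗ
    TensorProduct.map (coactOp i B) (coactIn i B)

/-- An element of `U ⊗ U ⊗ L` viewed in `U_op ⊗ U_op ⊗ L_op`. -/
def toOp : (U ⊗[k] U) ⊗[k] L →ₗ[k] (Uᵐᵒᵖ ⊗[k] Uᵐᵒᵖ) ⊗[k] Lᵐᵒᵖ :=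
  TensorProduct.map
    (TensorProduct.map (MulOpposite.opLinearEquiv k).toLinearMap
      (MulOpposite.opLinearEquiv k).toLinearMap)
    (MulOpposite.opLinearEquiv k).toLinearMap

/-- The dynamical twist `F⁻¹ ⊗ F` over the base `L_op ⊗ L`, as an element of
`(U_op ⊗ U) ⊗ (U_op ⊗ U) ⊗ (L_op ⊗ L)`; here `F⁻¹` is viewed in `U_op ⊗ U_op ⊗ L_op`. -/
def twistBi (F : ((U ⊗[k] U) ⊗[k] L)ˣ) :
    ((Uᵐᵒᵖ ⊗[k] U) ⊗[k] (Uᵐᵒᵖ ⊗[k] U)) ⊗[k] (Lᵐᵒᵖ ⊗[k] L) :=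
  (TensorProduct.tensorTensorTensorComm k Uᵐᵒᵖ Uᵐᵒᵖ U U).toLinearMap.rTensor (Lᵐᵒᵖ ⊗[k] L)
    (TensorProduct.tensorTensorTensorComm k (Uᵐᵒᵖ ⊗[k] Uᵐᵒᵖ) Lᵐᵒᵖ (U ⊗[k] U) L
      (toOp (F⁻¹ : ((U ⊗[k] U) ⊗[k] L)ˣ).1 ⊗ₜ[k] F.1))

variable {ι : Type*} [Fintype ι] [DecidableEq ι]

/-- The multiplication of the twisted FRT algebra: the twist by `F⁻¹ ⊗ F` of the multiplication
of `FRT ⊗ (L_op ⊗ L)`. -/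
def FRT.twistedMul (ρ : U →ₐ[k] Matrix ι ι k) {R : (U ⊗[k] U)ˣ} (hR : IsUniversalRMatrix k R)
    (i : H →ₐ[k] U) (B : BaseAlgebra k H L) (F : ((U ⊗[k] U) ⊗[k] L)ˣ) :
    FRT (matS ρ R.1) ⊗[k] (Lᵐᵒᵖ ⊗[k] L) →ₗ[k] FRT (matS ρ R.1) ⊗[k] (Lᵐᵒᵖ ⊗[k] L) →ₗ[k]
      FRT (matS ρ R.1) ⊗[k] (Lᵐᵒᵖ ⊗[k] L) :=
  twistMul (FRT.act ρ hR) (coactBi i B) (twistBi F)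

end TwistedFRT

/-! ## The dynamical FRT algebra -/

section DFRT

variable {k : Type*} [Field k] {H L : Type*} [Ring H] [HopfAlgebra k H] [Ring L] [Algebra k L]
variable {ι : Type*} [Fintype ι] [DecidableEq ι]

/-- Generators of the dynamical FRT algebra. -/
inductive DGen (ι L : Type*)
  /-- the generators `T i j` -/
  | gT (i j : ι) : DGen ι L
  /-- the elements of `L_op` -/
  | gt (a : Lᵐᵒᵖ) : DGen ι L
  /-- the elements of `L` -/
  | gs (a : L) : DGen ι L

/-- The free algebra on all the generators. -/
abbrev DFree (k ι L : Type*) [Field k] : Type _ := FreeAlgebra k (DGen ι L)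

/-- The free generator `T i j`. -/
def DFree.T (k ι L : Type*) [Field k] (i j : ι) : DFree k ι L := FreeAlgebra.ι k (.gT i j)

/-- The free generator for an element of `L_op`. -/
def DFree.t (k ι : Type*) {L : Type*} [Field k] (a : Lᵐᵒᵖ) : DFree k ι L := FreeAlgebra.ι k (.gt a)

/-- The free generator for an element of `L`. -/
def DFree.s (k ι : Type*) {L : Type*} [Field k] (a : L) : DFree k ι L := FreeAlgebra.ι k (.gs a)

/-- The map `a ↦ ρ(a₍₁₎) i j a₍∞₎` on `L`. -/
def coactEntry (ρ : H →ₐ[k] Matrix ι ι k) (B : BaseAlgebra k H L) (i j : ι) (a : L) : L :=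
  evalLeft L (entry ρ.toLinearMap i j) (B.coact a)

/-- The defining relations of the smash product `k⟨T i j⟩ ⋊ (L_op ⊗ L)`: those of the algebras
`L_op` and `L`, their commutation with each other, and the permutation relations
`a T = T ρ(a₍₁₎) a₍∞₎` for `a` in `L` and `b T = ρ(b₍₁₎) T b₍∞₎` for `b` in `L_op`. -/
inductive SmashRel (ρ : H →ₐ[k] Matrix ι ι k) (B : BaseAlgebra k H L) :
    DFree k ι L → DFree k ι L → Prop
  | s_add (a b : L) : SmashRel ρ B (.s k ι (a + b)) (.s k ι a + .s k ι b)
  | s_mul (a b : L) : SmashRel ρ B (.s k ι (a * b)) (.s k ι a * .s k ι b)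
  | s_algebraMap (c : k) : SmashRel ρ B (.s k ι (algebraMap k L c)) (algebraMap k (DFree k ι L) c)
  | t_add (a b : Lᵐᵒᵖ) : SmashRel ρ B (.t k ι (a + b)) (.t k ι a + .t k ι b)
  | t_mul (a b : Lᵐᵒᵖ) : SmashRel ρ B (.t k ι (a * b)) (.t k ι a * .t k ι b)
  | t_algebraMap (c : k) :
      SmashRel ρ B (.t k ι (algebraMap k Lᵐᵒᵖ c)) (algebraMap k (DFree k ι L) c)
  | comm (a : L) (b : Lᵐᵒᵖ) : SmashRel ρ B (.s k ι a * .t k ι b) (.t k ι b * .s k ι a)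
  | s_T (a : L) (i j : ι) : SmashRel ρ B (.s k ι a * .T k ι L i j)
      (∑ l, .T k ι L i l * .s k ι (coactEntry ρ B l j a))
  | t_T (b : L) (i j : ι) : SmashRel ρ B (.t k ι (MulOpposite.op b) * .T k ι L i j)
      (∑ l, .T k ι L l j * .t k ι (MulOpposite.op (coactEntry ρ B i l b)))

/-- The smash product `k⟨T i j⟩ ⋊ (L_op ⊗ L)`. -/
abbrev Smash (ρ : H →ₐ[k] Matrix ι ι k) (B : BaseAlgebra k H L) : Type _ :=
  RingQuot (SmashRel ρ B)

/-- The matrix of generators `T i j` of the smash product. -/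
def Smash.T (ρ : H →ₐ[k] Matrix ι ι k) (B : BaseAlgebra k H L) : Matrix ι ι (Smash ρ B) :=
  Matrix.of fun i j => RingQuot.mkAlgHom k (SmashRel ρ B) (.T k ι L i j)

/-- The map of `L_op` to the smash product. -/
def Smash.t (ρ : H →ₐ[k] Matrix ι ι k) (B : BaseAlgebra k H L) (b : Lᵐᵒᵖ) : Smash ρ B :=
  RingQuot.mkAlgHom k (SmashRel ρ B) (.t k ι b)

/-- The map of `L` to the smash product. -/
def Smash.s (ρ : H →ₐ[k] Matrix ι ι k) (B : BaseAlgebra k H L) (a : L) : Smash ρ B :=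
  RingQuot.mkAlgHom k (SmashRel ρ B) (.s k ι a)

/-- The matrix valued map `h ↦ ρ(γ h₍₂₎) ⊗ ρ(γ h₍₁₎)`, with `γ` the antipode of `H`. -/
def antipodeRep (ρ : H →ₐ[k] Matrix ι ι k) : H →ₗ[k] Matrix (ι × ι) (ι × ι) k :=
  (rep2 ρ).toLinearMap ∘ₗ
    TensorProduct.map (HopfAlgebra.antipode k (A := H)) (HopfAlgebra.antipode k (A := H)) ∘ₗ
      (TensorProduct.comm k H H).toLinearMap ∘ₗ comul (R := k) (A := H)

/-- The matrix `S̃_op = S̃₁ ρ(γ Θ₂₍₂₎) ⊗ S̃₂ ρ(γ Θ₂₍₁₎) ⊗ Θ₁ ▷ S̃_L`, where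
`Θ₂ ⊗ Θ₁ ▷ a = δ a` is the coaction. -/
def matOp (ρ : H →ₐ[k] Matrix ι ι k) (B : BaseAlgebra k H L) (S : Matrix (ι × ι) (ι × ι) L) :
    Matrix (ι × ι) (ι × ι) L :=
  Matrix.of fun p q => ∑ r, evalLeft L (entry (antipodeRep ρ) r q) (B.coact (S p r))

/-- The relations `S̃_op T₁ T₂ = T₁ T₂ S̃`, where the coefficients of `S̃_op` and of `S̃` are taken
in `L_op` and in `L`, respectively. -/
inductive DFRTRel (ρ : H →ₐ[k] Matrix ι ι k) (B : BaseAlgebra k H L)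
    (S : Matrix (ι × ι) (ι × ι) L) : Smash ρ B → Smash ρ B → Prop
  | frt (p q : ι × ι) : DFRTRel ρ B S
      (((matOp ρ B S).map (fun a => Smash.t ρ B (MulOpposite.op a)) * mat12 (Smash.T ρ B)) p q)
      ((mat12 (Smash.T ρ B) * S.map (Smash.s ρ B)) p q)

/-- The dynamical FRT algebra associated with the matrix `S̃` over `L`. -/
abbrev DFRT (ρ : H →ₐ[k] Matrix ι ι k) (B : BaseAlgebra k H L)
    (S : Matrix (ι × ι) (ι × ι) L) : Type _ := RingQuot (DFRTRel ρ B S)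

/-- The generators `T i j` of the dynamical FRT algebra. -/
def DFRT.T (ρ : H →ₐ[k] Matrix ι ι k) (B : BaseAlgebra k H L) (S : Matrix (ι × ι) (ι × ι) L)
    (i j : ι) : DFRT ρ B S :=
  RingQuot.mkAlgHom k (DFRTRel ρ B S) (Smash.T ρ B i j)

/-- The map of `L_op` to the dynamical FRT algebra. -/
def DFRT.t (ρ : H →ₐ[k] Matrix ι ι k) (B : BaseAlgebra k H L) (S : Matrix (ι × ι) (ι × ι) L)
    (b : Lᵐᵒᵖ) : DFRT ρ B S :=
  RingQuot.mkAlgHom k (DFRTRel ρ B S) (Smash.t ρ B b)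

/-- The map of `L` to the dynamical FRT algebra. -/
def DFRT.s (ρ : H →ₐ[k] Matrix ι ι k) (B : BaseAlgebra k H L) (S : Matrix (ι × ι) (ι × ι) L)
    (a : L) : DFRT ρ B S :=
  RingQuot.mkAlgHom k (DFRTRel ρ B S) (Smash.s ρ B a)

end DFRT

end DynFRT

end

noncomputable section

set_option maxSynthPendingDepth 6

namespace DynFRT

open Coalgebra TensorProduct

/-! ## Twist data over a bialgebra -/

section TwistDatum

/-! Put `W = U_op ⊗ U`, `M = L_op ⊗ L`, `G = F⁻¹ ⊗ F`, and let `D` be the dynamical FRT algebra with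
its map `j : M → D`. Two homomorphisms between `D` and the twisted algebra are constructed and shown
to be mutually inverse.

From `D` to the twisted algebra the map is prescribed on generators. There the product `T₁T₂`
becomes `F⁻¹ T₁T₂ F`, with the coefficients of `F⁻¹` in `L_op` and those of `F` in `L`. Since `P
F⁻¹₂₁ = F⁻¹ P`, the matrix `S̃ = P R̃` equals `F⁻¹ S F` (`flip_dynR`). The matrix `S̃_op` is made so
that the antipodes cancel when its coefficients are moved to the right of `T₁T₂`
(`Smash.matOp_mul`). The dynamical relation then reduces to `S T₁T₂ = T₁T₂ S`
(`FRT.smashToTwisted_rel`).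

The inverse is harder, because `FRT ⊗ 1` is in general not closed under the twisted product, so the
FRT algebra cannot be mapped to `D` as an algebra. It is mapped instead to an algebra of functions:
the linear maps `f : W → D` with `j(m) f(w) = f(m₍₁₎ w) j(m₍∞₎)` form an algebra under `(f * g)(w) =
f(Ḡ₁ w₍₁₎) g(Ḡ₂ w₍₂₎) j(Ḡ_M)`, where `Ḡ = G⁻¹`. Associativity is the inverted cocycle identity
(`conv_assoc`). The maps `y ⊗ x ↦ ρ(y) T ρ(x)` lie in this algebra by the permutation relations and
satisfy the FRT relation by the dynamical one (`coeffMat_matS`), so they define a homomorphism `ψ`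
on the FRT algebra. The inverse is `a ⊗ m ↦ ψ(a)(1) j(m)`. It is multiplicative because `ψ(w ▷
a)(w') = ψ(a)(w' w)`, so that `G` in the twisted product cancels `Ḡ` in the convolution, and
equivariance carries `j(m)` past the second factor (`untwist_mulT`).

One composite is checked on generators. The other rests on `Φ(ψ(a)(w)) = (w ▷ a) ⊗ 1`, proved by
induction on `a` (`DFRT.toTwisted_toDynamical`). -/

/-- Induction on pure tensors in a triple tensor product. -/
theorem tensor3_induction {k A B C : Type*} [CommSemiring k] [AddCommMonoid A] [Module k A]
    [AddCommMonoid B] [Module k B] [AddCommMonoid C] [Module k C]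
    {P : (A ⊗[k] B) ⊗[k] C → Prop} (z : (A ⊗[k] B) ⊗[k] C) (zero : P 0)
    (tmul : ∀ a b c, P ((a ⊗ₜ b) ⊗ₜ c)) (add : ∀ x y, P x → P y → P (x + y)) : P z := by
  induction z using TensorProduct.induction_on with
  | zero => exact zero
  | add x y hx hy => exact add _ _ hx hy
  | tmul x c =>
    induction x using TensorProduct.induction_on with
    | zero => simpa using zero
    | add x y hx hy => rw [TensorProduct.add_tmul]; exact add _ _ hx hy
    | tmul a b => exact tmul a b c

variable (k : Type*) [Field k] (W M : Type*) [Ring W] [Bialgebra k W] [Ring M] [Algebra k M]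

/-- `Δ ⊗ id` on `W ⊗ M`. -/
def comulM : W ⊗[k] M →ₐ[k] (W ⊗[k] W) ⊗[k] M :=
  Algebra.TensorProduct.map (Bialgebra.comulAlgHom k W) (AlgHom.id k M)

/-- `z ↦ 1 ⊗ z` from `W ⊗ M` to `W ⊗ W ⊗ M`. -/
def inrM : W ⊗[k] M →ₐ[k] (W ⊗[k] W) ⊗[k] M :=
  Algebra.TensorProduct.map Algebra.TensorProduct.includeRight (AlgHom.id k M)

/-- `Δ ⊗ id ⊗ id` on `W ⊗ W ⊗ M`. -/
def comul12 : (W ⊗[k] W) ⊗[k] M →ₐ[k] ((W ⊗[k] W) ⊗[k] W) ⊗[k] M :=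
  Algebra.TensorProduct.map
    (Algebra.TensorProduct.map (Bialgebra.comulAlgHom k W) (AlgHom.id k W)) (AlgHom.id k M)

/-- `id ⊗ Δ ⊗ id` on `W ⊗ W ⊗ M`. -/
def comul23 : (W ⊗[k] W) ⊗[k] M →ₐ[k] ((W ⊗[k] W) ⊗[k] W) ⊗[k] M :=
  Algebra.TensorProduct.map
    ((Algebra.TensorProduct.assoc k k k W W W).symm.toAlgHom.comp
      (Algebra.TensorProduct.map (AlgHom.id k W) (Bialgebra.comulAlgHom k W))) (AlgHom.id k M)

/-- `z ↦ 1 ⊗ z` from `W ⊗ W ⊗ M` to `W ⊗ W ⊗ W ⊗ M`. -/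
def inr23 : (W ⊗[k] W) ⊗[k] M →ₐ[k] ((W ⊗[k] W) ⊗[k] W) ⊗[k] M :=
  Algebra.TensorProduct.map
    (Algebra.TensorProduct.map Algebra.TensorProduct.includeRight (AlgHom.id k W)) (AlgHom.id k M)

/-- `ε ⊗ id ⊗ id` on `W ⊗ W ⊗ M`. -/
def counit1 : (W ⊗[k] W) ⊗[k] M →ₐ[k] W ⊗[k] M :=
  Algebra.TensorProduct.map ((Algebra.TensorProduct.lid k W).toAlgHom.comp
    (Algebra.TensorProduct.map (Bialgebra.counitAlgHom k W) (AlgHom.id k W))) (AlgHom.id k M)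

/-- `id ⊗ ε ⊗ id` on `W ⊗ W ⊗ M`. -/
def counit2 : (W ⊗[k] W) ⊗[k] M →ₐ[k] W ⊗[k] M :=
  Algebra.TensorProduct.map ((Algebra.TensorProduct.rid k k W).toAlgHom.comp
    (Algebra.TensorProduct.map (AlgHom.id k W) (Bialgebra.counitAlgHom k W))) (AlgHom.id k M)

variable {W M}

/-- `id ⊗ δ : X ⊗ M → X ⊗ W ⊗ M` for a coaction `δ`. -/
def coactR (X : Type*) [Ring X] [Algebra k X] (δ : M →ₐ[k] W ⊗[k] M) :
    X ⊗[k] M →ₐ[k] (X ⊗[k] W) ⊗[k] M :=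
  (Algebra.TensorProduct.assoc k k k X W M).symm.toAlgHom.comp
    (Algebra.TensorProduct.map (AlgHom.id k X) δ)

variable (W M)

/-- A coaction `δ` of a bialgebra `W` on an algebra `M` together with a dynamical twist `G`
in `W ⊗ W ⊗ M`. The invariance of `G` is required only in the form in which it is used for
associativity: `G` commutes with `(Δ ⊗ id) δ(m)`. -/
structure TwistDatum where
  /-- the coaction -/
  δ : M →ₐ[k] W ⊗[k] M
  /-- the twist -/
  G : ((W ⊗[k] W) ⊗[k] M)ˣ
  counit_δ : ∀ m, TensorProduct.lid k M ((counit (R := k) (A := W)).rTensor M (δ m)) = m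
  coassoc : ∀ m, comulM k W M (δ m) = coactR k W δ (δ m)
  comm : ∀ m, comulM k W M (δ m) * G = G * comulM k W M (δ m)
  cocycle : comul12 k W M G * coactR k (W ⊗[k] W) δ G = comul23 k W M G * inr23 k W M G
  counit_left : counit1 k W M G = 1
  counit_right : counit2 k W M G = 1

variable {k W M}

namespace TwistDatum

variable (t : TwistDatum k W M)

theorem comm_inv (m : M) :
    comulM k W M (t.δ m) * t.G⁻¹.1 = t.G⁻¹.1 * comulM k W M (t.δ m) := by
  rw [Units.eq_inv_mul_iff_mul_eq, ← mul_assoc, ← t.comm, mul_assoc, Units.mul_inv, mul_one]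

/-- Both sides of the cocycle identity are products of units, and inversion reverses their order.
This form gives associativity of `conv` and the cocycle identity of the opposite datum. -/
theorem cocycle_inv : coactR k (W ⊗[k] W) t.δ t.G⁻¹.1 * comul12 k W M t.G⁻¹.1 =
    inr23 k W M t.G⁻¹.1 * comul23 k W M t.G⁻¹.1 := by
  have h : Units.map (comul12 k W M).toMonoidHom t.G *
      Units.map (coactR k (W ⊗[k] W) t.δ).toMonoidHom t.G =
      Units.map (comul23 k W M).toMonoidHom t.G * Units.map (inr23 k W M).toMonoidHom t.G :=
    Units.ext t.cocycle
  have h' := congrArg (fun u => (u⁻¹ : (((W ⊗[k] W) ⊗[k] W) ⊗[k] M)ˣ).1) h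
  simp only [mul_inv_rev, Units.val_mul] at h'
  exact h'

theorem counit_left_inv : counit1 k W M t.G⁻¹.1 = 1 := by
  have h := congrArg (counit1 k W M) t.G.mul_inv
  rwa [map_mul, t.counit_left, one_mul, map_one] at h

theorem counit_right_inv : counit2 k W M t.G⁻¹.1 = 1 := by
  have h := congrArg (counit2 k W M) t.G.mul_inv
  rwa [map_mul, t.counit_right, one_mul, map_one] at h

end TwistDatum

theorem comul12_inrM (z : W ⊗[k] M) : comul12 k W M (inrM k W M z) =
    Algebra.TensorProduct.map Algebra.TensorProduct.includeRight (AlgHom.id k M) z := by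
  induction z using TensorProduct.induction_on with
  | zero => simp
  | add x y hx hy => simp only [map_add, hx, hy]
  | tmul w m => simp [comul12, inrM, Algebra.TensorProduct.one_def]

theorem comul23_inrM (z : W ⊗[k] M) :
    comul23 k W M (inrM k W M z) = inr23 k W M (comulM k W M z) := by
  induction z using TensorProduct.induction_on with
  | zero => simp
  | add x y hx hy => simp only [map_add, hx, hy]
  | tmul w m =>
    simp only [comul23, inrM, inr23, comulM, Algebra.TensorProduct.map_tmul, AlgHom.comp_apply,
      AlgHom.id_apply, Algebra.TensorProduct.includeRight_apply]
    rfl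

theorem coactR_inrM (δ : M →ₐ[k] W ⊗[k] M) (z : W ⊗[k] M) :
    coactR k (W ⊗[k] W) δ (inrM k W M z) = inr23 k W M (coactR k W δ z) := by
  induction z using TensorProduct.induction_on with
  | zero => simp
  | add x y hx hy => simp only [map_add, hx, hy]
  | tmul w m =>
    simp only [coactR, inrM, inr23, Algebra.TensorProduct.map_tmul, AlgHom.comp_apply,
      AlgHom.id_apply, Algebra.TensorProduct.includeRight_apply]
    generalize δ m = x
    induction x using TensorProduct.induction_on with
    | zero => simp
    | add x y hx hy => simp only [map_add, TensorProduct.tmul_add, hx, hy]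
    | tmul x y => simp

theorem coactR_right (X : Type*) [Ring X] [Algebra k X] (δ : M →ₐ[k] W ⊗[k] M) (m : M) :
    coactR k X δ ((1 : X) ⊗ₜ m) =
      Algebra.TensorProduct.map Algebra.TensorProduct.includeRight (AlgHom.id k M) (δ m) := by
  simp only [coactR, Algebra.TensorProduct.map_tmul, AlgHom.comp_apply, AlgHom.id_apply]
  generalize δ m = x
  induction x using TensorProduct.induction_on with
  | zero => simp
  | add x y hx hy => simp only [map_add, TensorProduct.tmul_add, hx, hy]
  | tmul x y => simp

theorem coactR_left (X : Type*) [Ring X] [Algebra k X] (δ : M →ₐ[k] W ⊗[k] M) (x : X) :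
    coactR k X δ (x ⊗ₜ (1 : M)) = (x ⊗ₜ 1) ⊗ₜ 1 := by
  simp [coactR, Algebra.TensorProduct.one_def]

theorem counit1_inrM (z : W ⊗[k] M) : counit1 k W M (inrM k W M z) = z := by
  induction z using TensorProduct.induction_on with
  | zero => simp
  | add x y hx hy => simp only [map_add, hx, hy]
  | tmul w m => simp [counit1, inrM]

theorem counit2_inrM (z : W ⊗[k] M) : counit2 k W M (inrM k W M z) =
    1 ⊗ₜ TensorProduct.lid k M ((counit (R := k) (A := W)).rTensor M z) := by
  induction z using TensorProduct.induction_on with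
  | zero => simp
  | add x y hx hy => simp only [map_add, TensorProduct.tmul_add, hx, hy]
  | tmul w m => simp [counit2, inrM, TensorProduct.smul_tmul]

end TwistDatum

/-! ## The twisted product of a module algebra and the base algebra -/

section Twisted

variable (k : Type*) [Field k] (W A : Type*) [Ring W] [Bialgebra k W] [Ring A] [Algebra k A]

/-- A left module algebra over a bialgebra. -/
structure ModuleAlgebra where
  /-- the action `w ▷ a` -/
  act : W →ₐ[k] Module.End k A
  act_one : ∀ w, act w 1 = algebraMap k A (counit w)
  act_mul : ∀ w a b, act w (a * b) = LinearMap.mul' k A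
    (TensorProduct.map (act.toLinearMap.flip a) (act.toLinearMap.flip b) (comul (R := k) w))

variable {k W A} {M : Type*} [Ring M] [Algebra k M]

namespace ModuleAlgebra

variable (μ : ModuleAlgebra k W A)

/-- `w ⊗ w' ⊗ m ↦ (w ▷ a) (w' ▷ b) ⊗ m`. -/
def eval2 (M : Type*) [Ring M] [Algebra k M] (a b : A) : (W ⊗[k] W) ⊗[k] M →ₗ[k] A ⊗[k] M :=
  (LinearMap.mul' k A ∘ₗ
    TensorProduct.map (μ.act.toLinearMap.flip a) (μ.act.toLinearMap.flip b)).rTensor M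

/-- `w ⊗ w' ⊗ w'' ⊗ m ↦ (w ▷ a) (w' ▷ b) (w'' ▷ c) ⊗ m`. -/
def eval3 (M : Type*) [Ring M] [Algebra k M] (a b c : A) :
    ((W ⊗[k] W) ⊗[k] W) ⊗[k] M →ₗ[k] A ⊗[k] M :=
  (LinearMap.mul' k A ∘ₗ
    TensorProduct.map (LinearMap.mul' k A ∘ₗ
      TensorProduct.map (μ.act.toLinearMap.flip a) (μ.act.toLinearMap.flip b))
      (μ.act.toLinearMap.flip c)).rTensor M

@[simp] theorem eval2_tmul (a b : A) (w w' : W) (m : M) :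
    μ.eval2 M a b ((w ⊗ₜ w') ⊗ₜ m) = (μ.act w a * μ.act w' b) ⊗ₜ m := by
  simp [eval2]

@[simp] theorem eval3_tmul (a b c : A) (w w' w'' : W) (m : M) :
    μ.eval3 M a b c (((w ⊗ₜ w') ⊗ₜ w'') ⊗ₜ m) =
      (μ.act w a * μ.act w' b * μ.act w'' c) ⊗ₜ m := by
  simp [eval3]

/-- This lemma and the next three move the work from `A` into `W ⊗ W ⊗ W ⊗ M`: a product in an
argument becomes a coproduct on the corresponding leg, and an action on the arguments becomes right
multiplication. -/
theorem eval2_mul_left (a b c : A) (z : (W ⊗[k] W) ⊗[k] M) :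
    μ.eval2 M (a * b) c z = μ.eval3 M a b c (comul12 k W M z) := by
  induction z using tensor3_induction with
  | zero => simp
  | add x y hx hy => simp only [map_add, hx, hy]
  | tmul w w' m => simp [eval3, comul12, μ.act_mul]

theorem eval2_mul_right (a b c : A) (z : (W ⊗[k] W) ⊗[k] M) :
    μ.eval2 M a (b * c) z = μ.eval3 M a b c (comul23 k W M z) := by
  induction z using tensor3_induction with
  | zero => simp
  | add x y hx hy => simp only [map_add, hx, hy]
  | tmul w w' m =>
    simp only [eval2_tmul, μ.act_mul, comul23, Algebra.TensorProduct.map_tmul, AlgHom.comp_apply,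
      AlgHom.id_apply, Bialgebra.comulAlgHom_apply]
    generalize comul (R := k) w' = x
    induction x using TensorProduct.induction_on with
    | zero => simp
    | add x y hx hy =>
      simp only [map_add, TensorProduct.tmul_add, TensorProduct.add_tmul, mul_add, hx, hy]
    | tmul x y => simp [mul_assoc]

theorem eval3_act_left (a b c : A) (w w' : W) (z : ((W ⊗[k] W) ⊗[k] W) ⊗[k] M) :
    μ.eval3 M (μ.act w a) (μ.act w' b) c z =
      μ.eval3 M a b c (z * (((w ⊗ₜ w') ⊗ₜ 1) ⊗ₜ 1)) := by
  induction z using tensor3_induction with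
  | zero => simp
  | add x y hx hy => simp only [map_add, add_mul, hx, hy]
  | tmul x y m =>
    induction x using TensorProduct.induction_on with
    | zero => simp
    | add x y hx hy => simp only [map_add, TensorProduct.add_tmul, add_mul, hx, hy]
    | tmul p q => simp

theorem eval3_act_right (a b c : A) (w w' : W) (z : ((W ⊗[k] W) ⊗[k] W) ⊗[k] M) :
    μ.eval3 M a (μ.act w b) (μ.act w' c) z =
      μ.eval3 M a b c (z * (((1 ⊗ₜ w) ⊗ₜ w') ⊗ₜ 1)) := by
  induction z using tensor3_induction with
  | zero => simp
  | add x y hx hy => simp only [map_add, add_mul, hx, hy]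
  | tmul x y m =>
    induction x using TensorProduct.induction_on with
    | zero => simp
    | add x y hx hy => simp only [map_add, TensorProduct.add_tmul, add_mul, hx, hy]
    | tmul p q => simp

theorem eval2_mul_base (a b : A) (z : (W ⊗[k] W) ⊗[k] M) (m : M) :
    μ.eval2 M a b (z * (1 ⊗ₜ m)) = μ.eval2 M a b z * (1 ⊗ₜ m) := by
  induction z using tensor3_induction with
  | zero => simp
  | add x y hx hy => simp only [map_add, add_mul, hx, hy]
  | tmul x y m => simp

theorem eval3_mul_base (a b c : A) (z : ((W ⊗[k] W) ⊗[k] W) ⊗[k] M) (m : M) :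
    μ.eval3 M a b c (z * (1 ⊗ₜ m)) = μ.eval3 M a b c z * (1 ⊗ₜ m) := by
  induction z using tensor3_induction with
  | zero => simp
  | add x y hx hy => simp only [map_add, add_mul, hx, hy]
  | tmul x y m =>
    induction x using TensorProduct.induction_on with
    | zero => simp
    | add x y hx hy => simp only [map_add, TensorProduct.add_tmul, add_mul, hx, hy]
    | tmul p q => simp

theorem eval2_one_left (b : A) (z : (W ⊗[k] W) ⊗[k] M) :
    μ.eval2 M 1 b z = (μ.act.toLinearMap.flip b).rTensor M (counit1 k W M z) := by
  induction z using tensor3_induction with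
  | zero => simp
  | add x y hx hy => simp only [map_add, hx, hy]
  | tmul x y m =>
    simp [μ.act_one, counit1, Algebra.smul_def]

theorem eval2_one_right (a : A) (z : (W ⊗[k] W) ⊗[k] M) :
    μ.eval2 M a 1 z = (μ.act.toLinearMap.flip a).rTensor M (counit2 k W M z) := by
  induction z using tensor3_induction with
  | zero => simp
  | add x y hx hy => simp only [map_add, hx, hy]
  | tmul x y m =>
    simp [μ.act_one, counit2, Algebra.algebraMap_eq_smul_one]

theorem twistMul_tmul (δ : M →ₗ[k] W ⊗[k] M) (G : (W ⊗[k] W) ⊗[k] M) (a b : A) (m n : M) :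
    twistMul μ.act.toLinearMap δ G (a ⊗ₜ m) (b ⊗ₜ n) =
      μ.eval2 M a b (G * inrM k W M (δ m)) * (1 ⊗ₜ n) := by
  simp only [twistMul, LinearMap.compr₂_apply, TensorProduct.mk_apply, LinearMap.comp_apply,
    thetaOp, tensorOp, LinearMap.rTensor_tmul, LinearMap.lTensor_tmul]
  generalize δ m = x
  induction x using TensorProduct.induction_on with
  | zero => simp
  | add x y hx hy => simp only [map_add, TensorProduct.tmul_add, TensorProduct.add_tmul, mul_add,
      add_mul, hx, hy]
  | tmul w m' =>
    induction G using tensor3_induction with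
    | zero => simp
    | add x y hx hy =>
      simp only [map_add, LinearMap.add_apply, add_mul] at hx hy ⊢
      rw [hx, hy]
    | tmul x y l => simp [inrM, mul_assoc]

end ModuleAlgebra

namespace TwistDatum

variable (t : TwistDatum k W M) (μ : ModuleAlgebra k W A)

/-- The multiplication of `A ⊗ M` twisted by a twist datum. -/
def mulT : A ⊗[k] M →ₗ[k] A ⊗[k] M →ₗ[k] A ⊗[k] M :=
  twistMul μ.act.toLinearMap t.δ.toLinearMap t.G

theorem mulT_tmul (a b : A) (m n : M) : t.mulT μ (a ⊗ₜ m) (b ⊗ₜ n) =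
    μ.eval2 M a b (t.G * inrM k W M (t.δ m)) * (1 ⊗ₜ n) :=
  μ.twistMul_tmul _ _ _ _ _ _

theorem mulT_eval2_left (a b c : A) (z : (W ⊗[k] W) ⊗[k] M) (n : M) :
    t.mulT μ (μ.eval2 M a b z) (c ⊗ₜ n) =
      μ.eval3 M a b c (comul12 k W M t.G * coactR k (W ⊗[k] W) t.δ z) * (1 ⊗ₜ n) := by
  induction z using tensor3_induction with
  | zero => simp
  | add x y hx hy => simp only [map_add, LinearMap.add_apply, mul_add, add_mul, hx, hy]
  | tmul w w' m =>
    rw [μ.eval2_tmul, t.mulT_tmul, μ.eval2_mul_left, μ.eval3_act_left,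
      map_mul (comul12 k W M), comul12_inrM,
      mul_assoc]
    -- The coaction only sees `m`. Splitting it off on the left leaves `w ⊗ w'` as the right factor,
    -- which is where the actions on `a` and `b` have already put it.
    have h : (w ⊗ₜ[k] w') ⊗ₜ[k] m = (1 ⊗ₜ m) * ((w ⊗ₜ w') ⊗ₜ 1) := by simp
    rw [h, map_mul (coactR k (W ⊗[k] W) t.δ), coactR_right, coactR_left]

theorem mulT_eval2_right (a b c : A) (z : (W ⊗[k] W) ⊗[k] M) (l : M) :
    t.mulT μ (a ⊗ₜ l) (μ.eval2 M b c z) =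
      μ.eval3 M a b c (comul23 k W M (t.G * inrM k W M (t.δ l)) * inr23 k W M z) := by
  induction z using tensor3_induction with
  | zero => simp
  | add x y hx hy => simp only [map_add, mul_add, hx, hy]
  | tmul w w' m =>
    have h : inr23 k W M ((w ⊗ₜ[k] w') ⊗ₜ[k] m) = (((1 ⊗ₜ w) ⊗ₜ w') ⊗ₜ 1) * (1 ⊗ₜ m) := by
      simp [inr23]
    rw [μ.eval2_tmul, t.mulT_tmul, μ.eval2_mul_right, μ.eval3_act_right, h, ← mul_assoc,
      μ.eval3_mul_base]

theorem mulT_mul_base (x y : A ⊗[k] M) (n : M) :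
    t.mulT μ x (y * (1 ⊗ₜ n)) = t.mulT μ x y * (1 ⊗ₜ n) := by
  induction y using TensorProduct.induction_on with
  | zero => simp
  | add y y' hy hy' => simp only [map_add, add_mul, hy, hy']
  | tmul b m =>
    induction x using TensorProduct.induction_on with
    | zero => simp
    | add y y' hy hy' => simp only [map_add, LinearMap.add_apply, add_mul, hy, hy']
    | tmul a l => simp [t.mulT_tmul, mul_assoc]

/-- On pure tensors both sides are values of `eval3`, so an identity in `W ⊗ W ⊗ W ⊗ M` suffices.
Coassociativity makes both occurrences of `δ l` equal to `1 ⊗ (Δ ⊗ id) δ(l)`, the axiom `comm` moves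
it past `1 ⊗ G`, and the cocycle identity does the rest. -/
theorem mulT_assoc (x y z : A ⊗[k] M) :
    t.mulT μ (t.mulT μ x y) z = t.mulT μ x (t.mulT μ y z) := by
  induction x using TensorProduct.induction_on with
  | zero => simp
  | add x x' hx hx' => simp only [map_add, LinearMap.add_apply, hx, hx']
  | tmul a l =>
  induction y using TensorProduct.induction_on with
  | zero => simp
  | add x x' hx hx' => simp only [map_add, LinearMap.add_apply, hx, hx']
  | tmul b m =>
  induction z using TensorProduct.induction_on with
  | zero => simp
  | add x x' hx hx' => simp only [map_add, hx, hx']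
  | tmul c n =>
  rw [t.mulT_tmul μ a b, t.mulT_tmul μ b c, t.mulT_mul_base, ← μ.eval2_mul_base,
    t.mulT_eval2_left, t.mulT_eval2_right]
  congr 2
  simp only [map_mul, coactR_inrM, comul23_inrM, coactR_right, ← t.coassoc]
  rw [mul_assoc (comul23 k W M t.G.1), ← mul_assoc (inr23 k W M (comulM k W M (t.δ l))),
    ← map_mul (inr23 k W M), t.comm, map_mul, ← mul_assoc, ← mul_assoc, ← mul_assoc,
    t.cocycle, mul_assoc _ _ (inr23 k W M (inrM k W M _)), mul_assoc, mul_assoc, mul_assoc]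
  congr 3
  -- What remains is that two descriptions of the embedding of `δ m` into the third `W`-leg and `M`
  -- agree.
  generalize t.δ m = x
  induction x using TensorProduct.induction_on with
  | zero => simp
  | add x y hx hy => simp only [map_add, hx, hy]
  | tmul x y => simp [inr23, inrM, Algebra.TensorProduct.one_def]

/-- When one factor lies in the base, the counit conditions remove `G`, so only the coaction is left
here and nothing but ordinary multiplication in `mulT_base`. -/
theorem base_mulT (m : M) (b : A) (n : M) : t.mulT μ (1 ⊗ₜ m) (b ⊗ₜ n) =
    (μ.act.toLinearMap.flip b).rTensor M (t.δ m) * (1 ⊗ₜ n) := by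
  rw [t.mulT_tmul, μ.eval2_one_left, map_mul, t.counit_left, one_mul, counit1_inrM]

theorem mulT_base (x : A ⊗[k] M) (n : M) : t.mulT μ x (1 ⊗ₜ n) = x * (1 ⊗ₜ n) := by
  induction x using TensorProduct.induction_on with
  | zero => simp
  | add x x' hx hx' => simp only [map_add, LinearMap.add_apply, add_mul, hx, hx']
  | tmul a l =>
    rw [t.mulT_tmul, μ.eval2_one_right, map_mul, t.counit_right, one_mul, counit2_inrM, t.counit_δ]
    simp

theorem one_mulT (x : A ⊗[k] M) : t.mulT μ 1 x = x := by
  induction x using TensorProduct.induction_on with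
  | zero => simp
  | add x x' hx hx' => simp only [map_add, hx, hx']
  | tmul a l =>
    rw [Algebra.TensorProduct.one_def, t.base_mulT]
    simp [Algebra.TensorProduct.one_def]

theorem mulT_one (x : A ⊗[k] M) : t.mulT μ x 1 = x := by
  rw [Algebra.TensorProduct.one_def, t.mulT_base, ← Algebra.TensorProduct.one_def, mul_one]

end TwistDatum

end Twisted

/-! ## Equivariant maps and their twisted convolution product -/

section Equivariant

variable {k : Type*} [Field k] {W M D : Type*} [Ring W] [Bialgebra k W] [Ring M] [Algebra k M]
variable [Ring D] [Algebra k D] (j : M →ₐ[k] D)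

/-- The extension `x ⊗ m ↦ φ(x) j(m)` of a linear map `φ : X → D`. -/
def extM {X : Type*} [AddCommGroup X] [Module k X] (φ : X →ₗ[k] D) : X ⊗[k] M →ₗ[k] D :=
  LinearMap.mul' k D ∘ₗ TensorProduct.map φ j.toLinearMap

/-- The map `x ⊗ y ↦ φ(x) ψ(y)`. -/
def boxMul {X Y : Type*} [AddCommGroup X] [Module k X] [AddCommGroup Y] [Module k Y]
    (φ : X →ₗ[k] D) (ψ : Y →ₗ[k] D) : X ⊗[k] Y →ₗ[k] D :=
  LinearMap.mul' k D ∘ₗ TensorProduct.map φ ψ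

@[simp] theorem extM_tmul {X : Type*} [AddCommGroup X] [Module k X] (φ : X →ₗ[k] D) (x : X)
    (m : M) : extM j φ (x ⊗ₜ m) = φ x * j m := by
  simp [extM]

@[simp] theorem boxMul_tmul {X Y : Type*} [AddCommGroup X] [Module k X] [AddCommGroup Y]
    [Module k Y] (φ : X →ₗ[k] D) (ψ : Y →ₗ[k] D) (x : X) (y : Y) :
    boxMul φ ψ (x ⊗ₜ y) = φ x * ψ y := by
  simp [boxMul]

theorem extM_mul_base {X : Type*} [Ring X] [Algebra k X] (φ : X →ₗ[k] D) (z : X ⊗[k] M) (m : M) :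
    extM j φ (z * (1 ⊗ₜ m)) = extM j φ z * j m := by
  induction z using TensorProduct.induction_on with
  | zero => simp
  | add x y hx hy => simp only [map_add, add_mul, hx, hy]
  | tmul x n => simp [mul_assoc]

namespace TwistDatum

variable (t : TwistDatum k W M)

/-- The linear maps `f : W → D` with `f(m₍₁₎ w) j(m₍∞₎) = j(m) f(w)`. -/
def equivariant : Submodule k (W →ₗ[k] D) where
  -- Since `extM j f` is right `M`-linear, quantifying over all `z` in `W ⊗ M` is no stronger than
  -- over `w ⊗ 1`, and it lets `δ m` be handled as a factor in an algebra.
  carrier := {f | ∀ m z, extM j f (t.δ m * z) = j m * extM j f z}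
  zero_mem' m z := by simp [extM]
  add_mem' {f g} hf hg m z := by
    have h : extM j (f + g) = extM j f + extM j g := by
      ext; simp [add_mul]
    simp only [h, LinearMap.add_apply, mul_add, hf m z, hg m z]
  smul_mem' c f hf m z := by
    have h : extM j (c • f) = c • extM j f := by
      ext; simp
    simp only [h, LinearMap.smul_apply, mul_smul_comm, hf m z]

variable {j t}

/-- Equivariance of `h` is used to carry the `j(m)` in the middle of `φ(x) j(m) h(w) j(n)` to the
right. The price is one coaction on the `M`-leg of `x`. -/
theorem extM_boxMul {X : Type*} [Ring X] [Algebra k X] (φ : X →ₗ[k] D) {h : W →ₗ[k] D}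
    (hh : h ∈ t.equivariant j) (x : X ⊗[k] M) (z : W ⊗[k] M) :
    extM j (boxMul φ h) (coactR k X t.δ x *
      Algebra.TensorProduct.map Algebra.TensorProduct.includeRight (AlgHom.id k M) z) =
        extM j φ x * extM j h z := by
  induction x using TensorProduct.induction_on with
  | zero => simp
  | add x y hx hy => simp only [map_add, add_mul, hx, hy]
  | tmul x m =>
    have hx : x ⊗ₜ[k] m = (x ⊗ₜ 1) * (1 ⊗ₜ m) := by simp
    rw [hx, map_mul (coactR k X t.δ), coactR_right, coactR_left, mul_assoc, ← map_mul, ← hx,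
      extM_tmul, mul_assoc, ← hh m z]
    generalize t.δ m * z = y
    induction y using TensorProduct.induction_on with
    | zero => simp
    | add x y hx hy => simp only [map_add, mul_add, hx, hy]
    | tmul w n => simp [mul_assoc]

/-- `j m` passes `f` and then `g`; each passage costs one coaction, whence the iterated coaction of
`m`. -/
theorem extM_boxMul_δ {f g : W →ₗ[k] D} (hf : f ∈ t.equivariant j) (hg : g ∈ t.equivariant j)
    (m : M) (z : (W ⊗[k] W) ⊗[k] M) :
    extM j (boxMul f g) (coactR k W t.δ (t.δ m) * z) = j m * extM j (boxMul f g) z := by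
  induction z using tensor3_induction with
  | zero => simp
  | add x y hx hy => simp only [map_add, mul_add, hx, hy]
  | tmul w w' n =>
    have hw : (w ⊗ₜ[k] w') ⊗ₜ[k] n = coactR k W t.δ (w ⊗ₜ 1) *
        Algebra.TensorProduct.map Algebra.TensorProduct.includeRight (AlgHom.id k M) (w' ⊗ₜ n) := by
      simp [coactR_left]
    rw [hw, ← mul_assoc, ← map_mul, extM_boxMul _ hg, extM_boxMul _ hg, hf, mul_assoc]

variable (j t)

/-- The twisted convolution product of linear maps. -/
def conv (f g : W →ₗ[k] D) : W →ₗ[k] D :=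
  extM j (boxMul f g) ∘ₗ LinearMap.mulLeft k (t.G⁻¹ : ((W ⊗[k] W) ⊗[k] M)ˣ).1 ∘ₗ
    (TensorProduct.mk k (W ⊗[k] W) M).flip 1 ∘ₗ comul

theorem conv_apply (f g : W →ₗ[k] D) (w : W) : t.conv j f g w =
    extM j (boxMul f g) (t.G⁻¹.1 * (comul (R := k) w ⊗ₜ 1)) := rfl

theorem extM_conv (f g : W →ₗ[k] D) (z : W ⊗[k] M) :
    extM j (t.conv j f g) z = extM j (boxMul f g) (t.G⁻¹.1 * comulM k W M z) := by
  induction z using TensorProduct.induction_on with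
  | zero => simp
  | add x y hx hy => simp only [map_add, mul_add, hx, hy]
  | tmul w m =>
    rw [extM_tmul, conv_apply, ← extM_mul_base, mul_assoc]
    simp [comulM]

variable {j t}

/-- By coassociativity the iterated coaction is `(Δ ⊗ id) δ(m)`, and this commutes with the inverse
twist. -/
theorem conv_mem {f g : W →ₗ[k] D} (hf : f ∈ t.equivariant j) (hg : g ∈ t.equivariant j) :
    t.conv j f g ∈ t.equivariant j := by
  intro m z
  rw [extM_conv, extM_conv, map_mul (comulM k W M), ← mul_assoc, ← t.comm_inv, mul_assoc, t.coassoc,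
    extM_boxMul_δ hf hg]

theorem counit_mem : Algebra.linearMap k D ∘ₗ counit ∈ t.equivariant j := by
  have h : ∀ z : W ⊗[k] M, extM j (Algebra.linearMap k D ∘ₗ counit) z =
      j (Algebra.TensorProduct.lid k M (Algebra.TensorProduct.map (Bialgebra.counitAlgHom k W)
        (AlgHom.id k M) z)) := by
    intro z
    induction z using TensorProduct.induction_on with
    | zero => simp
    | add x y hx hy => simp only [map_add, hx, hy]
    | tmul w m => simp [Algebra.smul_def]
  intro m z
  rw [h, h, map_mul, map_mul, map_mul]
  congr 2
  exact t.counit_δ m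

/-- The base leg of the inner inverse twist stands between `g` and `h`. Moving it past `h` requires
`h` to be equivariant and turns the inverse twist into its coaction. -/
theorem extM_boxMul_conv_left {f g h : W →ₗ[k] D} (hh : h ∈ t.equivariant j)
    (z : (W ⊗[k] W) ⊗[k] M) : extM j (boxMul (t.conv j f g) h) z =
      extM j (boxMul (boxMul f g) h)
        (coactR k (W ⊗[k] W) t.δ t.G⁻¹.1 * comul12 k W M z) := by
  induction z using tensor3_induction with
  | zero => simp
  | add x y hx hy => simp only [map_add, mul_add, hx, hy]
  | tmul w w' m =>
    have hw : comul12 k W M ((w ⊗ₜ[k] w') ⊗ₜ[k] m) =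
        coactR k (W ⊗[k] W) t.δ (comul (R := k) w ⊗ₜ 1) *
        Algebra.TensorProduct.map Algebra.TensorProduct.includeRight (AlgHom.id k M) (w' ⊗ₜ m) := by
      simp [coactR_left, comul12]
    rw [hw, ← mul_assoc, ← map_mul, extM_boxMul _ hh, ← conv_apply]
    simp [mul_assoc]

theorem boxMul_boxMul_assoc (f g h : W →ₗ[k] D) (w : W) (z : (W ⊗[k] W) ⊗[k] M) :
    extM j (boxMul (boxMul f g) h) (((w ⊗ₜ 1) ⊗ₜ 1) ⊗ₜ 1 * inr23 k W M z) =
      f w * extM j (boxMul g h) z := by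
  induction z using tensor3_induction with
  | zero => simp
  | add x y hx hy => simp only [map_add, mul_add, hx, hy]
  | tmul x y m => simp [inr23, mul_assoc]

/-- Here the base leg of the inner inverse twist is already to the right of all three maps, so no
equivariance is needed. -/
theorem extM_boxMul_conv_right (f g h : W →ₗ[k] D)
    (z : (W ⊗[k] W) ⊗[k] M) : extM j (boxMul f (t.conv j g h)) z =
      extM j (boxMul (boxMul f g) h) (inr23 k W M t.G⁻¹.1 * comul23 k W M z) := by
  induction z using tensor3_induction with
  | zero => simp
  | add x y hx hy => simp only [map_add, mul_add, hx, hy]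
  | tmul w w' m =>
    -- `w` occupies the first leg, where `inr23` has only `1`.
    have hc : ∀ z, inr23 k W M z * (((w ⊗ₜ 1) ⊗ₜ 1) ⊗ₜ 1) =
        (((w ⊗ₜ 1) ⊗ₜ 1) ⊗ₜ 1) * inr23 k W M z := by
      intro z
      induction z using tensor3_induction with
      | zero => simp
      | add x y hx hy => simp only [map_add, add_mul, mul_add, hx, hy]
      | tmul x y m => simp [inr23]
    have hw : comul23 k W M ((w ⊗ₜ[k] w') ⊗ₜ[k] m) =
        (((w ⊗ₜ 1) ⊗ₜ 1) ⊗ₜ 1) * inr23 k W M (comul (R := k) w' ⊗ₜ 1) * (1 ⊗ₜ m) := by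
      simp only [comul23, inr23, Algebra.TensorProduct.map_tmul, AlgHom.comp_apply,
        Bialgebra.comulAlgHom_apply, AlgHom.id_apply, Algebra.TensorProduct.tmul_mul_tmul, one_mul,
        mul_one]
      congr 1
      generalize comul (R := k) w' = x
      induction x using TensorProduct.induction_on with
      | zero => simp
      | add x y hx hy => simp only [map_add, TensorProduct.tmul_add, mul_add, hx, hy]
      | tmul x y => simp
    rw [hw, ← mul_assoc, extM_mul_base, ← mul_assoc, hc, mul_assoc, ← map_mul (inr23 k W M),
      boxMul_boxMul_assoc, ← conv_apply]
    simp

/-- The two bracketings differ by the two sides of `cocycle_inv` and by the two sides of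
coassociativity in `W`. -/
theorem conv_assoc {f g h : W →ₗ[k] D} (hh : h ∈ t.equivariant j) :
    t.conv j (t.conv j f g) h = t.conv j f (t.conv j g h) := by
  ext w
  rw [conv_apply, conv_apply, extM_boxMul_conv_left hh, extM_boxMul_conv_right,
    map_mul (comul12 k W M), map_mul (comul23 k W M),
    ← mul_assoc, ← mul_assoc, t.cocycle_inv]
  congr 2
  simp only [comul12, comul23, Algebra.TensorProduct.map_tmul]
  congr 1
  exact ((TensorProduct.assoc k W W W).eq_symm_apply).2 (Coalgebra.coassoc_apply w)

theorem counit_conv (f : W →ₗ[k] D) : t.conv j (Algebra.linearMap k D ∘ₗ counit) f = f := by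
  have h : ∀ z : (W ⊗[k] W) ⊗[k] M, extM j (boxMul (Algebra.linearMap k D ∘ₗ counit) f) z =
      extM j f (counit1 k W M z) := by
    intro z
    induction z using tensor3_induction with
    | zero => simp
    | add x y hx hy => simp only [map_add, hx, hy]
    | tmul w w' m => simp [counit1, Algebra.algebraMap_eq_smul_one]
  ext w
  rw [conv_apply, h, map_mul, t.counit_left_inv, one_mul]
  have hc : counit1 k W M (comul (R := k) w ⊗ₜ 1) = w ⊗ₜ 1 := by
    simp only [counit1, Algebra.TensorProduct.map_tmul, map_one]
    congr 1
    exact ((TensorProduct.lid k W).eq_symm_apply).1 (Coalgebra.rTensor_counit_comul w)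
  rw [hc]
  simp

theorem conv_counit (f : W →ₗ[k] D) : t.conv j f (Algebra.linearMap k D ∘ₗ counit) = f := by
  have h : ∀ z : (W ⊗[k] W) ⊗[k] M, extM j (boxMul f (Algebra.linearMap k D ∘ₗ counit)) z =
      extM j f (counit2 k W M z) := by
    intro z
    induction z using tensor3_induction with
    | zero => simp
    | add x y hx hy => simp only [map_add, hx, hy]
    | tmul w w' m => simp [counit2, Algebra.algebraMap_eq_smul_one]
  ext w
  rw [conv_apply, h, map_mul, t.counit_right_inv, one_mul]
  have hc : counit2 k W M (comul (R := k) w ⊗ₜ 1) = w ⊗ₜ 1 := by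
    simp only [counit2, Algebra.TensorProduct.map_tmul, map_one]
    congr 1
    exact ((TensorProduct.rid k W).eq_symm_apply).1 (Coalgebra.lTensor_counit_comul w)
  rw [hc]
  simp

theorem conv_add_left (f f' g : W →ₗ[k] D) :
    t.conv j (f + f') g = t.conv j f g + t.conv j f' g := by
  have h : extM j (boxMul (f + f') g) = extM j (boxMul f g) + extM j (boxMul f' g) := by
    ext; simp [add_mul]
  ext w
  simp only [conv_apply, h, LinearMap.add_apply]

theorem conv_add_right (f g g' : W →ₗ[k] D) :
    t.conv j f (g + g') = t.conv j f g + t.conv j f g' := by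
  have h : extM j (boxMul f (g + g')) = extM j (boxMul f g) + extM j (boxMul f g') := by
    ext; simp [add_mul, mul_add]
  ext w
  simp only [conv_apply, h, LinearMap.add_apply]

theorem conv_smul_left (c : k) (f g : W →ₗ[k] D) :
    t.conv j (c • f) g = c • t.conv j f g := by
  have h : extM j (boxMul (c • f) g) = c • extM j (boxMul f g) := by
    ext; simp
  ext w
  simp only [conv_apply, h, LinearMap.smul_apply]

theorem conv_smul_right (c : k) (f g : W →ₗ[k] D) :
    t.conv j f (c • g) = c • t.conv j f g := by
  have h : extM j (boxMul f (c • g)) = c • extM j (boxMul f g) := by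
    ext; simp
  ext w
  simp only [conv_apply, h, LinearMap.smul_apply]

instance equivariant.instRing : Ring (t.equivariant j) where
  __ := (inferInstance : AddCommGroup (t.equivariant j))
  mul f g := ⟨t.conv j f.1 g.1, conv_mem f.2 g.2⟩
  one := ⟨Algebra.linearMap k D ∘ₗ counit, counit_mem⟩
  mul_assoc f g h := Subtype.ext (conv_assoc h.2)
  one_mul f := Subtype.ext (counit_conv f.1)
  mul_one f := Subtype.ext (conv_counit f.1)
  left_distrib f g h := Subtype.ext (conv_add_right f.1 g.1 h.1)
  right_distrib f g h := Subtype.ext (conv_add_left f.1 g.1 h.1)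
  zero_mul f := Subtype.ext (by
    have h := conv_smul_left (t := t) (j := j) 0 0 f.1
    rwa [zero_smul, zero_smul] at h)
  mul_zero f := Subtype.ext (by
    have h := conv_smul_right (t := t) (j := j) 0 f.1 0
    rwa [zero_smul, zero_smul] at h)

instance equivariant.instAlgebra : Algebra k (t.equivariant j) :=
  Algebra.ofModule (fun c f g => Subtype.ext (conv_smul_left c f.1 g.1))
    (fun c f g => Subtype.ext (conv_smul_right c f.1 g.1))

theorem equivariant.coe_mul (f g : t.equivariant j) :
    ((f * g : t.equivariant j) : W →ₗ[k] D) = t.conv j f.1 g.1 := rfl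

theorem equivariant.coe_one :
    ((1 : t.equivariant j) : W →ₗ[k] D) = Algebra.linearMap k D ∘ₗ counit := rfl

end TwistDatum

end Equivariant

/-! ## Comparison of an algebra over the base with a twisted product -/

section Comparison

variable {k : Type*} [Field k] {W M A D : Type*} [Ring W] [Bialgebra k W] [Ring M] [Algebra k M]
variable [Ring A] [Algebra k A] [Ring D] [Algebra k D] {j : M →ₐ[k] D}

namespace TwistDatum

variable {t : TwistDatum k W M} (μ : ModuleAlgebra k W A) (ψ : A →ₐ[k] t.equivariant j)

/-- The map `a ⊗ m ↦ ψ(a)(1) j(m)`. -/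
def untwist : A ⊗[k] M →ₗ[k] D :=
  extM j (LinearMap.applyₗ (1 : W) ∘ₗ (t.equivariant j).subtype ∘ₗ ψ.toLinearMap)

@[simp] theorem untwist_tmul (a : A) (m : M) :
    untwist ψ (a ⊗ₜ m) = (ψ a : W →ₗ[k] D) 1 * j m := by
  simp [untwist]

variable {μ ψ}

/-- `ψ(a b)(1)` is the convolution product at `1`, that is, the box product evaluated on the inverse
twist. By `hψ` the elements acting on `a` and `b` appear as right factors of its legs. -/
theorem untwist_eval2
    (hψ : ∀ w a w', (ψ (μ.act w a) : W →ₗ[k] D) w' = (ψ a : W →ₗ[k] D) (w' * w))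
    (a b : A) (z : (W ⊗[k] W) ⊗[k] M) : untwist ψ (μ.eval2 M a b z) =
      extM j (boxMul (ψ a : W →ₗ[k] D) (ψ b : W →ₗ[k] D)) (t.G⁻¹.1 * z) := by
  induction z using tensor3_induction with
  | zero => simp
  | add x y hx hy => simp only [map_add, mul_add, hx, hy]
  | tmul w w' m =>
    have hw : (w ⊗ₜ[k] w') ⊗ₜ[k] m = (w ⊗ₜ w') ⊗ₜ 1 * 1 ⊗ₜ m := by simp
    rw [μ.eval2_tmul, untwist_tmul, map_mul ψ, equivariant.coe_mul, conv_apply,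
      Bialgebra.comul_one, ← Algebra.TensorProduct.one_def, mul_one, hw, ← mul_assoc, extM_mul_base]
    congr 1
    generalize t.G⁻¹.1 = y
    induction y using tensor3_induction with
    | zero => simp
    | add x y hx hy => simp only [map_add, add_mul, hx, hy]
    | tmul p q n => simp [hψ]

/-- The twist in the product meets the inverse twist from `untwist_eval2` and cancels. With `f = ψ
a` and `g = ψ b` there remains `f(1) g(l₍₁₎) j(l₍∞₎) j(n)`, which is `f(1) j(l) g(1) j(n)` by
equivariance of `g`. -/
theorem untwist_mulT
    (hψ : ∀ w a w', (ψ (μ.act w a) : W →ₗ[k] D) w' = (ψ a : W →ₗ[k] D) (w' * w))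
    (x y : A ⊗[k] M) : untwist ψ (t.mulT μ x y) = untwist ψ x * untwist ψ y := by
  induction x using TensorProduct.induction_on with
  | zero => simp
  | add x x' hx hx' => simp only [map_add, LinearMap.add_apply, add_mul, hx, hx']
  | tmul a l =>
  induction y using TensorProduct.induction_on with
  | zero => simp
  | add x x' hx hx' => simp only [map_add, mul_add, hx, hx']
  | tmul b n =>
  rw [t.mulT_tmul, ← μ.eval2_mul_base, untwist_eval2 hψ, mul_assoc, ← mul_assoc, Units.inv_mul,
    one_mul, extM_mul_base, untwist_tmul, untwist_tmul, mul_assoc, ← mul_assoc (j l)]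
  have h := (ψ b).2 l 1
  rw [mul_one, Algebra.TensorProduct.one_def, extM_tmul, map_one j, mul_one] at h
  rw [← h, ← mul_assoc]
  congr 1
  generalize t.δ l = z
  induction z using TensorProduct.induction_on with
  | zero => simp
  | add x x' hx hx' => simp only [map_add, mul_add, hx, hx']
  | tmul w m => simp [inrM, mul_assoc]

/-- The same cancellation in the other direction: `Φ` turns the product of values into a twisted
product, whose `G` absorbs the inverse twist of `conv`, and the module algebra axiom reassembles `w
▷ (a b)`. It is the multiplicative step of `DFRT.toTwisted_toDynamical`. -/
theorem map_conv {Φ : D →ₗ[k] A ⊗[k] M} (hΦ : ∀ x y, Φ (x * y) = t.mulT μ (Φ x) (Φ y))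
    (hj : ∀ m, Φ (j m) = 1 ⊗ₜ m) {f g : W →ₗ[k] D} {a b : A}
    (hf : ∀ w, Φ (f w) = μ.act w a ⊗ₜ 1) (hg : ∀ w, Φ (g w) = μ.act w b ⊗ₜ 1) (w : W) :
    Φ (t.conv j f g w) = μ.act w (a * b) ⊗ₜ 1 := by
  have h : ∀ z, Φ (extM j (boxMul f g) z) = μ.eval2 M a b (t.G * z) := by
    intro z
    induction z using tensor3_induction with
    | zero => simp
    | add x y hx hy => simp only [map_add, mul_add, hx, hy]
    | tmul w w' m =>
      have hw : (w ⊗ₜ[k] w') ⊗ₜ[k] m = (w ⊗ₜ w') ⊗ₜ 1 * 1 ⊗ₜ m := by simp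
      rw [extM_tmul, boxMul_tmul, hΦ, hΦ, hj, hf, hg, t.mulT_base, t.mulT_tmul, map_one, map_one,
        mul_one, hw, ← mul_assoc, μ.eval2_mul_base, ← Algebra.TensorProduct.one_def, mul_one]
      congr 1
      generalize t.G.1 = y
      induction y using tensor3_induction with
      | zero => simp
      | add x y hx hy => simp only [map_add, add_mul, hx, hy]
      | tmul p q n => simp
  rw [conv_apply, h, ← mul_assoc, Units.mul_inv, one_mul, μ.act_mul]
  simp [ModuleAlgebra.eval2]

end TwistDatum

end Comparison

/-! ## Opposite and product of twist data -/

section Op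

open MulOpposite

variable {k : Type*} [Field k]

/-- The coproduct and counit are unchanged. Reversing the product reverses it in both legs of
`Δ(ab)` at once, so `Δ` stays multiplicative. -/
instance {U : Type*} [Ring U] [Bialgebra k U] : Bialgebra k Uᵐᵒᵖ :=
  Bialgebra.mk' k Uᵐᵒᵖ (by simp [MulOpposite.counit_def])
    (by intro a b; simp [MulOpposite.counit_def, mul_comm])
    (by simp [MulOpposite.comul_def, Algebra.TensorProduct.one_def])
    (by
      intro a b
      simp only [MulOpposite.comul_def, LinearMap.comp_apply, LinearEquiv.coe_coe,
        coe_opLinearEquiv_symm, unop_mul, Bialgebra.comul_mul]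
      generalize comul (R := k) (unop b) = y
      generalize comul (R := k) (unop a) = x
      induction x using TensorProduct.induction_on with
      | zero => simp
      | add x x' hx hx' => simp only [map_add, mul_add, add_mul, hx, hx']
      | tmul p q =>
        induction y using TensorProduct.induction_on with
        | zero => simp
        | add x x' hx hx' => simp only [map_add, mul_add, add_mul, hx, hx']
        | tmul r s => simp)

/-- Iterating this shows that the passage to opposite algebras reverses products in tensor powers of
any length without permuting legs. -/
theorem map_antimul {X Y X' Y' : Type*} [Ring X] [Algebra k X] [Ring Y] [Algebra k Y] [Ring X']
    [Algebra k X'] [Ring Y'] [Algebra k Y'] {α : X →ₗ[k] X'} {β : Y →ₗ[k] Y'}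
    (hα : ∀ x y, α (x * y) = α y * α x) (hβ : ∀ x y, β (x * y) = β y * β x) (x y : X ⊗[k] Y) :
    TensorProduct.map α β (x * y) = TensorProduct.map α β y * TensorProduct.map α β x := by
  induction x using TensorProduct.induction_on with
  | zero => simp
  | add x x' hx hx' => simp only [map_add, mul_add, add_mul, hx, hx']
  | tmul p q =>
    induction y using TensorProduct.induction_on with
    | zero => simp
    | add x x' hx hx' => simp only [map_add, mul_add, add_mul, hx, hx']
    | tmul r s => simp [hα, hβ]

/-- The map `x ⊗ y ↦ x ⊗ y` from `X ⊗ Y` to `X_op ⊗ Y_op`. -/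
def toOp2 (X Y : Type*) [Ring X] [Algebra k X] [Ring Y] [Algebra k Y] :
    X ⊗[k] Y →ₗ[k] Xᵐᵒᵖ ⊗[k] Yᵐᵒᵖ :=
  TensorProduct.map (opLinearEquiv k).toLinearMap (opLinearEquiv k).toLinearMap

theorem toOp2_mul {X Y : Type*} [Ring X] [Algebra k X] [Ring Y] [Algebra k Y] (x y : X ⊗[k] Y) :
    toOp2 X Y (x * y) = toOp2 X Y y * toOp2 X Y x :=
  map_antimul (fun _ _ => rfl) (fun _ _ => rfl) x y

variable {W M : Type*} [Ring W] [Bialgebra k W] [Ring M] [Algebra k M]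

/-- The map `u ⊗ v ⊗ w ⊗ m ↦ u ⊗ v ⊗ w ⊗ m` to the tensor product of opposite algebras. -/
def toOp4 : ((W ⊗[k] W) ⊗[k] W) ⊗[k] M →ₗ[k] ((Wᵐᵒᵖ ⊗[k] Wᵐᵒᵖ) ⊗[k] Wᵐᵒᵖ) ⊗[k] Mᵐᵒᵖ :=
  TensorProduct.map
    (TensorProduct.map (toOp2 W W) (opLinearEquiv k).toLinearMap) (opLinearEquiv k).toLinearMap

theorem toOp_mul (x y : (W ⊗[k] W) ⊗[k] M) : toOp (x * y) = toOp y * toOp x :=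
  map_antimul (fun x y => toOp2_mul x y) (fun _ _ => rfl) x y

theorem toOp4_mul (x y : ((W ⊗[k] W) ⊗[k] W) ⊗[k] M) : toOp4 (x * y) = toOp4 y * toOp4 x :=
  map_antimul (map_antimul (fun x y => toOp2_mul x y) (fun _ _ => rfl)) (fun _ _ => rfl) x y

theorem toOp_one : toOp (1 : (W ⊗[k] W) ⊗[k] M) = 1 := by
  simp [toOp, Algebra.TensorProduct.one_def]

theorem toOp2_one {X Y : Type*} [Ring X] [Algebra k X] [Ring Y] [Algebra k Y] :
    toOp2 X Y (1 : X ⊗[k] Y) = 1 := by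
  simp [toOp2, Algebra.TensorProduct.one_def]

theorem comulM_toOp2 (z : W ⊗[k] M) :
    comulM k Wᵐᵒᵖ Mᵐᵒᵖ (toOp2 W M z) = toOp (comulM k W M z) := by
  induction z using TensorProduct.induction_on with
  | zero => simp
  | add x y hx hy => simp only [map_add, hx, hy]
  | tmul w m => simp [comulM, toOp2, toOp, MulOpposite.comul_def]

theorem comul12_toOp (z : (W ⊗[k] W) ⊗[k] M) :
    comul12 k Wᵐᵒᵖ Mᵐᵒᵖ (toOp z) = toOp4 (comul12 k W M z) := by
  induction z using tensor3_induction with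
  | zero => simp
  | add x y hx hy => simp only [map_add, hx, hy]
  | tmul w w' m => simp [comul12, toOp2, toOp4, toOp, MulOpposite.comul_def]

theorem comul23_toOp (z : (W ⊗[k] W) ⊗[k] M) :
    comul23 k Wᵐᵒᵖ Mᵐᵒᵖ (toOp z) = toOp4 (comul23 k W M z) := by
  induction z using tensor3_induction with
  | zero => simp
  | add x y hx hy => simp only [map_add, hx, hy]
  | tmul w w' m =>
    simp [comul23, toOp4, toOp, MulOpposite.comul_def]
    congr 1
    generalize comul (R := k) w' = x
    induction x using TensorProduct.induction_on with
    | zero => simp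
    | add x y hx hy => simp only [map_add, TensorProduct.tmul_add, hx, hy]
    | tmul w m => simp [toOp2]

theorem inr23_toOp (z : (W ⊗[k] W) ⊗[k] M) :
    inr23 k Wᵐᵒᵖ Mᵐᵒᵖ (toOp z) = toOp4 (inr23 k W M z) := by
  induction z using tensor3_induction with
  | zero => simp
  | add x y hx hy => simp only [map_add, hx, hy]
  | tmul w w' m => simp [inr23, toOp2, toOp4, toOp]

theorem counit1_toOp (z : (W ⊗[k] W) ⊗[k] M) :
    counit1 k Wᵐᵒᵖ Mᵐᵒᵖ (toOp z) = toOp2 W M (counit1 k W M z) := by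
  induction z using tensor3_induction with
  | zero => simp
  | add x y hx hy => simp only [map_add, hx, hy]
  | tmul w w' m => simp [counit1, toOp2, toOp, MulOpposite.counit_def]

theorem counit2_toOp (z : (W ⊗[k] W) ⊗[k] M) :
    counit2 k Wᵐᵒᵖ Mᵐᵒᵖ (toOp z) = toOp2 W M (counit2 k W M z) := by
  induction z using tensor3_induction with
  | zero => simp
  | add x y hx hy => simp only [map_add, hx, hy]
  | tmul w w' m => simp [counit2, toOp2, toOp, MulOpposite.counit_def]

/-- The coaction of `W_op` on `M_op`. -/
def coactOpHom (δ : M →ₐ[k] W ⊗[k] M) : Mᵐᵒᵖ →ₐ[k] Wᵐᵒᵖ ⊗[k] Mᵐᵒᵖ :=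
  AlgHom.ofLinearMap (toOp2 W M ∘ₗ δ.toLinearMap ∘ₗ (opLinearEquiv k).symm.toLinearMap)
    (by simp [toOp2_one]) (fun x y => by simp [toOp2_mul])

theorem coactOpHom_op (δ : M →ₐ[k] W ⊗[k] M) (m : M) :
    coactOpHom δ (op m) = toOp2 W M (δ m) := rfl

theorem coactR_toOp2 (δ : M →ₐ[k] W ⊗[k] M) (z : W ⊗[k] M) :
    coactR k Wᵐᵒᵖ (coactOpHom δ) (toOp2 W M z) = toOp (coactR k W δ z) := by
  induction z using TensorProduct.induction_on with
  | zero => simp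
  | add x y hx hy => simp only [map_add, hx, hy]
  | tmul w m =>
    have h : toOp2 W M (w ⊗ₜ[k] m) = op w ⊗ₜ op m := rfl
    simp only [coactR, AlgHom.comp_apply, Algebra.TensorProduct.map_tmul, AlgHom.id_apply, h,
      coactOpHom_op]
    generalize δ m = x
    induction x using TensorProduct.induction_on with
    | zero => simp
    | add x y hx hy => simp only [map_add, TensorProduct.tmul_add, hx, hy]
    | tmul p q => simp [toOp2, toOp]

theorem coactR_toOp (δ : M →ₐ[k] W ⊗[k] M) (z : (W ⊗[k] W) ⊗[k] M) :
    coactR k (Wᵐᵒᵖ ⊗[k] Wᵐᵒᵖ) (coactOpHom δ) (toOp z) = toOp4 (coactR k (W ⊗[k] W) δ z) := by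
  induction z using tensor3_induction with
  | zero => simp
  | add x y hx hy => simp only [map_add, hx, hy]
  | tmul w w' m =>
    have h : toOp ((w ⊗ₜ[k] w') ⊗ₜ[k] m) = (op w ⊗ₜ op w') ⊗ₜ op m := rfl
    simp only [coactR, AlgHom.comp_apply, Algebra.TensorProduct.map_tmul, AlgHom.id_apply, h,
      coactOpHom_op]
    generalize δ m = x
    induction x using TensorProduct.induction_on with
    | zero => simp
    | add x y hx hy => simp only [map_add, TensorProduct.tmul_add, hx, hy]
    | tmul p q => simp [toOp2, toOp4]

namespace TwistDatum

/-- The opposite of a twist datum: the inverse of the twist, viewed in the opposite algebras. -/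
def op (t : TwistDatum k W M) : TwistDatum k Wᵐᵒᵖ Mᵐᵒᵖ where
  δ := coactOpHom t.δ
  -- `toOp` reverses products, so the axioms for `G` would arrive in the wrong order; those for the
  -- inverse, already reversed, arrive in the right one.
  G := ⟨toOp t.G⁻¹.1, toOp t.G.1, by rw [← toOp_mul, Units.mul_inv, toOp_one],
    by rw [← toOp_mul, Units.inv_mul, toOp_one]⟩
  counit_δ m := by
    obtain ⟨m, rfl⟩ := op_surjective m
    have h : ∀ z, TensorProduct.lid k Mᵐᵒᵖ ((counit (R := k) (A := Wᵐᵒᵖ)).rTensor Mᵐᵒᵖ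
        (toOp2 W M z)) =
        MulOpposite.op (TensorProduct.lid k M ((counit (R := k) (A := W)).rTensor M z)) := by
      intro z
      induction z using TensorProduct.induction_on with
      | zero => simp
      | add x y hx hy => simp only [map_add, hx, hy, op_add]
      | tmul w m => simp [toOp2, MulOpposite.counit_def]
    rw [coactOpHom_op, h, t.counit_δ]
  coassoc m := by
    obtain ⟨m, rfl⟩ := op_surjective m
    rw [coactOpHom_op, comulM_toOp2, coactR_toOp2, t.coassoc]
  comm m := by
    obtain ⟨m, rfl⟩ := op_surjective m
    rw [coactOpHom_op, comulM_toOp2, ← toOp_mul, ← toOp_mul, t.comm_inv]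
  cocycle := by
    simp only [comul12_toOp, comul23_toOp, inr23_toOp, coactR_toOp, ← toOp4_mul, t.cocycle_inv]
  counit_left := by rw [counit1_toOp, t.counit_left_inv, toOp2_one]
  counit_right := by rw [counit2_toOp, t.counit_right_inv, toOp2_one]

end TwistDatum

end Op

section Product

variable {k : Type*} [Field k] {W M W' M' : Type*} [Ring W] [Bialgebra k W] [Ring M] [Algebra k M]
variable [Ring W'] [Bialgebra k W'] [Ring M'] [Algebra k M']

variable (k W M W' M') in
/-- The shuffle `(W ⊗ M) ⊗ (W' ⊗ M') → (W ⊗ W') ⊗ (M ⊗ M')`. -/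
def shuffle2 : (W ⊗[k] M) ⊗[k] (W' ⊗[k] M') →ₐ[k] (W ⊗[k] W') ⊗[k] (M ⊗[k] M') :=
  (Algebra.TensorProduct.tensorTensorTensorComm k k k k W M W' M').toAlgHom

variable (k W M W' M') in
/-- The shuffle of `W ⊗ W ⊗ M` and `W' ⊗ W' ⊗ M'`. -/
def shuffle3 : ((W ⊗[k] W) ⊗[k] M) ⊗[k] ((W' ⊗[k] W') ⊗[k] M') →ₐ[k]
    ((W ⊗[k] W') ⊗[k] (W ⊗[k] W')) ⊗[k] (M ⊗[k] M') :=
  (Algebra.TensorProduct.map (shuffle2 k W W W' W') (AlgHom.id k _)).comp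
    (shuffle2 k (W ⊗[k] W) M (W' ⊗[k] W') M')

variable (k W M W' M') in
/-- The shuffle of `W ⊗ W ⊗ W ⊗ M` and `W' ⊗ W' ⊗ W' ⊗ M'`. -/
def shuffle4 : (((W ⊗[k] W) ⊗[k] W) ⊗[k] M) ⊗[k] (((W' ⊗[k] W') ⊗[k] W') ⊗[k] M') →ₐ[k]
    (((W ⊗[k] W') ⊗[k] (W ⊗[k] W')) ⊗[k] (W ⊗[k] W')) ⊗[k] (M ⊗[k] M') :=
  (Algebra.TensorProduct.map (shuffle3 k W W W' W') (AlgHom.id k _)).comp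
    ((Algebra.TensorProduct.tensorTensorTensorComm k k k k
      ((W ⊗[k] W) ⊗[k] W) M ((W' ⊗[k] W') ⊗[k] W') M').toAlgHom)

@[simp] theorem shuffle2_tmul (w : W) (m : M) (w' : W') (m' : M') :
    shuffle2 k W M W' M' ((w ⊗ₜ m) ⊗ₜ (w' ⊗ₜ m')) = (w ⊗ₜ w') ⊗ₜ (m ⊗ₜ m') := by
  simp [shuffle2]

@[simp] theorem shuffle3_tmul (x : W ⊗[k] W) (m : M) (x' : W' ⊗[k] W') (m' : M') :
    shuffle3 k W M W' M' ((x ⊗ₜ m) ⊗ₜ (x' ⊗ₜ m')) =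
      shuffle2 k W W W' W' (x ⊗ₜ x') ⊗ₜ (m ⊗ₜ m') := by
  simp [shuffle3, shuffle2]

@[simp] theorem shuffle4_tmul (x : (W ⊗[k] W) ⊗[k] W) (m : M) (x' : (W' ⊗[k] W') ⊗[k] W')
    (m' : M') : shuffle4 k W M W' M' ((x ⊗ₜ m) ⊗ₜ (x' ⊗ₜ m')) =
      shuffle3 k W W W' W' (x ⊗ₜ x') ⊗ₜ (m ⊗ₜ m') := by
  simp [shuffle4]

theorem shuffle4_mul (x y : ((W ⊗[k] W) ⊗[k] W) ⊗[k] M) (x' y' : ((W' ⊗[k] W') ⊗[k] W') ⊗[k] M') :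
    shuffle4 k W M W' M' (x ⊗ₜ x') * shuffle4 k W M W' M' (y ⊗ₜ y') =
      shuffle4 k W M W' M' ((x * y) ⊗ₜ (x' * y')) :=
  ((shuffle4 k W M W' M').map_mul (x ⊗ₜ x') (y ⊗ₜ y')).symm.trans
    (congrArg _ (Algebra.TensorProduct.tmul_mul_tmul x y x' y'))

theorem comul_tmul_shuffle (w : W) (w' : W') : comul (R := k) (w ⊗ₜ[k] w') =
    shuffle2 k W W W' W' (comul (R := k) w ⊗ₜ comul (R := k) w') := by
  rw [TensorProduct.comul_tmul]
  rfl

/-- The shuffles are algebra homomorphisms that intertwine each structure map of the product with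
the pair of structure maps of the factors. This and the following lemmas verify that map by map, so
that every axiom of `TwistDatum.tensor` follows from the two given ones. -/
theorem comulM_shuffle2 (x : W ⊗[k] M) (y : W' ⊗[k] M') :
    comulM k (W ⊗[k] W') (M ⊗[k] M') (shuffle2 k W M W' M' (x ⊗ₜ y)) =
      shuffle3 k W M W' M' (comulM k W M x ⊗ₜ comulM k W' M' y) := by
  induction x using TensorProduct.induction_on with
  | zero => simp
  | add x x' hx hx' => simp only [map_add, TensorProduct.add_tmul, hx, hx']
  | tmul w m =>
  induction y using TensorProduct.induction_on with
  | zero => simp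
  | add x x' hx hx' => simp only [map_add, TensorProduct.tmul_add, hx, hx']
  | tmul w' m' => simp [comulM, comul_tmul_shuffle, -TensorProduct.comul_tmul]

theorem comul12_shuffle3 (x : (W ⊗[k] W) ⊗[k] M) (y : (W' ⊗[k] W') ⊗[k] M') :
    comul12 k (W ⊗[k] W') (M ⊗[k] M') (shuffle3 k W M W' M' (x ⊗ₜ y)) =
      shuffle4 k W M W' M' (comul12 k W M x ⊗ₜ comul12 k W' M' y) := by
  induction x using tensor3_induction with
  | zero => simp
  | add x x' hx hx' => simp only [map_add, TensorProduct.add_tmul, hx, hx']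
  | tmul w₁ w₂ m =>
  induction y using tensor3_induction with
  | zero => simp
  | add x x' hx hx' => simp only [map_add, TensorProduct.tmul_add, hx, hx']
  | tmul w₁' w₂' m' => simp [comul12, comul_tmul_shuffle, -TensorProduct.comul_tmul]

theorem comul23_shuffle3 (x : (W ⊗[k] W) ⊗[k] M) (y : (W' ⊗[k] W') ⊗[k] M') :
    comul23 k (W ⊗[k] W') (M ⊗[k] M') (shuffle3 k W M W' M' (x ⊗ₜ y)) =
      shuffle4 k W M W' M' (comul23 k W M x ⊗ₜ comul23 k W' M' y) := by
  induction x using tensor3_induction with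
  | zero => simp
  | add x x' hx hx' => simp only [map_add, TensorProduct.add_tmul, hx, hx']
  | tmul w₁ w₂ m =>
  induction y using tensor3_induction with
  | zero => simp
  | add x x' hx hx' => simp only [map_add, TensorProduct.tmul_add, hx, hx']
  | tmul w₁' w₂' m' =>
    simp only [shuffle3_tmul, shuffle2_tmul, comul23, Algebra.TensorProduct.map_tmul,
      AlgHom.comp_apply, AlgHom.id_apply, Bialgebra.comulAlgHom_apply, comul_tmul_shuffle,
      shuffle4_tmul]
    congr 1
    generalize comul (R := k) w₂ = x
    generalize comul (R := k) w₂' = y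
    induction x using TensorProduct.induction_on with
    | zero => simp
    | add x x' hx hx' =>
      simp only [map_add, TensorProduct.add_tmul, TensorProduct.tmul_add, hx, hx']
    | tmul a b =>
    induction y using TensorProduct.induction_on with
    | zero => simp
    | add x x' hx hx' => simp only [map_add, TensorProduct.tmul_add, hx, hx']
    | tmul a' b' => simp

theorem inr23_shuffle3 (x : (W ⊗[k] W) ⊗[k] M) (y : (W' ⊗[k] W') ⊗[k] M') :
    inr23 k (W ⊗[k] W') (M ⊗[k] M') (shuffle3 k W M W' M' (x ⊗ₜ y)) =
      shuffle4 k W M W' M' (inr23 k W M x ⊗ₜ inr23 k W' M' y) := by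
  induction x using tensor3_induction with
  | zero => simp
  | add x x' hx hx' => simp only [map_add, TensorProduct.add_tmul, hx, hx']
  | tmul w₁ w₂ m =>
  induction y using tensor3_induction with
  | zero => simp
  | add x x' hx hx' => simp only [map_add, TensorProduct.tmul_add, hx, hx']
  | tmul w₁' w₂' m' => simp [inr23, Algebra.TensorProduct.one_def]

theorem counit1_shuffle3 (x : (W ⊗[k] W) ⊗[k] M) (y : (W' ⊗[k] W') ⊗[k] M') :
    counit1 k (W ⊗[k] W') (M ⊗[k] M') (shuffle3 k W M W' M' (x ⊗ₜ y)) =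
      shuffle2 k W M W' M' (counit1 k W M x ⊗ₜ counit1 k W' M' y) := by
  induction x using tensor3_induction with
  | zero => simp
  | add x x' hx hx' => simp only [map_add, TensorProduct.add_tmul, hx, hx']
  | tmul w₁ w₂ m =>
  induction y using tensor3_induction with
  | zero => simp
  | add x x' hx hx' => simp only [map_add, TensorProduct.tmul_add, hx, hx']
  | tmul w₁' w₂' m' => simp [counit1, TensorProduct.counit_tmul, TensorProduct.smul_tmul',
      smul_smul,
      TensorProduct.tmul_smul, mul_comm]

theorem counit2_shuffle3 (x : (W ⊗[k] W) ⊗[k] M) (y : (W' ⊗[k] W') ⊗[k] M') :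
    counit2 k (W ⊗[k] W') (M ⊗[k] M') (shuffle3 k W M W' M' (x ⊗ₜ y)) =
      shuffle2 k W M W' M' (counit2 k W M x ⊗ₜ counit2 k W' M' y) := by
  induction x using tensor3_induction with
  | zero => simp
  | add x x' hx hx' => simp only [map_add, TensorProduct.add_tmul, hx, hx']
  | tmul w₁ w₂ m =>
  induction y using tensor3_induction with
  | zero => simp
  | add x x' hx hx' => simp only [map_add, TensorProduct.tmul_add, hx, hx']
  | tmul w₁' w₂' m' => simp [counit2, TensorProduct.counit_tmul, TensorProduct.smul_tmul',
      smul_smul,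
      TensorProduct.tmul_smul, mul_comm]

/-- The coaction of `W ⊗ W'` on `M ⊗ M'`. -/
def coactTensor (δ : M →ₐ[k] W ⊗[k] M) (δ' : M' →ₐ[k] W' ⊗[k] M') :
    M ⊗[k] M' →ₐ[k] (W ⊗[k] W') ⊗[k] (M ⊗[k] M') :=
  (shuffle2 k W M W' M').comp (Algebra.TensorProduct.map δ δ')

theorem coactR_shuffle2 (δ : M →ₐ[k] W ⊗[k] M) (δ' : M' →ₐ[k] W' ⊗[k] M')
    (x : W ⊗[k] M) (y : W' ⊗[k] M') :
    coactR k (W ⊗[k] W') (coactTensor δ δ') (shuffle2 k W M W' M' (x ⊗ₜ y)) =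
      shuffle3 k W M W' M' (coactR k W δ x ⊗ₜ coactR k W' δ' y) := by
  induction x using TensorProduct.induction_on with
  | zero => simp
  | add x x' hx hx' => simp only [map_add, TensorProduct.add_tmul, hx, hx']
  | tmul w m =>
  induction y using TensorProduct.induction_on with
  | zero => simp
  | add x x' hx hx' => simp only [map_add, TensorProduct.tmul_add, hx, hx']
  | tmul w' m' =>
    simp only [shuffle2_tmul, coactR, coactTensor, Algebra.TensorProduct.map_tmul,
      AlgHom.comp_apply, AlgHom.id_apply]
    generalize δ m = x
    generalize δ' m' = y
    induction x using TensorProduct.induction_on with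
    | zero => simp
    | add x x' hx hx' =>
      simp only [map_add, TensorProduct.add_tmul, TensorProduct.tmul_add, hx, hx']
    | tmul a b =>
    induction y using TensorProduct.induction_on with
    | zero => simp
    | add x x' hx hx' => simp only [map_add, TensorProduct.tmul_add, hx, hx']
    | tmul a' b' => simp

theorem coactR_shuffle3 (δ : M →ₐ[k] W ⊗[k] M) (δ' : M' →ₐ[k] W' ⊗[k] M')
    (x : (W ⊗[k] W) ⊗[k] M) (y : (W' ⊗[k] W') ⊗[k] M') :
    coactR k ((W ⊗[k] W') ⊗[k] (W ⊗[k] W')) (coactTensor δ δ') (shuffle3 k W M W' M' (x ⊗ₜ y)) =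
      shuffle4 k W M W' M' (coactR k (W ⊗[k] W) δ x ⊗ₜ coactR k (W' ⊗[k] W') δ' y) := by
  induction x using tensor3_induction with
  | zero => simp
  | add x x' hx hx' => simp only [map_add, TensorProduct.add_tmul, hx, hx']
  | tmul w₁ w₂ m =>
  induction y using tensor3_induction with
  | zero => simp
  | add x x' hx hx' => simp only [map_add, TensorProduct.tmul_add, hx, hx']
  | tmul w₁' w₂' m' =>
    simp only [shuffle3_tmul, shuffle2_tmul, coactR, coactTensor, Algebra.TensorProduct.map_tmul,
      AlgHom.comp_apply, AlgHom.id_apply]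
    generalize δ m = x
    generalize δ' m' = y
    induction x using TensorProduct.induction_on with
    | zero => simp
    | add x x' hx hx' =>
      simp only [map_add, TensorProduct.add_tmul, TensorProduct.tmul_add, hx, hx']
    | tmul a b =>
    induction y using TensorProduct.induction_on with
    | zero => simp
    | add x x' hx hx' => simp only [map_add, TensorProduct.tmul_add, hx, hx']
    | tmul a' b' => simp

namespace TwistDatum

set_option maxHeartbeats 2000000 in
/-- The tensor product of two twist data. -/
def tensor (t : TwistDatum k W M) (t' : TwistDatum k W' M') :
    TwistDatum k (W ⊗[k] W') (M ⊗[k] M') where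
  δ := coactTensor t.δ t'.δ
  G := ⟨shuffle3 k W M W' M' (t.G.1 ⊗ₜ t'.G.1), shuffle3 k W M W' M' (t.G⁻¹.1 ⊗ₜ t'.G⁻¹.1),
    by rw [← map_mul]; simp [← Algebra.TensorProduct.one_def],
    by rw [← map_mul]; simp [← Algebra.TensorProduct.one_def]⟩
  counit_δ m := by
    have h : ∀ x y, TensorProduct.lid k (M ⊗[k] M')
        ((counit (R := k) (A := W ⊗[k] W')).rTensor (M ⊗[k] M') (shuffle2 k W M W' M' (x ⊗ₜ y))) =
        TensorProduct.lid k M ((counit (R := k) (A := W)).rTensor M x) ⊗ₜ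
          TensorProduct.lid k M' ((counit (R := k) (A := W')).rTensor M' y) := by
      intro x y
      induction x using TensorProduct.induction_on with
      | zero => simp
      | add x x' hx hx' => simp only [map_add, TensorProduct.add_tmul, hx, hx']
      | tmul w m =>
      induction y using TensorProduct.induction_on with
      | zero => simp
      | add x x' hx hx' => simp only [map_add, TensorProduct.tmul_add, hx, hx']
      | tmul w' m' => simp [TensorProduct.smul_tmul', smul_smul, TensorProduct.tmul_smul, mul_comm]
    induction m using TensorProduct.induction_on with
    | zero => simp
    | add x x' hx hx' => simp only [map_add, hx, hx']
    | tmul m m' =>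
      rw [coactTensor, AlgHom.comp_apply, Algebra.TensorProduct.map_tmul, h, t.counit_δ,
        t'.counit_δ]
  coassoc m := by
    induction m using TensorProduct.induction_on with
    | zero => simp
    | add x x' hx hx' => simp only [map_add, hx, hx']
    | tmul m m' =>
      have h : coactTensor t.δ t'.δ (m ⊗ₜ m') = shuffle2 k W M W' M' (t.δ m ⊗ₜ t'.δ m') := rfl
      rw [h, comulM_shuffle2, coactR_shuffle2, t.coassoc, t'.coassoc]
  comm m := by
    induction m using TensorProduct.induction_on with
    | zero => simp
    | add x x' hx hx' => simp only [map_add, add_mul, mul_add, hx, hx']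
    | tmul m m' =>
      have h : coactTensor t.δ t'.δ (m ⊗ₜ m') = shuffle2 k W M W' M' (t.δ m ⊗ₜ t'.δ m') := rfl
      rw [h, comulM_shuffle2, ← map_mul, ← map_mul, Algebra.TensorProduct.tmul_mul_tmul,
        Algebra.TensorProduct.tmul_mul_tmul, t.comm, t'.comm]
  cocycle := by
    have h := congrArg₂ (fun x y => shuffle4 k W M W' M' (x ⊗ₜ y)) t.cocycle t'.cocycle
    exact (congrArg₂ (· * ·) (comul12_shuffle3 t.G.1 t'.G.1)
      (coactR_shuffle3 t.δ t'.δ t.G.1 t'.G.1)).trans ((shuffle4_mul _ _ _ _).trans (h.trans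
      ((shuffle4_mul _ _ _ _).symm.trans (congrArg₂ (· * ·) (comul23_shuffle3 t.G.1 t'.G.1)
      (inr23_shuffle3 t.G.1 t'.G.1)).symm)))
  counit_left := (counit1_shuffle3 _ _).trans (by
    rw [t.counit_left, t'.counit_left, ← Algebra.TensorProduct.one_def]
    exact map_one (shuffle2 k W M W' M'))
  counit_right := (counit2_shuffle3 _ _).trans (by
    rw [t.counit_right, t'.counit_right, ← Algebra.TensorProduct.one_def]
    exact map_one (shuffle2 k W M W' M'))

end TwistDatum

end Product

/-! ## The twist datum of a dynamical twist -/

section DynamicalTwist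

variable {k : Type*} [Field k] {H U L : Type*} [Ring H] [Bialgebra k H] [Ring U] [Bialgebra k U]
variable [Ring L] [Algebra k L]

/-- In `(Δ ⊗ id) δ(a) · F` the base leg is `a₍∞₎ F_L`. Quasi-commutativity and coassociativity
rewrite the product as `Δ(a₍₁₎)(F₁ ⊗ F₂) ⊗ (a₍₂₎ ▷ F_L) a₍∞₎`, and the invariance of `F` turns this
into `F · (Δ ⊗ id) δ(a)`. -/
theorem IsDynamicalTwist.comm {i : H →ₐc[k] U} {B : BaseAlgebra k H L}
    {F : ((U ⊗[k] U) ⊗[k] L)ˣ} (hF : IsDynamicalTwist (i : H →ₐ[k] U) B F) (a : L) :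
    comulM k U L (coactIn (i : H →ₐ[k] U) B a) * F.1 =
      F.1 * comulM k U L (coactIn (i : H →ₐ[k] U) B a) := by
  let α : H →ₗ[k] Module.End k (U ⊗[k] U) :=
    LinearMap.mul k (U ⊗[k] U) ∘ₗ comul (R := k) (A := U) ∘ₗ (i : H →ₐ[k] U).toLinearMap
  -- `β X` sends `h ⊗ h' ⊗ b` to `Δ(h)(X₁ ⊗ X₂) ⊗ (h' ▷ X_L) b`, the intermediate form of the
  -- product.
  let β : (U ⊗[k] U) ⊗[k] L → (H ⊗[k] H) ⊗[k] L →ₗ[k] (U ⊗[k] U) ⊗[k] L := fun X =>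
    LinearMap.mul' k ((U ⊗[k] U) ⊗[k] L) ∘ₗ TensorProduct.map
      ((TensorProduct.map₂ α B.act.toLinearMap).flip X) (TensorProduct.mk k (U ⊗[k] U) L 1)
  have h₁ : ∀ X z, comulM k U L ((i : H →ₐ[k] U).toLinearMap.rTensor L z) * X =
      β X ((TensorProduct.assoc k H H L).symm (B.coact.toLinearMap.lTensor H z)) := by
    intro X z
    induction z using TensorProduct.induction_on with
    | zero => simp
    | add x x' hx hx' => simp only [map_add, add_mul, hx, hx']
    | tmul h b =>
      induction X using TensorProduct.induction_on with
      | zero =>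
        simp only [mul_zero, β, map_zero, TensorProduct.map_zero_left, LinearMap.comp_zero,
          LinearMap.zero_apply]
      | add x x' hx hx' =>
        rw [mul_add, hx, hx']
        simp only [β, map_add, TensorProduct.map_add_left, LinearMap.comp_add, LinearMap.add_apply]
      | tmul p l =>
        simp only [LinearMap.rTensor_tmul, LinearMap.lTensor_tmul, comulM,
          Algebra.TensorProduct.map_tmul, Algebra.TensorProduct.tmul_mul_tmul, AlgHom.id_apply,
          B.quasiComm b l, AlgHom.toLinearMap_apply]
        generalize B.coact b = y
        induction y using TensorProduct.induction_on with
        | zero => simp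
        | add x x' hx hx' => simp only [map_add, TensorProduct.tmul_add, hx, hx']
        | tmul h' b' => simp [β, α]
  have h₂ : ∀ z, β F.1 ((comul (R := k) (A := H)).rTensor L z) =
      F.1 * comulM k U L ((i : H →ₐ[k] U).toLinearMap.rTensor L z) := by
    intro z
    induction z using TensorProduct.induction_on with
    | zero => simp
    | add x x' hx hx' => simp only [map_add, mul_add, hx, hx']
    | tmul h b =>
      have := hF.invariant h
      simp only [β, LinearMap.rTensor_tmul, LinearMap.comp_apply, TensorProduct.map_tmul,
        LinearMap.mul'_apply, LinearMap.flip_apply, α, this, mul_assoc]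
      congr 1
      simp [comulM]
  rw [coactIn, LinearMap.comp_apply, h₁, AlgHom.toLinearMap_apply, ← B.coact_coassoc,
    LinearEquiv.symm_apply_apply, h₂]

/-- The twist datum of a dynamical twist over a base algebra. -/
def IsDynamicalTwist.datum {i : H →ₐc[k] U} {B : BaseAlgebra k H L}
    {F : ((U ⊗[k] U) ⊗[k] L)ˣ} (hF : IsDynamicalTwist (i : H →ₐ[k] U) B F) :
    TwistDatum k U L where
  δ := (Algebra.TensorProduct.map (i : H →ₐ[k] U) (AlgHom.id k L)).comp B.coact
  G := F
  counit_δ a := by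
    have h : ∀ z, TensorProduct.lid k L ((counit (R := k) (A := U)).rTensor L
        (Algebra.TensorProduct.map (i : H →ₐ[k] U) (AlgHom.id k L) z)) =
        TensorProduct.lid k L ((counit (R := k) (A := H)).rTensor L z) := by
      intro z
      induction z using TensorProduct.induction_on with
      | zero => simp
      | add x x' hx hx' => simp only [map_add, hx, hx']
      | tmul h b => simp
    rw [AlgHom.comp_apply, h, B.coact_counit]
  coassoc a := by
    have h₁ : ∀ z, comulM k U L (Algebra.TensorProduct.map (i : H →ₐ[k] U) (AlgHom.id k L) z) =
        Algebra.TensorProduct.map (Algebra.TensorProduct.map (i : H →ₐ[k] U) (i : H →ₐ[k] U))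
          (AlgHom.id k L) ((comul (R := k) (A := H)).rTensor L z) := by
      intro z
      induction z using TensorProduct.induction_on with
      | zero => simp
      | add x x' hx hx' => simp only [map_add, hx, hx']
      | tmul h b =>
        simp only [comulM, Algebra.TensorProduct.map_tmul, LinearMap.rTensor_tmul]
        congr 1
        exact (CoalgHomClass.map_comp_comul_apply i h).symm
    have h₂ : ∀ z, coactR k U
        ((Algebra.TensorProduct.map (i : H →ₐ[k] U) (AlgHom.id k L)).comp B.coact)
        (Algebra.TensorProduct.map (i : H →ₐ[k] U) (AlgHom.id k L) z) =
        Algebra.TensorProduct.map (Algebra.TensorProduct.map (i : H →ₐ[k] U) (i : H →ₐ[k] U))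
          (AlgHom.id k L)
          ((TensorProduct.assoc k H H L).symm (B.coact.toLinearMap.lTensor H z)) := by
      intro z
      induction z using TensorProduct.induction_on with
      | zero => simp
      | add x x' hx hx' => simp only [map_add, hx, hx']
      | tmul h b =>
        simp only [coactR, AlgHom.comp_apply, Algebra.TensorProduct.map_tmul, AlgHom.id_apply,
          LinearMap.lTensor_tmul, AlgHom.toLinearMap_apply]
        generalize B.coact b = y
        induction y using TensorProduct.induction_on with
        | zero => simp
        | add x x' hx hx' => simp only [map_add, TensorProduct.tmul_add, hx, hx']
        | tmul h' b' => simp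
    rw [AlgHom.comp_apply, h₁, h₂, ← B.coact_coassoc, LinearEquiv.symm_apply_apply]
  comm a := hF.comm a
  -- The linear maps in `IsDynamicalTwist` unfold to the algebra homomorphisms used in `TwistDatum`,
  -- so the remaining axioms carry over as they are.
  cocycle := hF.cocycle
  counit_left := hF.counit_left
  counit_right := hF.counit_right

end DynamicalTwist

end DynFRT

namespace DynFRT

open Coalgebra TensorProduct MulOpposite

/-! ## Matrix coefficients -/

section Generators

variable {k : Type*} [Field k] {ι : Type*} [Fintype ι] [DecidableEq ι]
variable {U : Type*} [Ring U] [Algebra k U] (ρ : U →ₐ[k] Matrix ι ι k)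
variable {Q : Type*} [Ring Q] [Algebra k Q] (T : Matrix ι ι Q)

omit [DecidableEq ι] in
theorem sum_comm_pairs {A : Type*} [AddCommMonoid A] (f : ι → ι → ι → ι → A) :
    ∑ x, ∑ y, ∑ z, ∑ w, f x y z w = ∑ z, ∑ w, ∑ x, ∑ y, f x y z w := by
  refine (Finset.sum_congr rfl fun x _ => Finset.sum_comm).trans (Finset.sum_comm.trans ?_)
  refine Finset.sum_congr rfl fun z _ => ?_
  exact (Finset.sum_congr rfl fun x _ => Finset.sum_comm).trans Finset.sum_comm

/-- The map `y ⊗ x ↦ (ρ(y) T ρ(x)) i j`. -/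
def genMap (i j : ι) : Uᵐᵒᵖ ⊗[k] U →ₗ[k] Q :=
  ∑ a, ∑ b, LinearMap.toSpanSingleton k Q (T a b) ∘ₗ LinearMap.mul' k k ∘ₗ
    TensorProduct.map
      (entry ρ.toLinearMap i a ∘ₗ (MulOpposite.opLinearEquiv k).symm.toLinearMap)
      (entry ρ.toLinearMap b j)

@[simp] theorem entry_apply {X m n : Type*} [AddCommGroup X] [Module k X]
    (f : X →ₗ[k] Matrix m n k) (p : m) (q : n) (x : X) : entry f p q x = f x p q := rfl

@[simp] theorem evalLeft_tmul {X L : Type*} [AddCommGroup X] [Module k X] [Ring L] [Algebra k L]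
    (f : X →ₗ[k] k) (x : X) (a : L) : evalLeft L f (x ⊗ₜ a) = f x • a := by
  simp [evalLeft]

theorem genMap_tmul (i j : ι) (y x : U) : genMap ρ T i j (op y ⊗ₜ[k] x) =
    ∑ a, ∑ b, (ρ y i a * ρ x b j) • T a b := by
  simp [genMap, entry, LinearMap.sum_apply]

theorem genMap_one (i j : ι) : genMap ρ T i j 1 = T i j := by
  rw [Algebra.TensorProduct.one_def, ← op_one, genMap_tmul]
  simp [Matrix.one_apply]

/-- Right multiplication in the opposite algebra is left multiplication in `U`, so `ρ(y)` and `ρ(x)`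
both come out on the outside, as scalars acting on the indices. -/
theorem genMap_mul_tmul (i j : ι) (u : Uᵐᵒᵖ ⊗[k] U) (y x : U) :
    genMap ρ T i j (u * (op y ⊗ₜ[k] x)) =
      ∑ a, ∑ b, (ρ y i a * ρ x b j) • genMap ρ T a b u := by
  induction u using TensorProduct.induction_on with
  | zero => simp
  | add x y hx hy => simp only [map_add, add_mul, hx, hy, smul_add, Finset.sum_add_distrib]
  | tmul y' x' =>
    obtain ⟨y', rfl⟩ := op_surjective y'
    rw [Algebra.TensorProduct.tmul_mul_tmul, ← op_mul, genMap_tmul]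
    simp only [genMap_tmul, map_mul, Matrix.mul_apply, Finset.sum_mul_sum, Finset.sum_smul,
      Finset.smul_sum, smul_smul]
    rw [sum_comm_pairs]
    refine Finset.sum_congr rfl fun a _ => Finset.sum_congr rfl fun b _ =>
      Finset.sum_congr rfl fun c _ => Finset.sum_congr rfl fun d _ => ?_
    congr 1
    ring

end Generators

section Matrices

variable {k : Type*} [Field k] {ι : Type*} [Fintype ι] [DecidableEq ι]
variable {U : Type*} [Ring U] [Bialgebra k U] (ρ : U →ₐ[k] Matrix ι ι k)
variable {L : Type*} [Ring L] [Algebra k L]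

theorem rep2L_add (X Y : (U ⊗[k] U) ⊗[k] L) : rep2L ρ (X + Y) = rep2L ρ X + rep2L ρ Y := by
  ext p q; simp [rep2L]

theorem rep2L_tmul (x : U ⊗[k] U) (a : L) (p q : ι × ι) :
    rep2L ρ (x ⊗ₜ[k] a) p q = rep2 ρ x p q • a := by
  simp [rep2L]

theorem rep2L_zero : rep2L ρ (0 : (U ⊗[k] U) ⊗[k] L) = 0 := by
  ext p q; simp [rep2L]

theorem rep2L_mul (X Y : (U ⊗[k] U) ⊗[k] L) : rep2L ρ (X * Y) = rep2L ρ X * rep2L ρ Y := by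
  induction X using TensorProduct.induction_on with
  | zero => simp [rep2L_zero]
  | add x x' hx hx' => simp only [add_mul, rep2L_add, hx, hx']
  | tmul x a =>
  induction Y using TensorProduct.induction_on with
  | zero => simp [rep2L_zero]
  | add x x' hx hx' => simp only [mul_add, rep2L_add, hx, hx']
  | tmul y b =>
    ext p q
    simp only [rep2L_tmul, Algebra.TensorProduct.tmul_mul_tmul, map_mul, Matrix.mul_apply,
      Finset.sum_smul, smul_mul_smul_comm]

theorem rep2L_scalar (x : U ⊗[k] U) :
    rep2L ρ (x ⊗ₜ[k] (1 : L)) = (rep2 ρ x).map (algebraMap k L) := by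
  ext p q
  simp [rep2L_tmul, Algebra.algebraMap_eq_smul_one]

theorem rep2L_one : rep2L ρ (1 : (U ⊗[k] U) ⊗[k] L) = 1 := by
  rw [Algebra.TensorProduct.one_def, rep2L_scalar, map_one]
  simp

theorem flipMatrix_mul_apply (X : Matrix (ι × ι) (ι × ι) L) (p q : ι × ι) :
    (flipMatrix ι L * X) p q = X p.swap q := by
  have h : ∀ r : ι × ι, p = r.swap ↔ p.swap = r := fun r => by
    constructor <;> rintro rfl <;> rfl
  simp [Matrix.mul_apply, flipMatrix, h]

theorem mul_flipMatrix_apply (X : Matrix (ι × ι) (ι × ι) L) (p q : ι × ι) :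
    (X * flipMatrix ι L) p q = X p q.swap := by
  simp [Matrix.mul_apply, flipMatrix]

theorem flipMatrix_mul_rep2L (X : (U ⊗[k] U) ⊗[k] L) :
    flipMatrix ι L * rep2L ρ ((TensorProduct.comm k U U).toLinearMap.rTensor L X) =
      rep2L ρ X * flipMatrix ι L := by
  induction X using tensor3_induction with
  | zero => simp [rep2L_zero]
  | add x x' hx hx' => simp only [map_add, rep2L_add, mul_add, add_mul, hx, hx']
  | tmul u v a =>
    ext p q
    rw [flipMatrix_mul_apply, mul_flipMatrix_apply]
    simp [rep2L_tmul, rep2_tmul, mul_comm]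

theorem matS_map (R : U ⊗[k] U) : (matS ρ R).map (algebraMap k L) =
    flipMatrix ι L * (rep2 ρ R).map (algebraMap k L) := by
  rw [matS, Matrix.map_mul]
  congr 1
  ext p q
  simp only [flipMatrix, Matrix.map_apply, Matrix.of_apply]
  split_ifs <;> simp

/-- The flip turns the inverse twist with exchanged legs into the inverse twist itself. Thus `S̃` is
conjugate to the constant matrix `S`, and this is the only way in which `dynR` enters the argument.
-/
theorem flip_dynR (R : U ⊗[k] U) (F : ((U ⊗[k] U) ⊗[k] L)ˣ) :
    flipMatrix ι L * rep2L ρ (dynR R F) =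
      rep2L ρ F⁻¹.1 * (matS ρ R).map (algebraMap k L) * rep2L ρ F.1 := by
  rw [dynR, rep2L_mul, rep2L_mul, ← mul_assoc, ← mul_assoc, flipMatrix_mul_rep2L, rep2L_scalar,
    matS_map, mul_assoc (rep2L ρ F⁻¹.1)]

variable {Q : Type*} [Ring Q] [Algebra k Q]

theorem rTensor_boxMul_shuffle3 (T : Matrix ι ι Q) (p q : ι × ι) (Y X : (U ⊗[k] U) ⊗[k] L) :
    (boxMul (genMap ρ T p.1 q.1) (genMap ρ T p.2 q.2)).rTensor (Lᵐᵒᵖ ⊗[k] L)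
      (shuffle3 k Uᵐᵒᵖ Lᵐᵒᵖ U L (toOp Y ⊗ₜ X)) =
        ∑ r, ∑ s, mat12 T r s ⊗ₜ (op (rep2L ρ Y p r) ⊗ₜ[k] rep2L ρ X s q) := by
  induction Y using tensor3_induction with
  | zero => simp [rep2L_zero]
  | add x x' hx hx' => simp only [map_add, rep2L_add, Matrix.add_apply, TensorProduct.add_tmul,
      TensorProduct.tmul_add, op_add, Finset.sum_add_distrib, hx, hx']
  | tmul y y' b =>
  induction X using tensor3_induction with
  | zero => simp [rep2L_zero]
  | add x x' hx hx' => simp only [map_add, rep2L_add, Matrix.add_apply,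
      TensorProduct.tmul_add, Finset.sum_add_distrib, hx, hx']
  | tmul x x' a =>
    have h : toOp ((y ⊗ₜ[k] y') ⊗ₜ[k] b) = (op y ⊗ₜ op y') ⊗ₜ op b := rfl
    rw [h, shuffle3_tmul, shuffle2_tmul, LinearMap.rTensor_tmul, boxMul_tmul, genMap_tmul,
      genMap_tmul]
    simp only [rep2L_tmul, rep2_tmul, Fintype.sum_prod_type, Finset.sum_mul_sum, mat12,
      Matrix.of_apply, TensorProduct.sum_tmul, op_smul, ← TensorProduct.smul_tmul',
      TensorProduct.tmul_smul, smul_smul, smul_mul_smul_comm]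
    refine (Finset.sum_congr rfl fun r _ => Finset.sum_congr rfl fun r' _ =>
      Finset.sum_congr rfl fun s _ =>
      Finset.sum_congr rfl fun s' _ => ?_)
    congr 1
    ring

/-- The matrix `∑ T₁T₂ Y X` with the coefficients of `Y` in `L_op` and those of `X` in `L`. -/
def coeffMat (j : Lᵐᵒᵖ ⊗[k] L →ₐ[k] Q) (TT : Matrix (ι × ι) (ι × ι) Q)
    (Y X : Matrix (ι × ι) (ι × ι) L) : Matrix (ι × ι) (ι × ι) Q :=
  Matrix.of fun p q => ∑ r, ∑ s, TT r s * j (op (Y p r) ⊗ₜ X s q)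

theorem extM_boxMul_shuffle3 (j : Lᵐᵒᵖ ⊗[k] L →ₐ[k] Q) (T : Matrix ι ι Q) (p q : ι × ι)
    (Y X : (U ⊗[k] U) ⊗[k] L) :
    extM j (boxMul (genMap ρ T p.1 q.1) (genMap ρ T p.2 q.2))
      (shuffle3 k Uᵐᵒᵖ Lᵐᵒᵖ U L (toOp Y ⊗ₜ X)) =
        coeffMat j (mat12 T) (rep2L ρ Y) (rep2L ρ X) p q := by
  have h : ∀ (φ : (Uᵐᵒᵖ ⊗[k] U) ⊗[k] (Uᵐᵒᵖ ⊗[k] U) →ₗ[k] Q), extM j φ =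
      extM j LinearMap.id ∘ₗ φ.rTensor (Lᵐᵒᵖ ⊗[k] L) := fun φ =>
    TensorProduct.ext' fun x m => by simp
  rw [h, LinearMap.comp_apply, rTensor_boxMul_shuffle3]
  simp [coeffMat]

omit [DecidableEq ι] in
-- If the dynamical relation holds for `S`, with all its coefficients to the right of `TT`, then `S`
-- may be moved from one side of `TT` to the other inside `Y · TT · X`. It is applied once to `S̃`
-- in the dynamical FRT algebra and once to the constant `S` in the FRT algebra.
theorem coeffMat_mul (j : Lᵐᵒᵖ ⊗[k] L →ₐ[k] Q) {TT : Matrix (ι × ι) (ι × ι) Q}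
    {S : Matrix (ι × ι) (ι × ι) L}
    (h : ∀ p q, ∑ r, TT r q * j (op (S p r) ⊗ₜ 1) = ∑ s, TT p s * j (1 ⊗ₜ S s q))
    (Y X : Matrix (ι × ι) (ι × ι) L) :
    coeffMat j TT (Y * S) X = coeffMat j TT Y (S * X) := by
  ext p q
  simp only [coeffMat, Matrix.of_apply, Matrix.mul_apply, Finset.op_sum, TensorProduct.sum_tmul,
    TensorProduct.tmul_sum, map_sum, Finset.mul_sum, op_mul]
  -- In `L_op` the product `Y S` has the factor of `S` first, next to `TT`, which is where the
  -- relation can be applied.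
  have h₁ : ∀ r s t, TT r s * j ((op (S t r) * op (Y p t)) ⊗ₜ X s q) =
      TT r s * j (op (S t r) ⊗ₜ 1) * j (op (Y p t) ⊗ₜ X s q) := fun r s t => by
    rw [mul_assoc, ← map_mul]; simp
  have h₂ : ∀ t u s, TT t u * j (op (Y p t) ⊗ₜ (S u s * X s q)) =
      TT t u * j (1 ⊗ₜ S u s) * j (op (Y p t) ⊗ₜ X s q) := fun r s t => by
    rw [mul_assoc, ← map_mul]; simp
  simp only [h₁, h₂]
  calc _ = ∑ t, ∑ s, ∑ r, TT r s * j (op (S t r) ⊗ₜ 1) * j (op (Y p t) ⊗ₜ X s q) := by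
          rw [Finset.sum_comm]
          refine (Finset.sum_congr rfl fun s _ => Finset.sum_comm).trans ?_
          exact Finset.sum_comm
    _ = ∑ t, ∑ s, ∑ u, TT t u * j (1 ⊗ₜ S u s) * j (op (Y p t) ⊗ₜ X s q) := by
          refine Finset.sum_congr rfl fun t _ => Finset.sum_congr rfl fun s _ => ?_
          rw [← Finset.sum_mul, h, Finset.sum_mul]
    _ = _ := Finset.sum_congr rfl fun t _ => Finset.sum_comm

omit [DecidableEq ι] in
theorem coeffMat_scalar_left (j : Lᵐᵒᵖ ⊗[k] L →ₐ[k] Q) (TT : Matrix (ι × ι) (ι × ι) Q)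
    (S : Matrix (ι × ι) (ι × ι) k) (Y X : Matrix (ι × ι) (ι × ι) L) :
    coeffMat j TT (S.map (algebraMap k L) * Y) X =
      S.map (algebraMap k Q) * coeffMat j TT Y X := by
  ext p q
  simp only [coeffMat, Matrix.of_apply, Matrix.mul_apply, Finset.op_sum, TensorProduct.sum_tmul,
    map_sum, Finset.mul_sum, Matrix.map_apply, ← Algebra.smul_def, op_smul,
    ← TensorProduct.smul_tmul', map_smul, mul_smul_comm]
  refine (Finset.sum_congr rfl fun s _ => Finset.sum_comm).trans ?_
  exact Finset.sum_comm

omit [DecidableEq ι] in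
theorem coeffMat_scalar_right (j : Lᵐᵒᵖ ⊗[k] L →ₐ[k] Q) (TT : Matrix (ι × ι) (ι × ι) Q)
    (S : Matrix (ι × ι) (ι × ι) k) (Y X : Matrix (ι × ι) (ι × ι) L) :
    coeffMat j TT Y (X * S.map (algebraMap k L)) =
      coeffMat j TT Y X * S.map (algebraMap k Q) := by
  ext p q
  simp only [coeffMat, Matrix.of_apply, Matrix.mul_apply, TensorProduct.tmul_sum,
    map_sum, Finset.mul_sum, Matrix.map_apply, ← Algebra.commutes,
    ← Algebra.smul_def,
    TensorProduct.tmul_smul, map_smul, mul_smul_comm]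
  refine (Finset.sum_congr rfl fun s _ => Finset.sum_comm).trans ?_
  exact Finset.sum_comm

end Matrices

/-! ## The FRT algebra as a module algebra -/

section FRTAction

variable {k : Type*} [Field k] {ι : Type*} [Fintype ι] [DecidableEq ι]
variable {U : Type*} [Ring U] [Bialgebra k U]

omit [DecidableEq ι] in
theorem FRT.induction {S : Matrix (ι × ι) (ι × ι) k} {P : FRT S → Prop}
    (algebraMap : ∀ c : k, P (algebraMap k (FRT S) c)) (T : ∀ i j, P (FRT.T S i j))
    (add : ∀ a b, P a → P b → P (a + b)) (mul : ∀ a b, P a → P b → P (a * b)) (a : FRT S) :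
    P a := by
  obtain ⟨x, rfl⟩ := RingQuot.mkAlgHom_surjective k (FRTRel S) a
  induction x using FreeAlgebra.induction with
  | grade0 c => simpa only [AlgHom.commutes] using algebraMap c
  | grade1 x => exact T x.1 x.2
  | add a b ha hb => rw [map_add]; exact add _ _ ha hb
  | mul a b ha hb => rw [map_mul]; exact mul _ _ ha hb

variable (ρ : U →ₐ[k] Matrix ι ι k) {R : (U ⊗[k] U)ˣ} (hR : IsUniversalRMatrix k R)

theorem FRT.act_T (w : Uᵐᵒᵖ ⊗[k] U) (i j : ι) : FRT.act ρ hR w (FRT.T (matS ρ R.1) i j) =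
    genMap ρ (FRT.T (matS ρ R.1)) i j w := by
  have h : FRT.actHom ρ hR (FRT.T (matS ρ R.1) i j) =
      WithConv.toConv (genMap ρ (FRT.T (matS ρ R.1)) i j) := by
    simp only [FRT.actHom, FRT.T, Matrix.map_apply, freeT, Matrix.of_apply]
    erw [RingQuot.liftAlgHom_mkAlgHom_apply]
    rw [FreeAlgebra.lift_ι_apply]
    rfl
  exact congrArg (fun f : WithConv (Uᵐᵒᵖ ⊗[k] U →ₗ[k] FRT (matS ρ R.1)) => f.ofConv w) h

theorem FRT.act_mul (w : Uᵐᵒᵖ ⊗[k] U) (a b : FRT (matS ρ R.1)) :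
    FRT.act ρ hR w (a * b) = LinearMap.mul' k _
      (TensorProduct.map ((FRT.act ρ hR).flip a) ((FRT.act ρ hR).flip b) (comul (R := k) w)) :=
  congrArg (fun f : WithConv (Uᵐᵒᵖ ⊗[k] U →ₗ[k] FRT (matS ρ R.1)) => f.ofConv w)
    (map_mul (FRT.actHom ρ hR) a b)

theorem FRT.act_algebraMap (w : Uᵐᵒᵖ ⊗[k] U) (c : k) :
    FRT.act ρ hR w (algebraMap k _ c) = c • algebraMap k _ (counit (R := k) w) := by
  rw [Algebra.algebraMap_eq_smul_one, map_smul]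
  congr 1
  exact congrArg (fun f : WithConv (Uᵐᵒᵖ ⊗[k] U →ₗ[k] FRT (matS ρ R.1)) => f.ofConv w)
    (map_one (FRT.actHom ρ hR))

/-- The homomorphism into the convolution algebra gives compatibility with products in the FRT
algebra, but not with products in `U_op ⊗ U`. The latter is checked on generators and spreads to
products because the coproduct is multiplicative. -/
theorem FRT.act_act (w w' : Uᵐᵒᵖ ⊗[k] U) (a : FRT (matS ρ R.1)) :
    FRT.act ρ hR (w * w') a = FRT.act ρ hR w (FRT.act ρ hR w' a) := by
  induction a using FRT.induction generalizing w w' with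
  | algebraMap c =>
    simp only [FRT.act_algebraMap, map_smul, Bialgebra.counit_mul, map_mul]
    simp [Algebra.algebraMap_eq_smul_one, smul_smul, mul_comm]
  | add a b ha hb => simp only [map_add, ha, hb]
  | T i j =>
    induction w' using TensorProduct.induction_on with
    | zero => simp
    | add x y hx hy => simp only [mul_add, map_add, LinearMap.add_apply, hx, hy]
    | tmul y x =>
      obtain ⟨y, rfl⟩ := op_surjective y
      simp only [FRT.act_T, genMap_mul_tmul, genMap_tmul, map_sum, map_smul]
  | mul a b ha hb =>
    rw [FRT.act_mul, FRT.act_mul, Bialgebra.comul_mul]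
    generalize comul (R := k) w' = z
    induction z using TensorProduct.induction_on with
    | zero => simp
    | add x y hx hy => simp only [mul_add, map_add, hx, hy]
    | tmul p q =>
      rw [TensorProduct.map_tmul, LinearMap.mul'_apply, FRT.act_mul]
      generalize comul (R := k) w = z
      induction z using TensorProduct.induction_on with
      | zero => simp
      | add x y hx hy => simp only [add_mul, map_add, hx, hy]
      | tmul p q => simp [ha, hb]

theorem FRT.one_act (a : FRT (matS ρ R.1)) : FRT.act ρ hR 1 a = a := by
  induction a using FRT.induction with
  | algebraMap c =>
    rw [FRT.act_algebraMap, Bialgebra.counit_one, map_one, ← Algebra.algebraMap_eq_smul_one]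
  | add a b ha hb => simp only [map_add, ha, hb]
  | T i j => rw [FRT.act_T, genMap_one]
  | mul a b ha hb =>
    rw [FRT.act_mul, Bialgebra.comul_one, Algebra.TensorProduct.one_def]
    simp [ha, hb]

/-- The FRT algebra as a module algebra over `U_op ⊗ U`. -/
def FRT.moduleAlgebra : ModuleAlgebra k (Uᵐᵒᵖ ⊗[k] U) (FRT (matS ρ R.1)) where
  act := AlgHom.ofLinearMap (FRT.act ρ hR) (LinearMap.ext (FRT.one_act ρ hR))
    (fun w w' => LinearMap.ext (FRT.act_act ρ hR w w'))
  act_one w := by simpa using FRT.act_algebraMap ρ hR w 1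
  act_mul w a b := FRT.act_mul ρ hR w a b

end FRTAction

/-! ## Relations in the dynamical FRT algebra -/

section SmashProduct

variable {k : Type*} [Field k] {H L : Type*} [Ring H] [HopfAlgebra k H] [Ring L] [Algebra k L]
variable {ι : Type*} [Fintype ι] [DecidableEq ι]
variable (ρ : H →ₐ[k] Matrix ι ι k) (B : BaseAlgebra k H L)

/-- The homomorphism of `L` to the smash product. -/
def Smash.sHom : L →ₐ[k] Smash ρ B where
  toFun := Smash.s ρ B
  map_one' := by
    have h := RingQuot.mkAlgHom_rel k (SmashRel.s_algebraMap (ρ := ρ) (B := B) 1)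
    rwa [map_one, map_one, map_one] at h
  map_mul' a b := by
    have h := RingQuot.mkAlgHom_rel k (SmashRel.s_mul (ρ := ρ) (B := B) a b)
    rwa [map_mul] at h
  map_zero' := by
    have h := RingQuot.mkAlgHom_rel k (SmashRel.s_algebraMap (ρ := ρ) (B := B) 0)
    rwa [map_zero, map_zero, map_zero] at h
  map_add' a b := by
    have h := RingQuot.mkAlgHom_rel k (SmashRel.s_add (ρ := ρ) (B := B) a b)
    rwa [map_add] at h
  commutes' c := by
    have h := RingQuot.mkAlgHom_rel k (SmashRel.s_algebraMap (ρ := ρ) (B := B) c)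
    rwa [AlgHom.commutes] at h

/-- The homomorphism of `L_op` to the smash product. -/
def Smash.tHom : Lᵐᵒᵖ →ₐ[k] Smash ρ B where
  toFun := Smash.t ρ B
  map_one' := by
    have h := RingQuot.mkAlgHom_rel k (SmashRel.t_algebraMap (ρ := ρ) (B := B) 1)
    rwa [map_one, map_one, map_one] at h
  map_mul' a b := by
    have h := RingQuot.mkAlgHom_rel k (SmashRel.t_mul (ρ := ρ) (B := B) a b)
    rwa [map_mul] at h
  map_zero' := by
    have h := RingQuot.mkAlgHom_rel k (SmashRel.t_algebraMap (ρ := ρ) (B := B) 0)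
    rwa [map_zero, map_zero, map_zero] at h
  map_add' a b := by
    have h := RingQuot.mkAlgHom_rel k (SmashRel.t_add (ρ := ρ) (B := B) a b)
    rwa [map_add] at h
  commutes' c := by
    have h := RingQuot.mkAlgHom_rel k (SmashRel.t_algebraMap (ρ := ρ) (B := B) c)
    rwa [AlgHom.commutes] at h

/-- The homomorphism of `L_op ⊗ L` to the smash product. -/
def Smash.jHom : Lᵐᵒᵖ ⊗[k] L →ₐ[k] Smash ρ B :=
  Algebra.TensorProduct.lift (Smash.tHom ρ B) (Smash.sHom ρ B) fun b a => by
    have h := RingQuot.mkAlgHom_rel k (SmashRel.comm (ρ := ρ) (B := B) a b)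
    rw [map_mul, map_mul] at h
    exact h.symm

theorem Smash.jHom_left (b : Lᵐᵒᵖ) : Smash.jHom ρ B (b ⊗ₜ 1) = Smash.t ρ B b := by
  change Smash.tHom ρ B b * Smash.sHom ρ B 1 = _
  rw [map_one, mul_one]
  rfl

theorem Smash.jHom_right (a : L) : Smash.jHom ρ B (1 ⊗ₜ a) = Smash.s ρ B a := by
  change Smash.tHom ρ B 1 * Smash.sHom ρ B a = _
  rw [map_one, one_mul]
  rfl

theorem Smash.s_mul_T (a : L) (i j : ι) : Smash.s ρ B a * Smash.T ρ B i j =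
    ∑ l, Smash.T ρ B i l * Smash.s ρ B (coactEntry ρ B l j a) := by
  have h := RingQuot.mkAlgHom_rel k (SmashRel.s_T (ρ := ρ) (B := B) a i j)
  simp only [map_mul, map_sum] at h
  exact h

theorem Smash.t_mul_T (b : L) (i j : ι) : Smash.t ρ B (op b) * Smash.T ρ B i j =
    ∑ l, Smash.T ρ B l j * Smash.t ρ B (op (coactEntry ρ B i l b)) := by
  have h := RingQuot.mkAlgHom_rel k (SmashRel.t_T (ρ := ρ) (B := B) b i j)
  simp only [map_mul, map_sum] at h
  exact h

variable {B} in
theorem evalLeft_coact_evalLeft (f g : H →ₗ[k] k) (a : L) :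
    evalLeft L f (B.coact (evalLeft L g (B.coact a))) =
      evalLeft L (LinearMap.mul' k k ∘ₗ TensorProduct.map g f ∘ₗ comul) (B.coact a) := by
  have h₁ : ∀ z, evalLeft L f (B.coact (evalLeft L g z)) =
      evalLeft L (LinearMap.mul' k k ∘ₗ TensorProduct.map g f)
        ((TensorProduct.assoc k H H L).symm (B.coact.toLinearMap.lTensor H z)) := by
    intro z
    induction z using TensorProduct.induction_on with
    | zero => simp
    | add x y hx hy => simp only [map_add, hx, hy]
    | tmul h b =>
      simp only [evalLeft_tmul, map_smul, LinearMap.lTensor_tmul, AlgHom.toLinearMap_apply]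
      generalize B.coact b = y
      induction y using TensorProduct.induction_on with
      | zero => simp
      | add x y hx hy => simp only [map_add, TensorProduct.tmul_add, smul_add, hx, hy]
      | tmul h' b => simp [smul_smul]
  rw [h₁, ← B.coact_coassoc, LinearEquiv.symm_apply_apply]
  generalize B.coact a = z
  induction z using TensorProduct.induction_on with
  | zero => simp
  | add x y hx hy => simp only [map_add, hx, hy]
  | tmul h b => simp

variable {B} in
theorem evalLeft_smul_counit (c : k) (a : L) :
    evalLeft L (c • counit (R := k) (A := H)) (B.coact a) = c • a := by
  have h : ∀ z, evalLeft L (c • counit (R := k) (A := H)) z =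
      c • TensorProduct.lid k L ((counit (R := k) (A := H)).rTensor L z) := by
    intro z
    induction z using TensorProduct.induction_on with
    | zero => simp
    | add x y hx hy => simp only [map_add, smul_add, hx, hy]
    | tmul h b => simp [smul_smul]
  rw [h, B.coact_counit]

theorem antipode_conv {X : Type*} [Ring X] [Algebra k X] (φ : H →ₐ[k] X) :
    WithConv.toConv (φ.toLinearMap ∘ₗ HopfAlgebra.antipode k (A := H)) *
      WithConv.toConv φ.toLinearMap = 1 := by
  apply WithConv.ofConv_injective
  ext h
  have hz : ∀ z : H ⊗[k] H, LinearMap.mul' k X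
      (TensorProduct.map (φ.toLinearMap ∘ₗ HopfAlgebra.antipode k (A := H)) φ.toLinearMap z) =
      φ (LinearMap.mul' k H ((HopfAlgebra.antipode k (A := H)).rTensor H z)) := by
    intro z
    induction z using TensorProduct.induction_on with
    | zero => simp
    | add x y hx hy => simp only [map_add, hx, hy]
    | tmul x y => simp
  exact (hz _).trans (by
    rw [HopfAlgebra.mul_antipode_rTensor_comul_apply, AlgHom.commutes]; rfl)

/-- Let `l` and `r` be the embeddings of the two legs. Then `Δ = l * r` in the convolution algebra,
while `h ↦ γ h₍₂₎ ⊗ γ h₍₁₎` is `(r ∘ γ) * (l ∘ γ)`. The product collapses from the inside out. -/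
theorem antipode_comul_conv :
    WithConv.toConv (TensorProduct.map (HopfAlgebra.antipode k (A := H))
      (HopfAlgebra.antipode k (A := H)) ∘ₗ (TensorProduct.comm k H H).toLinearMap ∘ₗ
        comul (R := k) (A := H)) * WithConv.toConv (comul (R := k) (A := H)) = 1 := by
  have h₁ : WithConv.toConv (TensorProduct.map (HopfAlgebra.antipode k (A := H))
      (HopfAlgebra.antipode k (A := H)) ∘ₗ (TensorProduct.comm k H H).toLinearMap ∘ₗ
        comul (R := k) (A := H)) =
      WithConv.toConv ((Algebra.TensorProduct.includeRight (R := k) (A := H) (B := H)).toLinearMap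
        ∘ₗ HopfAlgebra.antipode k (A := H)) *
      WithConv.toConv ((Algebra.TensorProduct.includeLeft (R := k) (S := k) (A := H)
        (B := H)).toLinearMap ∘ₗ HopfAlgebra.antipode k (A := H)) := by
    apply WithConv.ofConv_injective
    refine LinearMap.ext fun h => ?_
    have hz : ∀ z : H ⊗[k] H, TensorProduct.map (HopfAlgebra.antipode k (A := H))
        (HopfAlgebra.antipode k (A := H)) (TensorProduct.comm k H H z) =
        LinearMap.mul' k (H ⊗[k] H) (TensorProduct.map
          ((Algebra.TensorProduct.includeRight (R := k) (A := H) (B := H)).toLinearMap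
            ∘ₗ HopfAlgebra.antipode k (A := H))
          ((Algebra.TensorProduct.includeLeft (R := k) (S := k) (A := H)
            (B := H)).toLinearMap ∘ₗ HopfAlgebra.antipode k (A := H)) z) := by
      intro z
      induction z using TensorProduct.induction_on with
      | zero => simp
      | add x y hx hy => simp only [map_add, hx, hy]
      | tmul x y => simp
    exact hz _
  have h₂ : WithConv.toConv (comul (R := k) (A := H)) =
      WithConv.toConv (Algebra.TensorProduct.includeLeft (R := k) (S := k) (A := H)
        (B := H)).toLinearMap *
      WithConv.toConv (Algebra.TensorProduct.includeRight (R := k) (A := H) (B := H)).toLinearMap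
      := by
    apply WithConv.ofConv_injective
    refine LinearMap.ext fun h => ?_
    have hz : ∀ z : H ⊗[k] H, z = LinearMap.mul' k (H ⊗[k] H) (TensorProduct.map
          (Algebra.TensorProduct.includeLeft (R := k) (S := k) (A := H) (B := H)).toLinearMap
          (Algebra.TensorProduct.includeRight (R := k) (A := H) (B := H)).toLinearMap z) := by
      intro z
      induction z using TensorProduct.induction_on with
      | zero => simp
      | add x y hx hy => rw [map_add, map_add, ← hx, ← hy]
      | tmul x y => simp
    exact hz _
  rw [h₁, h₂, mul_assoc, ← mul_assoc (WithConv.toConv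
    ((Algebra.TensorProduct.includeLeft (R := k) (S := k) (A := H) (B := H)).toLinearMap ∘ₗ
      HopfAlgebra.antipode k (A := H))), antipode_conv, one_mul, antipode_conv]

theorem antipodeRep_mul_comul (p q : ι × ι) :
    ∑ r, LinearMap.mul' k k ∘ₗ TensorProduct.map (entry (antipodeRep ρ) p r)
      (entry ((rep2 ρ).toLinearMap ∘ₗ comul (R := k) (A := H)) r q) ∘ₗ comul (R := k) (A := H) =
        (if p = q then (1 : k) else 0) • counit (R := k) (A := H) := by
  ext h
  have hz : ∀ z : H ⊗[k] H, ∑ r, LinearMap.mul' k k (TensorProduct.map (entry (antipodeRep ρ) p r)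
      (entry ((rep2 ρ).toLinearMap ∘ₗ comul (R := k) (A := H)) r q) z) =
      rep2 ρ (LinearMap.mul' k (H ⊗[k] H) (TensorProduct.map
        (TensorProduct.map (HopfAlgebra.antipode k (A := H))
      (HopfAlgebra.antipode k (A := H)) ∘ₗ (TensorProduct.comm k H H).toLinearMap ∘ₗ
        comul (R := k) (A := H)) (comul (R := k) (A := H)) z)) p q := by
    intro z
    induction z using TensorProduct.induction_on with
    | zero => simp
    | add x y hx hy => simp only [map_add, Finset.sum_add_distrib, hx, hy, Matrix.add_apply]
    | tmul x y => simp [Matrix.mul_apply, antipodeRep]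
  have hc := congrArg (fun f : WithConv (H →ₗ[k] H ⊗[k] H) => rep2 ρ (f.ofConv h) p q)
    (antipode_comul_conv (k := k) (H := H))
  rw [LinearMap.sum_apply]
  refine (hz _).trans (hc.trans ?_)
  have h1 : (1 : WithConv (H →ₗ[k] H ⊗[k] H)).ofConv h = algebraMap k _ (counit (R := k) h) := rfl
  simp only [h1, AlgHom.commutes, Matrix.algebraMap_matrix_apply, LinearMap.smul_apply]
  split_ifs <;> simp

variable {B} in
-- Carrying the coefficients of `S̃_op` past two generators applies `(ρ ⊗ ρ)Δ` to their coaction.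
-- This undoes the antipode factor in `S̃_op` and gives back the entries of `S`.
theorem evalLeft_coact_matOp (S : Matrix (ι × ι) (ι × ι) L) (p q : ι × ι) :
    ∑ r, evalLeft L (entry ((rep2 ρ).toLinearMap ∘ₗ comul (R := k) (A := H)) r q)
      (B.coact (matOp ρ B S p r)) = S p q := by
  simp only [matOp, Matrix.of_apply, map_sum, evalLeft_coact_evalLeft]
  rw [Finset.sum_comm]
  have h : ∀ (f : ι × ι → H →ₗ[k] k) z, ∑ r, evalLeft L (f r) z = evalLeft L (∑ r, f r) z := by
    intro f z
    induction z using TensorProduct.induction_on with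
    | zero => simp
    | add x y hx hy => simp only [map_add, Finset.sum_add_distrib, hx, hy]
    | tmul x y => simp [Finset.sum_smul, LinearMap.sum_apply]
  simp only [h, antipodeRep_mul_comul, evalLeft_smul_counit]
  simp

variable {B} in
-- The inner coaction comes from crossing `T₁`, the outer one from crossing `T₂`; coassociativity
-- merges them into one coproduct.
theorem coactEntry_coactEntry (p q : ι × ι) (b : L) :
    coactEntry ρ B p.2 q.2 (coactEntry ρ B p.1 q.1 b) =
      evalLeft L (entry ((rep2 ρ).toLinearMap ∘ₗ comul (R := k) (A := H)) p q) (B.coact b) := by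
  rw [coactEntry, coactEntry, evalLeft_coact_evalLeft]
  congr 2
  have h : LinearMap.mul' k k ∘ₗ TensorProduct.map (entry ρ.toLinearMap p.1 q.1)
      (entry ρ.toLinearMap p.2 q.2) = entry (rep2 ρ).toLinearMap p q :=
    TensorProduct.ext' fun x y => by simp [rep2_tmul]
  rw [← LinearMap.comp_assoc, h]
  rfl

/-- The product of `S̃_op` and `T₁ T₂` in the smash product. -/
theorem Smash.matOp_mul (S : Matrix (ι × ι) (ι × ι) L) (p q : ι × ι) :
    ((matOp ρ B S).map (fun a => Smash.t ρ B (op a)) * mat12 (Smash.T ρ B)) p q =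
      ∑ r, mat12 (Smash.T ρ B) r q * Smash.t ρ B (op (S p r)) := by
  have h : ∀ (b : L) (r : ι × ι), Smash.t ρ B (op b) * mat12 (Smash.T ρ B) r q =
      ∑ l, mat12 (Smash.T ρ B) l q * Smash.t ρ B (op (evalLeft L
        (entry ((rep2 ρ).toLinearMap ∘ₗ comul (R := k) (A := H)) r l) (B.coact b))) := by
    intro b r
    simp only [mat12, Matrix.of_apply, ← mul_assoc, Smash.t_mul_T, Finset.sum_mul]
    simp only [mul_assoc, Smash.t_mul_T, Finset.mul_sum, Fintype.sum_prod_type,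
      ← coactEntry_coactEntry]
  simp only [Matrix.mul_apply, Matrix.map_apply, h]
  rw [Finset.sum_comm]
  refine Finset.sum_congr rfl fun l _ => ?_
  rw [← Finset.mul_sum]
  congr 1
  rw [← evalLeft_coact_matOp ρ (B := B) S p l, Finset.op_sum]
  exact (map_sum (Smash.tHom ρ B) _ _).symm

end SmashProduct

/-! ## The FRT algebra and equivariant maps -/

section BiDatum

variable {k : Type*} [Field k] {H U L : Type*} [Ring H] [HopfAlgebra k H] [Ring U] [Bialgebra k U]
variable [Ring L] [Algebra k L] {i : H →ₐc[k] U} {B : BaseAlgebra k H L}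
variable {F : ((U ⊗[k] U) ⊗[k] L)ˣ} (hF : IsDynamicalTwist (i : H →ₐ[k] U) B F)

/-- The twist datum of `F⁻¹ ⊗ F` over `L_op ⊗ L`. -/
def IsDynamicalTwist.biDatum : TwistDatum k (Uᵐᵒᵖ ⊗[k] U) (Lᵐᵒᵖ ⊗[k] L) :=
  hF.datum.op.tensor hF.datum

theorem IsDynamicalTwist.biDatum_δ_tmul (b a : L) : hF.biDatum.δ (op b ⊗ₜ a) =
    shuffle2 k Uᵐᵒᵖ Lᵐᵒᵖ U L
      (toOp2 U L (Algebra.TensorProduct.map (i : H →ₐ[k] U) (AlgHom.id k L) (B.coact b)) ⊗ₜ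
        Algebra.TensorProduct.map (i : H →ₐ[k] U) (AlgHom.id k L) (B.coact a)) := rfl

theorem IsDynamicalTwist.biDatum_G :
    hF.biDatum.G.1 = shuffle3 k Uᵐᵒᵖ Lᵐᵒᵖ U L (toOp F⁻¹.1 ⊗ₜ F.1) := rfl

theorem IsDynamicalTwist.biDatum_G_inv :
    hF.biDatum.G⁻¹.1 = shuffle3 k Uᵐᵒᵖ Lᵐᵒᵖ U L (toOp F.1 ⊗ₜ F⁻¹.1) := rfl

theorem IsDynamicalTwist.biDatum_δ : hF.biDatum.δ.toLinearMap = coactBi (i : H →ₐ[k] U) B := by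
  refine TensorProduct.ext' fun b a => ?_
  obtain ⟨b, rfl⟩ := op_surjective b
  rfl

variable {ι : Type*} [Fintype ι] [DecidableEq ι] (ρ : U →ₐ[k] Matrix ι ι k)
variable {Q : Type*} [Ring Q] [Algebra k Q] (T : Matrix ι ι Q)

theorem genMap_biDatum_δ (p q : ι) (b a : L) :
    (genMap ρ T p q).rTensor (Lᵐᵒᵖ ⊗[k] L) (hF.biDatum.δ (op b ⊗ₜ a)) =
      ∑ r, ∑ l, T r l ⊗ₜ[k] (op (coactEntry (ρ.comp (i : H →ₐ[k] U)) B p r b) ⊗ₜ[k]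
        coactEntry (ρ.comp (i : H →ₐ[k] U)) B l q a) := by
  rw [hF.biDatum_δ_tmul]
  simp only [coactEntry]
  generalize B.coact b = y
  generalize B.coact a = x
  induction y using TensorProduct.induction_on with
  | zero => simp
  | add y y' hy hy' => simp only [map_add, TensorProduct.add_tmul, TensorProduct.tmul_add, op_add,
      Finset.sum_add_distrib, hy, hy']
  | tmul g b =>
  induction x using TensorProduct.induction_on with
  | zero => simp
  | add x x' hx hx' => simp only [map_add, TensorProduct.tmul_add,
      Finset.sum_add_distrib, hx, hx']
  | tmul h a =>
    have h₁ : toOp2 U L (Algebra.TensorProduct.map (i : H →ₐ[k] U) (AlgHom.id k L) (g ⊗ₜ b)) =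
      op (i g) ⊗ₜ op b := rfl
    rw [h₁, Algebra.TensorProduct.map_tmul, shuffle2_tmul, LinearMap.rTensor_tmul]
    erw [genMap_tmul]
    simp only [TensorProduct.sum_tmul, ← TensorProduct.smul_tmul', evalLeft_tmul, entry_apply,
      op_smul, TensorProduct.tmul_smul, smul_smul, mul_comm (ρ _ p _)]
    rfl

variable {ρ T} {j : Lᵐᵒᵖ ⊗[k] L →ₐ[k] Q}

omit [DecidableEq ι] in
theorem extM_eq_rTensor {k : Type*} [Field k] {X M D : Type*} [AddCommGroup X] [Module k X] [Ring M]
    [Algebra k M] [Ring D] [Algebra k D] (j : M →ₐ[k] D) (f : X →ₗ[k] D) (z : X ⊗[k] M) :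
    extM j f z = extM j LinearMap.id (f.rTensor M z) := by
  induction z using TensorProduct.induction_on with
  | zero => simp
  | add x x' hx hx' => simp only [map_add, hx, hx']
  | tmul x m => simp

theorem extM_genMap_mul_tmul (p q : ι) (u : (Uᵐᵒᵖ ⊗[k] U) ⊗[k] (Lᵐᵒᵖ ⊗[k] L)) (y x : U) :
    extM j (genMap ρ T p q) (u * ((op y ⊗ₜ x) ⊗ₜ 1)) =
      ∑ a, ∑ b, (ρ y p a * ρ x b q) • extM j (genMap ρ T a b) u := by
  induction u using TensorProduct.induction_on with
  | zero => simp
  | add x y hx hy => simp only [map_add, add_mul, hx, hy, smul_add, Finset.sum_add_distrib]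
  | tmul w m =>
    rw [Algebra.TensorProduct.tmul_mul_tmul, extM_tmul, genMap_mul_tmul]
    simp [Finset.sum_mul]

theorem genMap_mem_equivariant
    (hT : ∀ b a p q, j (op b ⊗ₜ a) * T p q = ∑ r, ∑ l, T r l *
      j (op (coactEntry (ρ.comp (i : H →ₐ[k] U)) B p r b) ⊗ₜ
        coactEntry (ρ.comp (i : H →ₐ[k] U)) B l q a)) (p q : ι) :
    genMap ρ T p q ∈ hF.biDatum.equivariant j := by
  have h₁ : ∀ m p q, extM j (genMap ρ T p q) (hF.biDatum.δ m) = j m * T p q := by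
    intro m p q
    induction m using TensorProduct.induction_on with
    | zero => simp
    | add x y hx hy => simp only [map_add, add_mul, hx, hy]
    | tmul b a =>
      obtain ⟨b, rfl⟩ := op_surjective b
      rw [extM_eq_rTensor, genMap_biDatum_δ, hT]
      simp
  intro m z
  induction z using tensor3_induction with
  | zero => simp
  | add x y hx hy => simp only [map_add, mul_add, hx, hy]
  | tmul y x n =>
    obtain ⟨y, rfl⟩ := op_surjective y
    have hz : (op y ⊗ₜ[k] x) ⊗ₜ[k] n = (1 * ((op y ⊗ₜ x) ⊗ₜ 1)) * (1 ⊗ₜ n) := by simp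
    -- Right factors only mix the maps `genMap ρ T a b` by scalars, so the claim reduces to `z = 1`,
    -- where it is the permutation relation `hT`.
    rw [hz, ← mul_assoc, extM_mul_base, extM_mul_base, one_mul, extM_genMap_mul_tmul]
    rw [← one_mul ((op y ⊗ₜ[k] x) ⊗ₜ[k] (1 : Lᵐᵒᵖ ⊗[k] L)), extM_genMap_mul_tmul, ← mul_assoc]
    congr 1
    have h₂ : ∀ p q, extM j (genMap ρ T p q) 1 = T p q := fun p q => by
      rw [Algebra.TensorProduct.one_def, extM_tmul, genMap_one, map_one, mul_one]
    simp only [h₁, h₂, Finset.mul_sum, mul_smul_comm]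

end BiDatum

/-! ### The FRT relation in the algebra of equivariant maps -/

section ToEquivariant

variable {k : Type*} [Field k] {H U L : Type*} [Ring H] [HopfAlgebra k H] [Ring U] [Bialgebra k U]
variable [Ring L] [Algebra k L] {i : H →ₐc[k] U} {B : BaseAlgebra k H L}
variable {F : ((U ⊗[k] U) ⊗[k] L)ˣ} (hF : IsDynamicalTwist (i : H →ₐ[k] U) B F)
variable {ι : Type*} [Fintype ι] [DecidableEq ι] {ρ : U →ₐ[k] Matrix ι ι k}
variable {Q : Type*} [Ring Q] [Algebra k Q] {T : Matrix ι ι Q} {j : Lᵐᵒᵖ ⊗[k] L →ₐ[k] Q}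

/-- The inverse of `F⁻¹ ⊗ F` is `F ⊗ F⁻¹`. As the first half lives in opposite algebras, `F` ends up
to the right of `Δ(y)`, while `F⁻¹` is to the left of `Δ(x)`, so both are adjacent to `T₁T₂`. -/
theorem conv_genMap (p q : ι × ι) (y x : U) :
    hF.biDatum.conv j (genMap ρ T p.1 q.1) (genMap ρ T p.2 q.2) (op y ⊗ₜ x) =
      coeffMat j (mat12 T) ((rep2 ρ (comul (R := k) y)).map (algebraMap k L) * rep2L ρ F.1)
        (rep2L ρ F⁻¹.1 * (rep2 ρ (comul (R := k) x)).map (algebraMap k L)) p q := by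
  have h : hF.biDatum.G⁻¹.1 * (comul (R := k) (op y ⊗ₜ[k] x) ⊗ₜ 1) =
      shuffle3 k Uᵐᵒᵖ Lᵐᵒᵖ U L (toOp (comul (R := k) y ⊗ₜ 1 * F.1) ⊗ₜ
        (F⁻¹.1 * (comul (R := k) x ⊗ₜ 1))) := by
    have h₁ : comul (R := k) (op y ⊗ₜ[k] x) ⊗ₜ (1 : Lᵐᵒᵖ ⊗[k] L) = shuffle3 k Uᵐᵒᵖ Lᵐᵒᵖ U L
        (toOp (comul (R := k) y ⊗ₜ (1 : L)) ⊗ₜ (comul (R := k) x ⊗ₜ (1 : L))) := by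
      rw [comul_tmul_shuffle, Algebra.TensorProduct.one_def, ← shuffle3_tmul]
      rfl
    rw [h₁, hF.biDatum_G_inv, toOp_mul, ← map_mul, Algebra.TensorProduct.tmul_mul_tmul]
  rw [TwistDatum.conv_apply, h, extM_boxMul_shuffle3, rep2L_mul, rep2L_mul, rep2L_scalar,
    rep2L_scalar]

variable {R : (U ⊗[k] U)ˣ}

/-- `S` passes through `Δ(y)`, becomes `S̃` on crossing `F`, moves across `T₁T₂` by the dynamical
relation, becomes `S` again on crossing `F⁻¹`, and passes through `Δ(x)`. -/
theorem coeffMat_matS (hR : IsUniversalRMatrix k R)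
    (hrel : ∀ p q : ι × ι,
      ∑ r, mat12 T r q * j (op ((flipMatrix ι L * rep2L ρ (dynR R.1 F)) p r) ⊗ₜ 1) =
        ∑ s, mat12 T p s * j (1 ⊗ₜ (flipMatrix ι L * rep2L ρ (dynR R.1 F)) s q)) (y x : U) :
    (matS ρ R.1).map (algebraMap k Q) * coeffMat j (mat12 T)
      ((rep2 ρ (comul (R := k) y)).map (algebraMap k L) * rep2L ρ F.1)
        (rep2L ρ F⁻¹.1 * (rep2 ρ (comul (R := k) x)).map (algebraMap k L)) =
    coeffMat j (mat12 T)
      ((rep2 ρ (comul (R := k) y)).map (algebraMap k L) * rep2L ρ F.1)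
        (rep2L ρ F⁻¹.1 * (rep2 ρ (comul (R := k) x)).map (algebraMap k L)) *
          (matS ρ R.1).map (algebraMap k Q) := by
  have hc : ∀ z : U, (matS ρ R.1).map (algebraMap k L) *
      (rep2 ρ (comul (R := k) z)).map (algebraMap k L) =
      (rep2 ρ (comul (R := k) z)).map (algebraMap k L) *
        (matS ρ R.1).map (algebraMap k L) := fun z => by
    rw [← Matrix.map_mul, matS_commute ρ hR, Matrix.map_mul]
  have hFF : rep2L ρ F.1 * rep2L ρ F⁻¹.1 = 1 := by rw [← rep2L_mul, Units.mul_inv, rep2L_one]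
  rw [← coeffMat_scalar_left, ← coeffMat_scalar_right, ← mul_assoc, hc, mul_assoc, mul_assoc,
    ← hc]
  have h₁ : (matS ρ R.1).map (algebraMap k L) * rep2L ρ F.1 =
      rep2L ρ F.1 * (flipMatrix ι L * rep2L ρ (dynR R.1 F)) := by
    rw [flip_dynR, ← mul_assoc, ← mul_assoc, hFF, one_mul]
  have h₂ : (flipMatrix ι L * rep2L ρ (dynR R.1 F)) * rep2L ρ F⁻¹.1 =
      rep2L ρ F⁻¹.1 * (matS ρ R.1).map (algebraMap k L) := by
    rw [flip_dynR, mul_assoc, hFF, mul_one]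
  rw [h₁, ← mul_assoc, coeffMat_mul j hrel, ← mul_assoc (flipMatrix ι L * _), h₂]
  simp only [mul_assoc]

variable (hR : IsUniversalRMatrix k R)

/-- The homomorphism from the FRT algebra to the algebra of equivariant maps that sends `T` to
`y ⊗ x ↦ ρ(y) T ρ(x)`. -/
def FRT.toEquivariant
    (hT : ∀ b a p q, j (op b ⊗ₜ a) * T p q = ∑ r, ∑ l, T r l *
      j (op (coactEntry (ρ.comp (i : H →ₐ[k] U)) B p r b) ⊗ₜ
        coactEntry (ρ.comp (i : H →ₐ[k] U)) B l q a))
    (hrel : ∀ p q : ι × ι,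
      ∑ r, mat12 T r q * j (op ((flipMatrix ι L * rep2L ρ (dynR R.1 F)) p r) ⊗ₜ 1) =
        ∑ s, mat12 T p s * j (1 ⊗ₜ (flipMatrix ι L * rep2L ρ (dynR R.1 F)) s q)) :
    FRT (matS ρ R.1) →ₐ[k] hF.biDatum.equivariant j :=
  RingQuot.liftAlgHom k ⟨FreeAlgebra.lift k fun t : ι × ι =>
    (⟨genMap ρ T t.1 t.2, genMap_mem_equivariant hF hT t.1 t.2⟩ : hF.biDatum.equivariant j), by
    rintro a b ⟨p, q⟩
    simp only [Matrix.mul_apply, Matrix.map_apply, mat12, Matrix.of_apply, freeT, map_sum, map_mul,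
      AlgHom.commutes, FreeAlgebra.lift_ι_apply]
    simp only [← Algebra.commutes, ← Algebra.smul_def]
    apply Subtype.ext
    refine TensorProduct.ext' fun y x => ?_
    obtain ⟨y, rfl⟩ := op_surjective y
    have h := congrFun (congrFun (coeffMat_matS hR hrel y x) p) q
    rw [Matrix.mul_apply, Matrix.mul_apply] at h
    simp only [← conv_genMap hF, Matrix.map_apply, ← Algebra.commutes, ← Algebra.smul_def] at h
    simpa [TwistDatum.equivariant.coe_mul] using h⟩

theorem FRT.toEquivariant_T (hT hrel) (p q : ι) :
    (FRT.toEquivariant (j := j) (T := T) hF hR hT hrel (FRT.T (matS ρ R.1) p q) :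
      Uᵐᵒᵖ ⊗[k] U →ₗ[k] Q) = genMap ρ T p q := by
  simp only [FRT.toEquivariant, FRT.T, Matrix.map_apply, freeT, Matrix.of_apply]
  erw [RingQuot.liftAlgHom_mkAlgHom_apply]
  rw [FreeAlgebra.lift_ι_apply]

/-- The action on the FRT algebra corresponds to right translation of the argument. This is clear on
generators; it is inherited by products because the inverse twist in `conv` multiplies the coproduct
from the left and so does not interfere. -/
theorem FRT.toEquivariant_act (hT hrel) (w : Uᵐᵒᵖ ⊗[k] U) (a : FRT (matS ρ R.1))
    (w' : Uᵐᵒᵖ ⊗[k] U) :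
    (FRT.toEquivariant (j := j) (T := T) hF hR hT hrel ((FRT.moduleAlgebra ρ hR).act w a) :
      Uᵐᵒᵖ ⊗[k] U →ₗ[k] Q) w' =
    (FRT.toEquivariant (j := j) (T := T) hF hR hT hrel a : Uᵐᵒᵖ ⊗[k] U →ₗ[k] Q) (w' * w) := by
  have hact : ∀ w a, (FRT.moduleAlgebra ρ hR).act w a = FRT.act ρ hR w a := fun _ _ => rfl
  simp only [hact]
  induction a using FRT.induction generalizing w w' with
  | algebraMap c =>
    rw [FRT.act_algebraMap]
    simp only [map_smul, map_one (FRT.toEquivariant hF hR hT hrel), Algebra.algebraMap_eq_smul_one,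
      Submodule.coe_smul, TwistDatum.equivariant.coe_one, LinearMap.smul_apply,
      LinearMap.comp_apply, Bialgebra.counit_mul, Algebra.linearMap_apply, smul_smul]
    congr 1
    ring
  | add a b ha hb =>
    simp only [map_add, Submodule.coe_add, LinearMap.add_apply, ha, hb]
  | T p q =>
    rw [FRT.act_T, FRT.toEquivariant_T]
    induction w using TensorProduct.induction_on with
    | zero => simp
    | add x y hx hy => simp only [mul_add, map_add, Submodule.coe_add, LinearMap.add_apply, hx, hy]
    | tmul y x =>
      obtain ⟨y, rfl⟩ := op_surjective y
      simp only [genMap_mul_tmul, genMap_tmul, map_sum, map_smul, Submodule.coe_sum,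
        Submodule.coe_smul, LinearMap.sum_apply, LinearMap.smul_apply, FRT.toEquivariant_T]
  | mul a b ha hb =>
    rw [FRT.act_mul, map_mul (FRT.toEquivariant hF hR hT hrel), TwistDatum.equivariant.coe_mul,
      TwistDatum.conv_apply, Bialgebra.comul_mul]
    generalize comul (R := k) w = z
    induction z using TensorProduct.induction_on with
    | zero => simp
    | add x y hx hy => simp only [mul_add, map_add, Submodule.coe_add, LinearMap.add_apply,
        TensorProduct.add_tmul, hx, hy]
    | tmul v v' =>
      rw [TensorProduct.map_tmul, LinearMap.mul'_apply,
        map_mul (FRT.toEquivariant hF hR hT hrel), TwistDatum.equivariant.coe_mul,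
        TwistDatum.conv_apply]
      have hz : ∀ z : ((Uᵐᵒᵖ ⊗[k] U) ⊗[k] (Uᵐᵒᵖ ⊗[k] U)) ⊗[k] (Lᵐᵒᵖ ⊗[k] L),
          extM j (boxMul
            (FRT.toEquivariant hF hR hT hrel (FRT.act ρ hR v a) : Uᵐᵒᵖ ⊗[k] U →ₗ[k] Q)
            (FRT.toEquivariant hF hR hT hrel (FRT.act ρ hR v' b) : Uᵐᵒᵖ ⊗[k] U →ₗ[k] Q)) z =
          extM j (boxMul (FRT.toEquivariant hF hR hT hrel a : Uᵐᵒᵖ ⊗[k] U →ₗ[k] Q)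
            (FRT.toEquivariant hF hR hT hrel b : Uᵐᵒᵖ ⊗[k] U →ₗ[k] Q)) (z * ((v ⊗ₜ v') ⊗ₜ 1)) := by
        intro z
        induction z using tensor3_induction with
        | zero => simp
        | add x y hx hy => simp only [map_add, add_mul, hx, hy]
        | tmul x y m => simp [ha, hb]
      refine (hz _).trans ?_
      rw [mul_assoc, Algebra.TensorProduct.tmul_mul_tmul, one_mul]

end ToEquivariant

/-! ## The twisted FRT algebra as a ring -/

section TwistedRing

variable {k : Type*} [Field k] {W M A : Type*} [Ring W] [Bialgebra k W] [Ring M] [Algebra k M]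
variable [Ring A] [Algebra k A]

/-- The space `A ⊗ M` with the multiplication twisted by a twist datum. -/
def TwistDatum.Twisted (_t : TwistDatum k W M) (_μ : ModuleAlgebra k W A) : Type _ := A ⊗[k] M

namespace TwistDatum.Twisted

variable {t : TwistDatum k W M} {μ : ModuleAlgebra k W A}

instance instAddCommGroup : AddCommGroup (t.Twisted μ) := inferInstanceAs (AddCommGroup (A ⊗[k] M))

instance instModule : Module k (t.Twisted μ) := inferInstanceAs (Module k (A ⊗[k] M))

instance instRing : Ring (t.Twisted μ) where
  __ := instAddCommGroup
  mul x y := t.mulT μ x y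
  one := (1 : A ⊗[k] M)
  mul_assoc := t.mulT_assoc μ
  one_mul := t.one_mulT μ
  mul_one := t.mulT_one μ
  left_distrib x y z := map_add (t.mulT μ x) y z
  right_distrib x y z := LinearMap.map_add₂ (t.mulT μ) x y z
  zero_mul x := LinearMap.map_zero₂ (t.mulT μ) x
  mul_zero x := map_zero (t.mulT μ x)

instance instAlgebra : Algebra k (t.Twisted μ) :=
  Algebra.ofModule (fun c x y => LinearMap.map_smul₂ (t.mulT μ) c x y)
    (fun c x y => map_smul (t.mulT μ x) c y)

/-- The identity map from `A ⊗ M`. -/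
def of (t : TwistDatum k W M) (μ : ModuleAlgebra k W A) : A ⊗[k] M ≃ₗ[k] t.Twisted μ :=
  LinearEquiv.refl k _

theorem of_mul_of (x y : A ⊗[k] M) : of t μ x * of t μ y = of t μ (t.mulT μ x y) := rfl

theorem of_one : of t μ 1 = 1 := rfl

theorem of_mul_base (x : A ⊗[k] M) (n : M) : of t μ x * of t μ (1 ⊗ₜ n) = of t μ (x * (1 ⊗ₜ n)) :=
  (of_mul_of _ _).trans (congrArg _ (t.mulT_base μ x n))

theorem of_base_mul_tmul_one (m : M) (a : A) : of t μ (1 ⊗ₜ m) * of t μ (a ⊗ₜ 1) =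
    of t μ ((μ.act.toLinearMap.flip a).rTensor M (t.δ m)) :=
  (of_mul_of _ _).trans (congrArg _ ((t.base_mulT μ m a 1).trans (by
    rw [← Algebra.TensorProduct.one_def, mul_one])))

theorem of_tmul_one_mul (a b : A) : of t μ (a ⊗ₜ 1) * of t μ (b ⊗ₜ 1) =
    of t μ ((boxMul (μ.act.toLinearMap.flip a) (μ.act.toLinearMap.flip b)).rTensor M t.G.1) :=
  (of_mul_of _ _).trans (congrArg _ ((t.mulT_tmul μ a b 1 1).trans (by
    rw [map_one, map_one, mul_one, ← Algebra.TensorProduct.one_def, mul_one]; rfl)))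

theorem of_algebraMap (c : k) : of t μ (1 ⊗ₜ algebraMap k M c) = algebraMap k _ c := by
  rw [Algebra.algebraMap_eq_smul_one, Algebra.algebraMap_eq_smul_one, TensorProduct.tmul_smul,
    map_smul]
  rfl

end TwistDatum.Twisted

end TwistedRing

/-! ### The homomorphism from the dynamical FRT algebra to the twisted one -/

section Lift

open TwistDatum

variable {k : Type*} [Field k] {H U L : Type*} [Ring H] [HopfAlgebra k H] [Ring U] [Bialgebra k U]
variable [Ring L] [Algebra k L] {i : H →ₐc[k] U} {B : BaseAlgebra k H L}
variable {F : ((U ⊗[k] U) ⊗[k] L)ˣ} (hF : IsDynamicalTwist (i : H →ₐ[k] U) B F)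
variable {ι : Type*} [Fintype ι] [DecidableEq ι] (ρ : U →ₐ[k] Matrix ι ι k)
variable {R : (U ⊗[k] U)ˣ} (hR : IsUniversalRMatrix k R)

/-- The twisted FRT algebra. -/
abbrev FRT.TwistedAlgebra : Type _ := hF.biDatum.Twisted (FRT.moduleAlgebra ρ hR)

/-- The identity map from `FRT ⊗ (L_op ⊗ L)` to the twisted FRT algebra. -/
abbrev FRT.twist : FRT (matS ρ R.1) ⊗[k] (Lᵐᵒᵖ ⊗[k] L) ≃ₗ[k] FRT.TwistedAlgebra hF ρ hR :=
  Twisted.of _ _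

theorem FRT.flip_act_T (p q : ι) :
    (FRT.moduleAlgebra ρ hR).act.toLinearMap.flip (FRT.T (matS ρ R.1) p q) =
      genMap ρ (FRT.T (matS ρ R.1)) p q :=
  LinearMap.ext fun w => FRT.act_T ρ hR w p q

theorem coactEntry_one (ρ : H →ₐ[k] Matrix ι ι k) (p q : ι) :
    coactEntry ρ B p q 1 = if p = q then 1 else 0 := by
  rw [coactEntry, map_one, Algebra.TensorProduct.one_def, evalLeft_tmul, entry_apply]
  simp [Matrix.one_apply]

/-- The images of the generators of the dynamical FRT algebra in the twisted FRT algebra. -/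
def FRT.twistedGen : DGen ι L → FRT.TwistedAlgebra hF ρ hR
  | .gT p q => FRT.twist hF ρ hR (FRT.T (matS ρ R.1) p q ⊗ₜ 1)
  | .gt b => FRT.twist hF ρ hR (1 ⊗ₜ (b ⊗ₜ 1))
  | .gs a => FRT.twist hF ρ hR (1 ⊗ₜ (1 ⊗ₜ a))

theorem FRT.twistedGen_smashRel {x y : DFree k ι L}
    (h : SmashRel (ρ.comp (i : H →ₐ[k] U)) B x y) :
    FreeAlgebra.lift k (FRT.twistedGen hF ρ hR) x =
      FreeAlgebra.lift k (FRT.twistedGen hF ρ hR) y := by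
  induction h with
  | s_add a b =>
    simp only [DFree.s, map_add, FreeAlgebra.lift_ι_apply, FRT.twistedGen, TensorProduct.tmul_add]
  | s_mul a b =>
    simp only [DFree.s, map_mul, FreeAlgebra.lift_ι_apply, FRT.twistedGen, Twisted.of_mul_base,
      Algebra.TensorProduct.tmul_mul_tmul, one_mul]
  | s_algebraMap c =>
    simp only [DFree.s, FreeAlgebra.lift_ι_apply, FRT.twistedGen, AlgHom.commutes]
    rw [← Twisted.of_algebraMap, ← Algebra.TensorProduct.algebraMap_apply']
  | t_add a b =>
    simp only [DFree.t, map_add, FreeAlgebra.lift_ι_apply, FRT.twistedGen, TensorProduct.tmul_add,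
      TensorProduct.add_tmul]
  | t_mul a b =>
    simp only [DFree.t, map_mul, FreeAlgebra.lift_ι_apply, FRT.twistedGen, Twisted.of_mul_base,
      Algebra.TensorProduct.tmul_mul_tmul, one_mul]
  | t_algebraMap c =>
    simp only [DFree.t, FreeAlgebra.lift_ι_apply, FRT.twistedGen, AlgHom.commutes]
    rw [← Twisted.of_algebraMap, ← Algebra.TensorProduct.algebraMap_apply]
  | comm a b =>
    simp only [DFree.s, DFree.t, map_mul, FreeAlgebra.lift_ι_apply, FRT.twistedGen,
      Twisted.of_mul_base, Algebra.TensorProduct.tmul_mul_tmul, one_mul, mul_one]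
  | s_T a p q =>
    simp only [DFree.s, DFree.T, map_mul, map_sum, FreeAlgebra.lift_ι_apply, FRT.twistedGen,
      Twisted.of_base_mul_tmul_one, Twisted.of_mul_base, Algebra.TensorProduct.tmul_mul_tmul,
      one_mul, mul_one, FRT.flip_act_T]
    -- The unit of the other base factor coacts trivially and contributes a Kronecker delta, which
    -- collapses one of the two sums.
    rw [← op_one, genMap_biDatum_δ, Finset.sum_comm]
    simp [coactEntry_one, apply_ite MulOpposite.op, TensorProduct.tmul_ite,
      TensorProduct.ite_tmul]
  | t_T b p q =>
    simp only [DFree.t, DFree.T, map_mul, map_sum, FreeAlgebra.lift_ι_apply, FRT.twistedGen,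
      Twisted.of_base_mul_tmul_one, Twisted.of_mul_base, Algebra.TensorProduct.tmul_mul_tmul,
      one_mul, mul_one, FRT.flip_act_T]
    rw [genMap_biDatum_δ]
    simp [coactEntry_one, TensorProduct.tmul_ite]

/-- The homomorphism of the smash product to the twisted FRT algebra. -/
def FRT.smashToTwisted : Smash (ρ.comp (i : H →ₐ[k] U)) B →ₐ[k] FRT.TwistedAlgebra hF ρ hR :=
  RingQuot.liftAlgHom k ⟨FreeAlgebra.lift k (FRT.twistedGen hF ρ hR),
    fun _ _ h => FRT.twistedGen_smashRel hF ρ hR h⟩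

theorem FRT.smashToTwisted_T (p q : ι) :
    FRT.smashToTwisted hF ρ hR (Smash.T (ρ.comp (i : H →ₐ[k] U)) B p q) =
      FRT.twist hF ρ hR (FRT.T (matS ρ R.1) p q ⊗ₜ 1) := by
  simp only [FRT.smashToTwisted, Smash.T, Matrix.of_apply]
  erw [RingQuot.liftAlgHom_mkAlgHom_apply]
  exact FreeAlgebra.lift_ι_apply _ _

theorem FRT.smashToTwisted_t (b : Lᵐᵒᵖ) :
    FRT.smashToTwisted hF ρ hR (Smash.t (ρ.comp (i : H →ₐ[k] U)) B b) =
      FRT.twist hF ρ hR (1 ⊗ₜ (b ⊗ₜ 1)) := by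
  simp only [FRT.smashToTwisted, Smash.t]
  erw [RingQuot.liftAlgHom_mkAlgHom_apply]
  exact FreeAlgebra.lift_ι_apply _ _

theorem FRT.smashToTwisted_s (a : L) :
    FRT.smashToTwisted hF ρ hR (Smash.s (ρ.comp (i : H →ₐ[k] U)) B a) =
      FRT.twist hF ρ hR (1 ⊗ₜ (1 ⊗ₜ a)) := by
  simp only [FRT.smashToTwisted, Smash.s]
  erw [RingQuot.liftAlgHom_mkAlgHom_apply]
  exact FreeAlgebra.lift_ι_apply _ _

/-- This is `F⁻¹ T₁T₂ F`: the only place where the explicit form of the twist enters the forward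
map. -/
theorem FRT.smashToTwisted_mat12 (p q : ι × ι) :
    FRT.smashToTwisted hF ρ hR (mat12 (Smash.T (ρ.comp (i : H →ₐ[k] U)) B) p q) =
      FRT.twist hF ρ hR (coeffMat Algebra.TensorProduct.includeRight
        ((mat12 (FRT.T (matS ρ R.1))).map (· ⊗ₜ[k] 1)) (rep2L ρ F⁻¹.1) (rep2L ρ F.1) p q) := by
  rw [mat12, Matrix.of_apply, map_mul, FRT.smashToTwisted_T, FRT.smashToTwisted_T,
    Twisted.of_tmul_one_mul, FRT.flip_act_T, FRT.flip_act_T, hF.biDatum_G, rTensor_boxMul_shuffle3]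
  simp [coeffMat]

theorem coeffMat_includeRight_base {k A L ι : Type*} [Field k] [Ring A] [Algebra k A] [Ring L]
    [Algebra k L] [Fintype ι] (TT : Matrix (ι × ι) (ι × ι) (A ⊗[k] (Lᵐᵒᵖ ⊗[k] L)))
    (S Y X : Matrix (ι × ι) (ι × ι) L) (p q : ι × ι) :
    ∑ r, coeffMat Algebra.TensorProduct.includeRight TT Y X r q * (1 ⊗ₜ (op (S p r) ⊗ₜ 1)) =
      coeffMat Algebra.TensorProduct.includeRight TT (S * Y) X p q := by
  simp only [coeffMat, Matrix.of_apply, Matrix.mul_apply, Finset.op_sum, TensorProduct.sum_tmul,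
    Finset.mul_sum, Finset.sum_mul, mul_assoc, op_mul, map_sum,
    Algebra.TensorProduct.includeRight_apply, Algebra.TensorProduct.tmul_mul_tmul, mul_one]
  refine Finset.sum_comm.trans (Finset.sum_congr rfl fun u _ => Finset.sum_comm)

theorem coeffMat_includeRight_base' {k A L ι : Type*} [Field k] [Ring A] [Algebra k A] [Ring L]
    [Algebra k L] [Fintype ι] (TT : Matrix (ι × ι) (ι × ι) (A ⊗[k] (Lᵐᵒᵖ ⊗[k] L)))
    (S Y X : Matrix (ι × ι) (ι × ι) L) (p q : ι × ι) :
    ∑ s, coeffMat Algebra.TensorProduct.includeRight TT Y X p s * (1 ⊗ₜ (1 ⊗ₜ S s q)) =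
      coeffMat Algebra.TensorProduct.includeRight TT Y (X * S) p q := by
  simp only [coeffMat, Matrix.of_apply, Matrix.mul_apply,
    TensorProduct.tmul_sum, Finset.mul_sum, Finset.sum_mul, mul_assoc, map_sum,
    Algebra.TensorProduct.includeRight_apply, Algebra.TensorProduct.tmul_mul_tmul, mul_one]
  refine Finset.sum_comm.trans (Finset.sum_congr rfl fun u _ => Finset.sum_comm)

/-- With the coefficients moved to the right, the relation compares `S̃ F⁻¹ · T₁T₂ · F` with `F⁻¹ ·
T₁T₂ · F S̃`. Conjugation turns `S̃ F⁻¹` into `F⁻¹ S` and `F S̃` into `S F`, leaving the FRT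
relation for the constant matrix `S`. -/
theorem FRT.smashToTwisted_rel {x y : Smash (ρ.comp (i : H →ₐ[k] U)) B}
    (h : DFRTRel (ρ.comp (i : H →ₐ[k] U)) B (flipMatrix ι L * rep2L ρ (dynR R.1 F)) x y) :
    FRT.smashToTwisted hF ρ hR x = FRT.smashToTwisted hF ρ hR y := by
  obtain ⟨p, q⟩ := h
  rw [Smash.matOp_mul, Matrix.mul_apply]
  simp only [map_sum, map_mul, FRT.smashToTwisted_mat12, FRT.smashToTwisted_t,
    FRT.smashToTwisted_s, Matrix.map_apply, Twisted.of_mul_base]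
  rw [← map_sum, ← map_sum, coeffMat_includeRight_base, coeffMat_includeRight_base']
  have hFF : rep2L ρ F.1 * rep2L ρ F⁻¹.1 = 1 := by rw [← rep2L_mul, Units.mul_inv, rep2L_one]
  have h₁ : rep2L ρ F.1 * (flipMatrix ι L * rep2L ρ (dynR R.1 F)) =
      (matS ρ R.1).map (algebraMap k L) * rep2L ρ F.1 := by
    rw [flip_dynR, ← mul_assoc, ← mul_assoc, hFF, one_mul]
  have h₂ : (flipMatrix ι L * rep2L ρ (dynR R.1 F)) * rep2L ρ F⁻¹.1 =
      rep2L ρ F⁻¹.1 * (matS ρ R.1).map (algebraMap k L) := by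
    rw [flip_dynR, mul_assoc, hFF, mul_one]
  rw [h₁, h₂]
  refine congrArg _ (congrFun (congrFun (coeffMat_mul _ (fun p q => ?_) _ _) p) q)
  have h := congrFun (congrFun (FRT.rel (matS ρ R.1)) p) q
  simp only [Matrix.mul_apply, Matrix.map_apply, ← Algebra.commutes, ← Algebra.smul_def] at h
  have h' := congrArg (fun a => a ⊗ₜ[k] (1 : Lᵐᵒᵖ ⊗[k] L)) h
  simpa [Algebra.algebraMap_eq_smul_one, TensorProduct.sum_tmul, ← TensorProduct.smul_tmul',
    TensorProduct.tmul_smul, ← Algebra.TensorProduct.one_def] using h'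

/-- The homomorphism of the dynamical FRT algebra to the twisted FRT algebra. -/
def DFRT.toTwisted :
    DFRT (ρ.comp (i : H →ₐ[k] U)) B (flipMatrix ι L * rep2L ρ (dynR R.1 F)) →ₐ[k]
      FRT.TwistedAlgebra hF ρ hR :=
  RingQuot.liftAlgHom k ⟨FRT.smashToTwisted hF ρ hR, fun _ _ h => FRT.smashToTwisted_rel hF ρ hR h⟩

theorem DFRT.toTwisted_mk (x : Smash (ρ.comp (i : H →ₐ[k] U)) B) :
    DFRT.toTwisted hF ρ hR (RingQuot.mkAlgHom k _ x) = FRT.smashToTwisted hF ρ hR x := by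
  rw [DFRT.toTwisted]
  erw [RingQuot.liftAlgHom_mkAlgHom_apply]

end Lift

/-! ## The isomorphism -/

section DynamicalRelations

variable {k : Type*} [Field k] {H L : Type*} [Ring H] [HopfAlgebra k H] [Ring L] [Algebra k L]
variable {ι : Type*} [Fintype ι] [DecidableEq ι]
variable (ρ : H →ₐ[k] Matrix ι ι k) (B : BaseAlgebra k H L) (S : Matrix (ι × ι) (ι × ι) L)

/-- The homomorphism of `L_op ⊗ L` to the dynamical FRT algebra. -/
def DFRT.jHom : Lᵐᵒᵖ ⊗[k] L →ₐ[k] DFRT ρ B S :=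
  (RingQuot.mkAlgHom k (DFRTRel ρ B S)).comp (Smash.jHom ρ B)

theorem DFRT.jHom_left (b : Lᵐᵒᵖ) : DFRT.jHom ρ B S (b ⊗ₜ 1) = DFRT.t ρ B S b :=
  congrArg (RingQuot.mkAlgHom k (DFRTRel ρ B S)) (Smash.jHom_left ρ B b)

theorem DFRT.jHom_right (a : L) : DFRT.jHom ρ B S (1 ⊗ₜ a) = DFRT.s ρ B S a :=
  congrArg (RingQuot.mkAlgHom k (DFRTRel ρ B S)) (Smash.jHom_right ρ B a)

/-- The matrix of generators of the dynamical FRT algebra. -/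
def DFRT.matT : Matrix ι ι (DFRT ρ B S) := Matrix.of (DFRT.T ρ B S)

theorem Smash.jHom_tmul (b : Lᵐᵒᵖ) (a : L) :
    Smash.jHom ρ B (b ⊗ₜ a) = Smash.t ρ B b * Smash.s ρ B a := rfl

theorem DFRT.jHom_mul_matT (b a : L) (p q : ι) :
    DFRT.jHom ρ B S (op b ⊗ₜ a) * DFRT.matT ρ B S p q = ∑ r, ∑ l, DFRT.matT ρ B S r l *
      DFRT.jHom ρ B S (op (coactEntry ρ B p r b) ⊗ₜ coactEntry ρ B l q a) := by
  have h : Smash.jHom ρ B (op b ⊗ₜ a) * Smash.T ρ B p q = ∑ r, ∑ l, Smash.T ρ B r l *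
      Smash.jHom ρ B (op (coactEntry ρ B p r b) ⊗ₜ coactEntry ρ B l q a) := by
    simp only [Smash.jHom_tmul]
    rw [mul_assoc, Smash.s_mul_T, Finset.mul_sum]
    simp only [← mul_assoc, Smash.t_mul_T, Finset.sum_mul]
    exact Finset.sum_comm
  have h' := congrArg (RingQuot.mkAlgHom k (DFRTRel ρ B S)) h
  simp only [map_mul, map_sum] at h'
  exact h'

theorem DFRT.mat12_matT (p q : ι × ι) : mat12 (DFRT.matT ρ B S) p q =
    RingQuot.mkAlgHom k (DFRTRel ρ B S) (mat12 (Smash.T ρ B) p q) :=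
  (map_mul (RingQuot.mkAlgHom k (DFRTRel ρ B S)) _ _).symm

/-- The defining relation with all coefficients on the right and no antipode, as needed for
`FRT.toEquivariant` and `coeffMat_mul`. -/
theorem DFRT.rel (p q : ι × ι) :
    ∑ r, mat12 (DFRT.matT ρ B S) r q * DFRT.jHom ρ B S (op (S p r) ⊗ₜ 1) =
      ∑ s, mat12 (DFRT.matT ρ B S) p s * DFRT.jHom ρ B S (1 ⊗ₜ S s q) := by
  have h := RingQuot.mkAlgHom_rel k (DFRTRel.frt (ρ := ρ) (B := B) (S := S) p q)
  rw [Smash.matOp_mul, Matrix.mul_apply] at h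
  simp only [map_sum, map_mul, Matrix.map_apply] at h
  simp only [DFRT.mat12_matT, DFRT.jHom_left, DFRT.jHom_right]
  exact h

/-- Two homomorphisms from the dynamical FRT algebra are equal if they agree on the generators. -/
theorem DFRT.algHom_ext {E : Type*} [Ring E] [Algebra k E] {f g : DFRT ρ B S →ₐ[k] E}
    (hT : ∀ p q, f (DFRT.T ρ B S p q) = g (DFRT.T ρ B S p q))
    (ht : ∀ b, f (DFRT.t ρ B S b) = g (DFRT.t ρ B S b))
    (hs : ∀ a, f (DFRT.s ρ B S a) = g (DFRT.s ρ B S a)) : f = g := by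
  apply RingQuot.ringQuot_ext'
  apply RingQuot.ringQuot_ext'
  apply FreeAlgebra.hom_ext
  funext x
  cases x with
  | gT p q => exact hT p q
  | gt b => exact ht b
  | gs a => exact hs a

end DynamicalRelations

/-! ### The inverse homomorphism and the two composites -/

section Isomorphism

open TwistDatum

variable {k : Type*} [Field k] {H U L : Type*} [Ring H] [HopfAlgebra k H] [Ring U] [Bialgebra k U]
variable [Ring L] [Algebra k L] {i : H →ₐc[k] U} {B : BaseAlgebra k H L}
variable {F : ((U ⊗[k] U) ⊗[k] L)ˣ} (hF : IsDynamicalTwist (i : H →ₐ[k] U) B F)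
variable {ι : Type*} [Fintype ι] [DecidableEq ι] (ρ : U →ₐ[k] Matrix ι ι k)
variable {R : (U ⊗[k] U)ˣ} (hR : IsUniversalRMatrix k R)

theorem DFRT.toTwisted_T (p q : ι) :
    DFRT.toTwisted hF ρ hR (DFRT.T (ρ.comp (i : H →ₐ[k] U)) B _ p q) =
      FRT.twist hF ρ hR (FRT.T (matS ρ R.1) p q ⊗ₜ 1) :=
  (DFRT.toTwisted_mk hF ρ hR _).trans (FRT.smashToTwisted_T hF ρ hR p q)

theorem DFRT.toTwisted_t (b : Lᵐᵒᵖ) :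
    DFRT.toTwisted hF ρ hR (DFRT.t (ρ.comp (i : H →ₐ[k] U)) B _ b) =
      FRT.twist hF ρ hR (1 ⊗ₜ (b ⊗ₜ 1)) :=
  (DFRT.toTwisted_mk hF ρ hR _).trans (FRT.smashToTwisted_t hF ρ hR b)

theorem DFRT.toTwisted_s (a : L) :
    DFRT.toTwisted hF ρ hR (DFRT.s (ρ.comp (i : H →ₐ[k] U)) B _ a) =
      FRT.twist hF ρ hR (1 ⊗ₜ (1 ⊗ₜ a)) :=
  (DFRT.toTwisted_mk hF ρ hR _).trans (FRT.smashToTwisted_s hF ρ hR a)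

theorem DFRT.toTwisted_jHom (m : Lᵐᵒᵖ ⊗[k] L) :
    DFRT.toTwisted hF ρ hR (DFRT.jHom (ρ.comp (i : H →ₐ[k] U)) B _ m) =
      FRT.twist hF ρ hR (1 ⊗ₜ m) := by
  induction m using TensorProduct.induction_on with
  | zero => simp
  | add x y hx hy => simp only [map_add, TensorProduct.tmul_add, hx, hy]
  | tmul b a =>
    have h : b ⊗ₜ[k] a = (b ⊗ₜ 1) * (1 ⊗ₜ a) := by simp
    rw [h, map_mul, map_mul, DFRT.jHom_left, DFRT.jHom_right, DFRT.toTwisted_t, DFRT.toTwisted_s,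
      Twisted.of_mul_base, Algebra.TensorProduct.tmul_mul_tmul, one_mul]

/-- The equivariant maps with values in the dynamical FRT algebra. -/
def FRT.toDynamical : FRT (matS ρ R.1) →ₐ[k] hF.biDatum.equivariant
    (DFRT.jHom (ρ.comp (i : H →ₐ[k] U)) B (flipMatrix ι L * rep2L ρ (dynR R.1 F))) :=
  FRT.toEquivariant hF hR (DFRT.jHom_mul_matT _ B _) (DFRT.rel _ B _)

theorem FRT.toDynamical_T (p q : ι) :
    (FRT.toDynamical hF ρ hR (FRT.T (matS ρ R.1) p q) : Uᵐᵒᵖ ⊗[k] U →ₗ[k]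
      DFRT (ρ.comp (i : H →ₐ[k] U)) B (flipMatrix ι L * rep2L ρ (dynR R.1 F))) =
      genMap ρ (DFRT.matT (ρ.comp (i : H →ₐ[k] U)) B
        (flipMatrix ι L * rep2L ρ (dynR R.1 F))) p q :=
  FRT.toEquivariant_T hF hR _ _ p q

/-- The inverse of the isomorphism. -/
def FRT.fromTwisted : FRT.TwistedAlgebra hF ρ hR →ₐ[k]
    DFRT (ρ.comp (i : H →ₐ[k] U)) B (flipMatrix ι L * rep2L ρ (dynR R.1 F)) :=
  AlgHom.ofLinearMap (untwist (FRT.toDynamical hF ρ hR) ∘ₗ (FRT.twist hF ρ hR).symm.toLinearMap)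
    (by
      refine (untwist_tmul (FRT.toDynamical hF ρ hR) 1 1).trans ?_
      rw [map_one (DFRT.jHom _ B _), map_one (FRT.toDynamical hF ρ hR), equivariant.coe_one,
        mul_one, LinearMap.comp_apply,
        Bialgebra.counit_one, Algebra.linearMap_apply, map_one])
    (untwist_mulT (μ := FRT.moduleAlgebra ρ hR) (FRT.toEquivariant_act hF hR _ _))

theorem FRT.fromTwisted_tmul (a : FRT (matS ρ R.1)) (m : Lᵐᵒᵖ ⊗[k] L) :
    FRT.fromTwisted hF ρ hR (FRT.twist hF ρ hR (a ⊗ₜ m)) =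
      (FRT.toDynamical hF ρ hR a : Uᵐᵒᵖ ⊗[k] U →ₗ[k] _) 1 * DFRT.jHom _ B _ m :=
  untwist_tmul _ a m

theorem FRT.fromTwisted_base (m : Lᵐᵒᵖ ⊗[k] L) :
    FRT.fromTwisted hF ρ hR (FRT.twist hF ρ hR (1 ⊗ₜ m)) = DFRT.jHom _ B _ m := by
  rw [FRT.fromTwisted_tmul, map_one (FRT.toDynamical hF ρ hR), equivariant.coe_one,
    LinearMap.comp_apply, Bialgebra.counit_one, Algebra.linearMap_apply, map_one, one_mul]

theorem FRT.fromTwisted_comp_toTwisted :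
    (FRT.fromTwisted hF ρ hR).comp (DFRT.toTwisted hF ρ hR) = AlgHom.id k _ := by
  refine DFRT.algHom_ext _ B _ (fun p q => ?_) (fun b => ?_) (fun a => ?_)
  · rw [AlgHom.comp_apply, DFRT.toTwisted_T, FRT.fromTwisted_tmul,
      map_one (DFRT.jHom _ B _), mul_one,
      FRT.toDynamical_T, genMap_one]
    rfl
  · rw [AlgHom.comp_apply, DFRT.toTwisted_t, FRT.fromTwisted_base, DFRT.jHom_left]
    rfl
  · rw [AlgHom.comp_apply, DFRT.toTwisted_s, FRT.fromTwisted_base, DFRT.jHom_right]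
    rfl

/-- The case needed is `w = 1`, but the convolution product evaluates its factors at other elements
of `U_op ⊗ U`, so the induction must run over all `w`. -/
theorem DFRT.toTwisted_toDynamical (a : FRT (matS ρ R.1)) (w : Uᵐᵒᵖ ⊗[k] U) :
    DFRT.toTwisted hF ρ hR ((FRT.toDynamical hF ρ hR a : Uᵐᵒᵖ ⊗[k] U →ₗ[k] _) w) =
      FRT.twist hF ρ hR ((FRT.moduleAlgebra ρ hR).act w a ⊗ₜ 1) := by
  induction a using FRT.induction generalizing w with
  | algebraMap c =>
    rw [Algebra.algebraMap_eq_smul_one, map_smul, map_smul, map_one (FRT.toDynamical hF ρ hR),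
      Submodule.coe_smul, equivariant.coe_one, (FRT.moduleAlgebra ρ hR).act_one]
    simp only [LinearMap.smul_apply, LinearMap.comp_apply, map_smul, ← TensorProduct.smul_tmul',
      Algebra.linearMap_apply, AlgHom.commutes]
    simp only [Algebra.algebraMap_eq_smul_one, ← TensorProduct.smul_tmul', map_smul,
      ← Algebra.TensorProduct.one_def, Twisted.of_one]
  | add a b ha hb =>
    simp only [map_add, Submodule.coe_add, LinearMap.add_apply, TensorProduct.add_tmul, ha, hb]
  | T p q =>
    have h := congrFun (congrArg DFunLike.coe (FRT.flip_act_T ρ hR p q)) w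
    rw [LinearMap.flip_apply, AlgHom.toLinearMap_apply] at h
    rw [h, FRT.toDynamical_T]
    clear h
    induction w using TensorProduct.induction_on with
    | zero => simp
    | add x y hx hy => simp only [map_add, TensorProduct.add_tmul, hx, hy]
    | tmul y x =>
      obtain ⟨y, rfl⟩ := op_surjective y
      simp only [genMap_tmul, map_sum, map_smul, TensorProduct.sum_tmul,
        ← TensorProduct.smul_tmul', ← DFRT.toTwisted_T]
      rfl
  | mul a b ha hb =>
    rw [map_mul (FRT.toDynamical hF ρ hR), equivariant.coe_mul]
    exact map_conv (μ := FRT.moduleAlgebra ρ hR) (Φ := (DFRT.toTwisted hF ρ hR).toLinearMap)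
      (map_mul (DFRT.toTwisted hF ρ hR)) (DFRT.toTwisted_jHom hF ρ hR) ha hb w

theorem DFRT.toTwisted_fromTwisted (x : FRT.TwistedAlgebra hF ρ hR) :
    DFRT.toTwisted hF ρ hR (FRT.fromTwisted hF ρ hR x) = x := by
  obtain ⟨x, rfl⟩ := (FRT.twist hF ρ hR).surjective x
  induction x using TensorProduct.induction_on with
  | zero => simp
  | add x y hx hy => simp only [map_add, hx, hy]
  | tmul a m =>
    rw [FRT.fromTwisted_tmul, map_mul, DFRT.toTwisted_toDynamical, DFRT.toTwisted_jHom, map_one,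
      Twisted.of_mul_base, Algebra.TensorProduct.tmul_mul_tmul, mul_one, one_mul]
    rfl

/-- The isomorphism of the dynamical FRT algebra with the twisted FRT algebra. -/
def DFRT.twistedEquiv :
    DFRT (ρ.comp (i : H →ₐ[k] U)) B (flipMatrix ι L * rep2L ρ (dynR R.1 F)) ≃ₐ[k]
      FRT.TwistedAlgebra hF ρ hR :=
  AlgEquiv.ofAlgHom (DFRT.toTwisted hF ρ hR) (FRT.fromTwisted hF ρ hR)
    (AlgHom.ext (DFRT.toTwisted_fromTwisted hF ρ hR)) (FRT.fromTwisted_comp_toTwisted hF ρ hR)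

theorem FRT.twistedMul_eq (x y : FRT (matS ρ R.1) ⊗[k] (Lᵐᵒᵖ ⊗[k] L)) :
    FRT.twistedMul ρ hR (i : H →ₐ[k] U) B F x y =
      hF.biDatum.mulT (FRT.moduleAlgebra ρ hR) x y := by
  rw [TwistDatum.mulT, hF.biDatum_δ]
  rfl

end Isomorphism

end DynFRT

end

theorem mainTheorem7 {k : Type*} [Field k] [CharZero k]
    {H U L : Type*} [Ring H] [HopfAlgebra k H] [Ring U] [HopfAlgebra k U] [Ring L] [Algebra k L]
    (hγ : Function.Bijective (HopfAlgebra.antipode k (A := H)))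
    (i : H →ₐc[k] U) (hi : Function.Injective i)
    (B : DynFRT.BaseAlgebra k H L)
    (R : (U ⊗[k] U)ˣ) (hR : DynFRT.IsUniversalRMatrix k R)
    (F : ((U ⊗[k] U) ⊗[k] L)ˣ) (hF : DynFRT.IsDynamicalTwist (i : H →ₐ[k] U) B F)
    {ι : Type*} [Fintype ι] [DecidableEq ι] (ρ : U →ₐ[k] Matrix ι ι k)
    (ρH : H →ₐ[k] Matrix ι ι k) (hρH : ρH = ρ.comp (i : H →ₐ[k] U))
    (S' : Matrix (ι × ι) (ι × ι) L)
    (hS' : S' = DynFRT.flipMatrix ι L * DynFRT.rep2L ρ (DynFRT.dynR R.1 F)) :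
    ∃ Φ : DynFRT.DFRT ρH B S' ≃ₗ[k]
        DynFRT.FRT (DynFRT.matS ρ R.1) ⊗[k] (Lᵐᵒᵖ ⊗[k] L),
      (∀ x y, Φ (x * y) = DynFRT.FRT.twistedMul ρ hR (i : H →ₐ[k] U) B F (Φ x) (Φ y)) ∧
      Φ 1 = 1 ∧
      (∀ a b, Φ (DynFRT.DFRT.T ρH B S' a b) = DynFRT.FRT.T (DynFRT.matS ρ R.1) a b ⊗ₜ[k] 1) ∧
      (∀ b : Lᵐᵒᵖ, Φ (DynFRT.DFRT.t ρH B S' b) = 1 ⊗ₜ[k] (b ⊗ₜ[k] 1)) ∧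
      (∀ a : L, Φ (DynFRT.DFRT.s ρH B S' a) = 1 ⊗ₜ[k] (1 ⊗ₜ[k] a)) := by
  subst hρH hS'
  -- `FRT.twist` is the identity on the underlying space, so composing with its inverse only forgets
  -- the twisted ring structure, and the properties of `twistedEquiv` carry over by unfolding.
  refine ⟨(DynFRT.DFRT.twistedEquiv hF ρ hR).toLinearEquiv.trans (DynFRT.FRT.twist hF ρ hR).symm,
    fun x y => ?_, ?_, fun a b => ?_, fun b => ?_, fun a => ?_⟩
  · rw [DynFRT.FRT.twistedMul_eq hF]
    exact map_mul (DynFRT.DFRT.twistedEquiv hF ρ hR) x y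
  · exact map_one (DynFRT.DFRT.twistedEquiv hF ρ hR)
  · exact DynFRT.DFRT.toTwisted_T hF ρ hR a b
  · exact DynFRT.DFRT.toTwisted_t hF ρ hR b
  · exact DynFRT.DFRT.toTwisted_s hF ρ hR a
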